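/- **Setting.** A *quadratic-like map* is a holomorphic branched covering $f:U'\to U$ of degree two between topological disks (simply connected plane regions) with $\overline{U'}$ a compact subset of $U$, normalized so that its critical point is $0$. Its filled Julia set is $K(f)=\{z: f^n z\in U' \text{ for all } n\ge 0\}$. Assume that $K(f)$ is connected and that all fixed points of $f$ in $U'$ are repelling. Write $A\Subset B$ if $\overline A$ is compact and contained in $\operatorname{int} B$. *Rays and equipotentials.* Fix a homeomorphism $h$ from a neighborhood of $K(f)$ in $U'$ onto a neighborhood of the filled Julia set $K(P_c)$ of some $P_c(z)=z^2+c$, with $h(K(f))=K(P_c)$ and $h\circ f=P_c\circ h$. External rays and equipotentials of $f$ are the preimages under $h$ of those of $P_c$, which are defined by the Böttcher coordinate of $P_c$. Fix an equipotential $E$ of $f$ so close to $K(f)$ that $E$ and $fE$, with the domains they bound, lie in the domain of $h$. Let $\alpha$ be the dividing fixed point of $f$, i.e. the fixed point at which at least two external rays land, let $p$ be the common period of the rays landing at $\alpha$ (the denominator of its rotation number), and let $\alpha'\neq\alpha$ be the other preimage of $\alpha$. Assume that $f^n0\ne\alpha$ for all $n\ge 0$. *Puzzle pieces.* Let $\mathcal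 R$ be the union of $\alpha$ and the rays landing at $\alpha$. The pieces of depth $0$ are the closures of the components of (open domain bounded by $E$) $\setminus\mathcal R$; the one containing $0$ is $Y^{(0)}$. The pieces of depth $n$ are the connected components of the sets $f^{-n}Y$, $Y$ a piece of depth $0$. Let $Z^{(1)}_i$ be the pieces of depth $1$ that contain $\alpha'$ but not $0$. *Immediate renormalizability.* Let $\mathcal R'$ be the configuration symmetric to $\mathcal R$ (the preimage under $h$ of $-h(\mathcal R)$), and let $\Omega\ni0$ be the component of the open domain bounded by $E$ with $\mathcal R\cup\mathcal R'$ removed. $f$ is *immediately DH-renormalizable* if the component $\Omega'\subset\Omega$ of $f^{-p}\Omega$ with $\alpha\in\partial\Omega'$ contains $0$, and $f^{kp}0\in\Omega'$ for all $k\ge0$. *Principal nest.* The pull-back of a closed set $W$ along the orbit $z,fz,\dots,f^lz$ with $f^lz\in\operatorname{int}W$ is the set $W_{-l}$, where $W_0=W$ and $W_{-k}$ is the closure of the component of $f^{-1}(\operatorname{int}W_{-k+1})$ containing $f^{l-k}z$. Let $t>0$ be the first moment such that $f^{tp}0$ lies in some $Z^{(1)}_i$; then $V^0$ is the pull-back of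 this $Z^{(1)}_i$ along $0,f0,\dots,f^{tp}0$. If $l>0$ is the first moment with $f^l0\in\operatorname{int}V^n$, then $V^{n+1}$ is the pull-back of $V^n$ along $0,f0,\dots,f^l0$; if there is no such $l$, the nest stops at $V^n$. **Proposition 3.1.** Suppose that $f$ is not immediately DH-renormalizable. Then $V^0$ exists, $V^0\Subset Y^{(0)}$, and $V^{n+1}\Subset V^n$ for every $n\ge0$ such that $V^{n+1}$ exists. That is, the annulus $Y^{(0)}\setminus V^0$ and all annuli $A^n=V^n\setminus V^{n+1}$ are non-degenerate. -/

import Mathlib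

open Filter Topology Set

noncomputable section

namespace Yoccoz

/-- `A` is compactly (strictly) contained in `B`. For nested topological disks this says that
the annulus `B \ A` is non-degenerate. -/
def CompactlyContained (A B : Set ℂ) : Prop :=
  IsCompact (closure A) ∧ closure A ⊆ interior B

/-- A topological disk: a simply connected region of the plane. -/
def IsTopologicalDisk (U : Set ℂ) : Prop :=
  IsOpen U ∧ SimplyConnectedSpace U

/-- `f : U' → U` is a quadratic-like map with critical point `0`: a holomorphic proper map
(branched covering) of degree two between topological disks with `U'` compactly contained in `U`.
The map is the restriction of `f` to `U'`; values of `f` outside `U'` are irrelevant. -/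
structure IsQuadraticLike (f : ℂ → ℂ) (U' U : Set ℂ) : Prop where
  disk_dom : IsTopologicalDisk U'
  disk_range : IsTopologicalDisk U
  compactly : CompactlyContained U' U
  holo : DifferentiableOn ℂ f U'
  mapsTo : MapsTo f U' U
  proper : ∀ C ⊆ U, IsCompact C → IsCompact (U' ∩ f ⁻¹' C)
  zero_mem : (0 : ℂ) ∈ U'
  critical : deriv f 0 = 0
  fiber_critical : {z ∈ U' | f z = f 0} = {0}
  fiber : ∀ w ∈ U, w ≠ f 0 → {z ∈ U' | f z = w}.ncard = 2

/-- The filled Julia set of `f : U' → U`: the points whose orbit never leaves `U'`. -/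
def filledJulia (f : ℂ → ℂ) (U' : Set ℂ) : Set ℂ :=
  {z | ∀ n : ℕ, f^[n] z ∈ U'}

/-- The `n`-fold preimage of `S` under the partially defined map `f : U' → ℂ`. -/
def preimageIter (f : ℂ → ℂ) (U' : Set ℂ) (n : ℕ) (S : Set ℂ) : Set ℂ :=
  {z | (∀ k < n, f^[k] z ∈ U') ∧ f^[n] z ∈ S}

/-- The pull-back of `W` along the orbit `z, f z, …, f^l z` (meaningful if `f^l z ∈ int W`):
every step takes the closure of the component of the preimage of the interior that contains
the corresponding point of the orbit. -/
def pullback (f : ℂ → ℂ) (U' : Set ℂ) (W : Set ℂ) : ℕ → ℂ → Set ℂ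
  | 0, _ => W
  | l + 1, z => closure (connectedComponentIn (U' ∩ f ⁻¹' interior (pullback f U' W l (f z))) z)

/-! ### External rays and equipotentials of `z ↦ z ^ 2 + c` -/

/-- The quadratic polynomial `z ↦ z ^ 2 + c`. -/
def quad (c z : ℂ) : ℂ := z ^ 2 + c

/-- The filled Julia set of `z ↦ z ^ 2 + c`: the complement of the basin of infinity. -/
def quadFilledJulia (c : ℂ) : Set ℂ :=
  {z | ¬ Tendsto (fun n : ℕ => (quad c)^[n] z) atTop (cocompact ℂ)}

/-- `ψ` is the inverse of the Böttcher function of `z ↦ z ^ 2 + c` (in the case of a connected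
Julia set): the conformal map from the exterior of the unit disk onto the basin of infinity which
conjugates `w ↦ w ^ 2` to the polynomial and is tangent to the identity at infinity. -/
structure IsInverseBottcher (c : ℂ) (ψ : ℂ → ℂ) : Prop where
  holo : DifferentiableOn ℂ ψ {w | 1 < ‖w‖}
  bijOn : BijOn ψ {w | 1 < ‖w‖} (quadFilledJulia c)ᶜ
  conj : ∀ w : ℂ, 1 < ‖w‖ → ψ (w ^ 2) = quad c (ψ w)
  tangent : Tendsto (fun w => ψ w / w) (cocompact ℂ) (𝓝 1)

/-- The external ray whose angle is the direction `ζ` on the unit circle. -/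
def externalRay (ψ : ℂ → ℂ) (ζ : Circle) : Set ℂ :=
  (fun r : ℝ => ψ (r * ζ)) '' Ioi 1

/-- The directions of the external rays that land at `a`. -/
def landingAngles (ψ : ℂ → ℂ) (a : ℂ) : Set Circle :=
  {ζ | Tendsto (fun r : ℝ => ψ (r * ζ)) (𝓝[>] 1) (𝓝 a)}

/-- The rays landing at `a`, together with `a` itself. -/
def rayConfig (ψ : ℂ → ℂ) (a : ℂ) : Set ℂ :=
  insert a (⋃ ζ ∈ landingAngles ψ a, externalRay ψ ζ)

/-- The open domain bounded by the equipotential `ψ {|w| = r}`. -/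
def potentialDisk (c : ℂ) (ψ : ℂ → ℂ) (r : ℝ) : Set ℂ :=
  quadFilledJulia c ∪ ψ '' {w | 1 < ‖w‖ ∧ ‖w‖ < r}

/-- The closed domain bounded by the equipotential `ψ {|w| = r}`. -/
def closedPotentialDisk (c : ℂ) (ψ : ℂ → ℂ) (r : ℝ) : Set ℂ :=
  quadFilledJulia c ∪ ψ '' {w | 1 < ‖w‖ ∧ ‖w‖ ≤ r}

/-- `h` is a topological conjugacy from `f`, on a neighborhood of its filled Julia set, to
`z ↦ z ^ 2 + c` on a neighborhood of its filled Julia set. -/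
structure IsConjugacyToQuad (f : ℂ → ℂ) (U' : Set ℂ) (c : ℂ) (h : OpenPartialHomeomorph ℂ ℂ) :
    Prop where
  source_subset : h.source ⊆ U'
  filledJulia_subset : filledJulia f U' ⊆ h.source
  image_filledJulia : h '' filledJulia f U' = quadFilledJulia c
  conj : ∀ z ∈ h.source, f z ∈ h.source → h (f z) = quad c (h z)

/-- The choices from which the Yoccoz puzzle of `f : U' → ℂ` is made: a conjugacy `h` near the
filled Julia set to a quadratic polynomial, by which external rays and equipotentials of `f` are
defined; an equipotential `E`, of level `|w| = ρ`, so close to the filled Julia set that `E` and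
`f E` (of level `|w| = ρ ^ 2`) lie in the region where `h` is defined; and the dividing fixed
point `α`, that is, the fixed point at which at least two external rays land. -/
structure PuzzleData (f : ℂ → ℂ) (U' : Set ℂ) where
  c : ℂ
  ψ : ℂ → ℂ
  bottcher : IsInverseBottcher c ψ
  h : OpenPartialHomeomorph ℂ ℂ
  conj : IsConjugacyToQuad f U' c h
  ρ : ℝ
  one_lt_ρ : 1 < ρ
  level : closedPotentialDisk c ψ (ρ ^ 2) ⊆ h.target
  α : ℂ
  α_mem : α ∈ U'
  α_fixed : f α = α
  α_dividing : (landingAngles ψ (h α)).Nontrivial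

namespace PuzzleData

variable {f : ℂ → ℂ} {U' : Set ℂ} (P : PuzzleData f U')

/-- The open domain bounded by the equipotential `E` of `f`. -/
def domain : Set ℂ := P.h.source ∩ P.h ⁻¹' potentialDisk P.c P.ψ P.ρ

/-- The external rays of `f` landing at `α`, together with `α`. -/
def rays : Set ℂ := P.h.source ∩ P.h ⁻¹' rayConfig P.ψ (P.h P.α)

/-- The symmetric configuration, landing at the other preimage of `α`. -/
def symmRays : Set ℂ := {z ∈ P.h.source | -P.h z ∈ rayConfig P.ψ (P.h P.α)}

/-- The common period of the rays landing at `α`, that is, the denominator of the combinatorial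
rotation number of `α`. The ray in direction `ζ` is mapped to the ray in direction `ζ ^ 2`. -/
def period : ℕ :=
  sInf {p : ℕ | 0 < p ∧ ∀ ζ ∈ landingAngles P.ψ (P.h P.α), ζ ^ 2 ^ p = ζ}

/-- The puzzle pieces of depth zero: the closed pieces into which the rays landing at `α` cut the
domain bounded by `E`. -/
def zeroPieces : Set (Set ℂ) :=
  {Y | ∃ z ∈ P.domain \ P.rays, Y = closure (connectedComponentIn (P.domain \ P.rays) z)}

/-- The puzzle pieces of depth `n`: the components of the `n`-fold preimages of the pieces of
depth zero. -/
def pieces (n : ℕ) : Set (Set ℂ) :=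
  {Y | ∃ Y₀ ∈ P.zeroPieces, ∃ z ∈ preimageIter f U' n Y₀,
    Y = connectedComponentIn (preimageIter f U' n Y₀) z}

/-- The critical piece of depth zero. -/
def criticalPiece : Set ℂ := closure (connectedComponentIn (P.domain \ P.rays) 0)

/-- The non-critical puzzle pieces of depth one attached to the preimage `α' ≠ α` of `α`. -/
def symmPieces : Set (Set ℂ) :=
  {Z ∈ P.pieces 1 | (0 : ℂ) ∉ Z ∧ ∃ α' ∈ U', f α' = P.α ∧ α' ≠ P.α ∧ α' ∈ Z}

/-- The component `Ω` of the complement of the equipotential and of the two ray configurations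
that contains the critical point. -/
def renormRange : Set ℂ := connectedComponentIn (P.domain \ (P.rays ∪ P.symmRays)) 0

/-- The component `Ω'` of the `p`-fold preimage of `Ω` that contains the critical point. -/
def renormDomain : Set ℂ :=
  connectedComponentIn (preimageIter f U' P.period P.renormRange) 0

/-- `f` is immediately renormalizable in the sense of Douady and Hubbard: the component `Ω' ⊆ Ω`
of the `p`-fold preimage of `Ω` attached to `α` contains the critical point, and the critical
point does not escape `Ω'` under iterates of `f ^ p`. -/
def ImmediatelyRenormalizable : Prop :=
  P.renormDomain ⊆ P.renormRange ∧ P.α ∈ frontier P.renormDomain ∧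
    ∀ k : ℕ, f^[k * P.period] 0 ∈ P.renormDomain

/-- `V` is the first piece `V⁰` of the principal nest: the pull-back of `Z` along
`0, f 0, …, f^(tp) 0`, where `t > 0` is the first moment such that `f^(tp) 0` is in a
non-critical piece of depth one attached to `α'`, and `Z` is this piece. -/
def IsInitialNestPiece (V : Set ℂ) : Prop :=
  ∃ t : ℕ, IsLeast {s : ℕ | 0 < s ∧ ∃ Z ∈ P.symmPieces, f^[s * P.period] 0 ∈ Z} t ∧
    ∃ Z ∈ P.symmPieces, f^[t * P.period] 0 ∈ interior Z ∧
      V = pullback f U' Z (t * P.period) 0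

end PuzzleData

/-- `V'` is the pull-back of `V` corresponding to the first return of the critical point to the
interior of `V`. There is no such `V'` if the critical point never returns. -/
def IsFirstReturnPullback (f : ℂ → ℂ) (U' : Set ℂ) (V V' : Set ℂ) : Prop :=
  ∃ l : ℕ, IsLeast {k : ℕ | 0 < k ∧ f^[k] 0 ∈ interior V} l ∧ V' = pullback f U' V l 0

/-- `P.IsNestPiece n V`: the principal nest has a piece `Vⁿ` of level `n`, and it is `V`. -/
inductive PuzzleData.IsNestPiece {f : ℂ → ℂ} {U' : Set ℂ} (P : PuzzleData f U') :
    ℕ → Set ℂ → Prop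
  | zero {V : Set ℂ} : P.IsInitialNestPiece V → P.IsNestPiece 0 V
  | succ {n : ℕ} {V V' : Set ℂ} : P.IsNestPiece n V → IsFirstReturnPullback f U' V V' →
      P.IsNestPiece (n + 1) V'

end Yoccoz

end

namespace Yoccoz

/-! ### The polynomial plane -/

/-! All strict inclusions come from one property. Call an open piece `O` nice if no boundary point
of `O` ever returns to the closure of `O` (`IsNice`). Let `O'` be the pull-back of a nice `O` along
the first return of the critical point, at time `l`. A boundary point of `O` in the closure of `O'`
would be back in the closure of `O` at time `l`, so `closure O' ⊆ O`. Moreover `O'` is again nice: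
before time `l` its images miss `O`, at time `l` its boundary goes to the boundary of `O`, and from
there nothing comes back (`IsNice.firstReturn`). It remains to produce `V⁰`, place it and show that
it is nice.

In the polynomial plane the rays landing at the dividing fixed point `a` cut the plane into sectors,
one on the positive side of each ray; `separation` shows that these differ, by the monodromy of `log
(z - a)`. The critical sector contains the whole configuration opposite to the rays, the landing
point `-a` included. The other sectors are mapped bijectively onto the next one. Off the opposite
rays, the critical sector splits into the preimage of the sector of the critical value and the
mirror images of the noncritical sectors (`crit_cases`). Truncation by equipotentials and transfer
by `h` turn this into pieces of depth zero and one. A closed mirror piece lies in the open critical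
piece, because the opposite rays miss the rays at `a` and the level drops from `ρ` to `√ρ`. Pulling
this inclusion back around the cycle of sectors locates `V⁰` (`closure_openPullback_subset`) and
gives its niceness (`isNice_initial`).

If `V⁰` did not exist, the critical orbit at multiples of `p` would stay in the central piece
forever. Then the range `Ω` can be pulled back univalently through the noncritical sectors and once
more through the critical point, with `α` staying in the closure: `f` is immediately renormalizable
(`immediatelyRenormalizable`).

All this needs finitely many rays at `α` with a common period, whereas the data only say that there
are at least two. This is deduced from `α` being repelling. A contracting inverse branch acts on the
components of the basin near `a` that contain the ends of rays. Two components along a backward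
orbit of rays must coincide: otherwise they become thin, and the maxima of the Green function on
them would double at each step (`exists_comp_eq`). Inside one component, branches of high roots in
the Böttcher coordinate become almost constant, which yields a periodic direction in the closure of
the landing directions (`exists_periodic_mem_closure`). The landing directions lie in a half circle,
where angle doubling has a monotone lift of degree one; hence every direction is eventually
periodic, and, as doubling is injective on these directions, periodic (`exists_common_period`). -/

lemma tendsto_cocompact_iff_tendsto_norm {ι : Type*} {l : Filter ι} {F : ι → ℂ} :
    Tendsto F l (cocompact ℂ) ↔ Tendsto (fun i => ‖F i‖) l atTop := by
  rw [← Metric.cobounded_eq_cocompact, tendsto_norm_atTop_iff_cobounded]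

lemma quad_neg (c z : ℂ) : quad c (-z) = quad c z := by simp [quad]

lemma quad_eq_quad_iff {c z w : ℂ} : quad c z = quad c w ↔ z = w ∨ z = -w := by
  simp [quad, sq_eq_sq_iff_eq_or_eq_neg]

lemma continuous_quad (c : ℂ) : Continuous (quad c) := by unfold quad; fun_prop

lemma quad_mem_quadFilledJulia {c z : ℂ} :
    quad c z ∈ quadFilledJulia c ↔ z ∈ quadFilledJulia c := by
  simp only [quadFilledJulia, mem_ofPred_eq, ← Function.iterate_succ_apply]
  rw [tendsto_add_atTop_iff_nat (f := fun n => (quad c)^[n] z) 1]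

lemma neg_mem_quadFilledJulia {c z : ℂ} : -z ∈ quadFilledJulia c ↔ z ∈ quadFilledJulia c := by
  rw [← quad_mem_quadFilledJulia, quad_neg, quad_mem_quadFilledJulia]

lemma iterate_quad_mem {c z : ℂ} (hz : z ∈ quadFilledJulia c) (n : ℕ) :
    (quad c)^[n] z ∈ quadFilledJulia c := by
  induction n with
  | zero => exact hz
  | succ n ih => rw [Function.iterate_succ_apply']; exact quad_mem_quadFilledJulia.2 ih

lemma mem_quadFilledJulia_of_fixed {c a : ℂ} (ha : quad c a = a) : a ∈ quadFilledJulia c := by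
  intro h
  simp only [Function.iterate_fixed ha] at h
  obtain ⟨n, hn⟩ := (h.eventually (isCompact_singleton (x := a)).compl_mem_cocompact).exists
  exact hn rfl

/-- The halves make the estimate iterate: in terms of `‖z‖ / 2` each step at least squares. -/
lemma norm_quad_ge {c z : ℂ} (h4 : 4 ≤ ‖z‖) (hc : ‖c‖ ≤ ‖z‖) : (‖z‖ / 2) ^ 2 ≤ ‖quad c z‖ / 2 := by
  have h1 : ‖z ^ 2‖ - ‖c‖ ≤ ‖z ^ 2 + c‖ := by
    have := norm_sub_norm_le (z ^ 2) (-c)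
    simpa using this
  rw [norm_pow] at h1
  unfold quad
  nlinarith

lemma norm_iterate_quad_ge {c z : ℂ} (h4 : 4 ≤ ‖z‖) (hc : ‖c‖ ≤ ‖z‖) (n : ℕ) :
    (‖z‖ / 2) ^ 2 ^ n ≤ ‖(quad c)^[n] z‖ / 2 ∧ ‖z‖ ≤ ‖(quad c)^[n] z‖ := by
  induction n with
  | zero => simp
  | succ n ih =>
    rw [Function.iterate_succ_apply']
    have h := norm_quad_ge (c := c) (z := (quad c)^[n] z) (h4.trans ih.2) (hc.trans ih.2)
    constructor
    · refine le_trans ?_ h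
      rw [pow_succ 2 n, pow_mul]
      gcongr
      exact ih.1
    · nlinarith [ih.2]

/-- Points of large modulus escape. -/
lemma notMem_quadFilledJulia {c z : ℂ} (h4 : 5 ≤ ‖z‖) (hc : ‖c‖ ≤ ‖z‖) :
    z ∉ quadFilledJulia c := by
  intro hz
  apply hz
  rw [tendsto_cocompact_iff_tendsto_norm]
  have h1 : Tendsto (fun n : ℕ => (‖z‖ / 2) ^ 2 ^ n) atTop atTop :=
    (tendsto_pow_atTop_atTop_of_one_lt (by linarith)).comp
      (tendsto_pow_atTop_atTop_of_one_lt (by norm_num))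
  refine tendsto_atTop_mono (fun n => ?_) h1
  have := (norm_iterate_quad_ge (c := c) (by linarith : 4 ≤ ‖z‖) hc n).1
  have h0 := norm_nonneg ((quad c)^[n] z)
  linarith

namespace IsInverseBottcher

variable {c : ℂ} {ψ : ℂ → ℂ} (hψ : IsInverseBottcher c ψ)
include hψ

lemma injOn : InjOn ψ {w | 1 < ‖w‖} := hψ.bijOn.injOn

lemma notMem {w : ℂ} (hw : 1 < ‖w‖) : ψ w ∉ quadFilledJulia c := hψ.bijOn.mapsTo hw

lemma exists_of_notMem {z : ℂ} (hz : z ∉ quadFilledJulia c) : ∃ w, 1 < ‖w‖ ∧ ψ w = z :=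
  hψ.bijOn.surjOn hz

lemma continuousOn : ContinuousOn ψ {w | 1 < ‖w‖} := hψ.holo.continuousOn

/-- The values at `w` and `-w` have the same image under the polynomial, so they agree up to sign,
and injectivity rules out equality. -/
lemma map_neg {w : ℂ} (hw : 1 < ‖w‖) : ψ (-w) = -ψ w := by
  have h1 := hψ.conj w hw
  have h2 := hψ.conj (-w) (by simpa)
  rw [neg_sq, h1] at h2
  rcases quad_eq_quad_iff.1 h2 with h | h
  · have := hψ.injOn hw (by simpa : 1 < ‖-w‖) h
    have h0 : w = 0 := self_eq_neg.1 this
    simp [h0] at hw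
    linarith
  · rw [h, neg_neg]

lemma iterate {w : ℂ} (hw : 1 < ‖w‖) (n : ℕ) : (quad c)^[n] (ψ w) = ψ (w ^ 2 ^ n) := by
  induction n with
  | zero => simp
  | succ n ih =>
    rw [Function.iterate_succ_apply', ih, pow_succ, pow_mul, hψ.conj]
    rw [norm_pow]
    exact one_lt_pow₀ hw (by positivity)

/-- An odd injective map on the exterior of the disk cannot take the value zero. -/
lemma zero_mem : (0 : ℂ) ∈ quadFilledJulia c := by
  by_contra h
  obtain ⟨w, hw, h0⟩ := hψ.exists_of_notMem h
  have h1 := hψ.map_neg hw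
  rw [h0, neg_zero, ← h0] at h1
  have h2 := hψ.injOn (by simpa : 1 < ‖-w‖) hw h1
  have h0 : w = 0 := neg_eq_self.1 h2
  simp [h0] at hw
  linarith

lemma analyticOnNhd : AnalyticOnNhd ℂ ψ {w | 1 < ‖w‖} :=
  hψ.holo.analyticOnNhd (isOpen_lt continuous_const continuous_norm)

lemma isOpen_image {V : Set ℂ} (hV : IsOpen V) (hVE : V ⊆ {w | 1 < ‖w‖}) : IsOpen (ψ '' V) := by
  rw [isOpen_iff_mem_nhds]
  rintro _ ⟨w, hw, rfl⟩
  obtain ⟨ε, hε, hball⟩ := Metric.isOpen_iff.1 hV w hw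
  have han : AnalyticOnNhd ℂ ψ (Metric.ball w ε) := fun z hz => hψ.analyticOnNhd z (hVE (hball hz))
  rcases han.is_constant_or_isOpen (convex_ball w ε).isPreconnected with ⟨w', h⟩ | h
  · exfalso
    have hmem : w + (ε / 2 : ℝ) ∈ Metric.ball w ε := by
      simp [abs_of_pos hε, hε]
    have h1 := h w (Metric.mem_ball_self hε)
    have h2 := h _ hmem
    have := hψ.injOn (hVE hw) (hVE (hball hmem)) (h1.trans h2.symm)
    simp [hε.ne'] at this
  · exact mem_of_superset ((h _ subset_rfl Metric.isOpen_ball).mem_nhds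
      (mem_image_of_mem _ (Metric.mem_ball_self hε))) (image_mono hball)

lemma eventually_norm_le : ∀ᶠ w in cocompact ℂ, ‖w‖ / 2 ≤ ‖ψ w‖ ∧ ‖ψ w‖ ≤ 2 * ‖w‖ := by
  have h1 := hψ.tangent.norm
  rw [norm_one] at h1
  have h2 := h1.eventually (Ioo_mem_nhds (by norm_num : (1 / 2 : ℝ) < 1) (by norm_num : (1 : ℝ) < 2))
  have h3 : ∀ᶠ w in cocompact ℂ, w ∈ ({0} : Set ℂ)ᶜ :=
    (isCompact_singleton (x := (0 : ℂ))).compl_mem_cocompact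
  filter_upwards [h2, h3] with w hw hw0
  have hpos : 0 < ‖w‖ := norm_pos_iff.2 hw0
  rw [norm_div] at hw
  rw [lt_div_iff₀ hpos, div_lt_iff₀ hpos] at hw
  constructor <;> linarith [hw.1, hw.2]

lemma tendsto_cocompact : Tendsto ψ (cocompact ℂ) (cocompact ℂ) := by
  rw [tendsto_cocompact_iff_tendsto_norm]
  have h1 : Tendsto (fun w : ℂ => ‖w‖ / 2) (cocompact ℂ) atTop :=
    (tendsto_norm_cocompact_atTop).atTop_div_const (by norm_num)
  exact tendsto_atTop_mono' _ (hψ.eventually_norm_le.mono fun w hw => hw.1) h1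

/-- Images of closed sets which stay away from the unit circle are closed. -/
lemma isClosed_image {F : Set ℂ} (hF : IsClosed F) (hFE : F ⊆ {w | 1 < ‖w‖}) :
    IsClosed (ψ '' F) := by
  refine isClosed_of_closure_subset fun z hz => ?_
  have hev := hψ.tendsto_cocompact.eventually (isCompact_closedBall z 1).compl_mem_cocompact
  obtain ⟨C, hC, hCsub⟩ := mem_cocompact.1 hev
  have hz' : z ∈ closure (ψ '' (F ∩ C)) := by
    rw [mem_closure_iff_nhds] at hz ⊢
    intro t ht
    obtain ⟨y, ⟨hyt, hyb⟩, w, hw, rfl⟩ := hz (t ∩ Metric.closedBall z 1)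
      (inter_mem ht (Metric.closedBall_mem_nhds z one_pos))
    refine ⟨ψ w, hyt, w, ⟨hw, ?_⟩, rfl⟩
    by_contra hwC
    exact hCsub hwC hyb
  have hcomp : IsCompact (ψ '' (F ∩ C)) :=
    (hC.inter_left hF).image_of_continuousOn (hψ.continuousOn.mono (inter_subset_left.trans hFE))
  rw [hcomp.isClosed.closure_eq] at hz'
  exact image_mono inter_subset_left hz'

lemma isClosed_quadFilledJulia : IsClosed (quadFilledJulia c) := by
  rw [← isOpen_compl_iff, ← hψ.bijOn.image_eq]
  exact hψ.isOpen_image (isOpen_lt continuous_const continuous_norm) subset_rfl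

lemma mem_potentialDisk {r : ℝ} {w : ℂ} (hw : 1 < ‖w‖) : ψ w ∈ potentialDisk c ψ r ↔ ‖w‖ < r := by
  constructor
  · rintro (h | ⟨w', hw', h⟩)
    · exact absurd h (hψ.notMem hw)
    · rw [← hψ.injOn hw'.1 hw h]; exact hw'.2
  · intro h
    exact Or.inr ⟨w, ⟨hw, h⟩, rfl⟩

lemma mem_closedPotentialDisk {r : ℝ} {w : ℂ} (hw : 1 < ‖w‖) :
    ψ w ∈ closedPotentialDisk c ψ r ↔ ‖w‖ ≤ r := by
  constructor
  · rintro (h | ⟨w', hw', h⟩)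
    · exact absurd h (hψ.notMem hw)
    · rw [← hψ.injOn hw'.1 hw h]; exact hw'.2
  · intro h
    exact Or.inr ⟨w, ⟨hw, h⟩, rfl⟩

lemma compl_potentialDisk {r : ℝ} : (potentialDisk c ψ r)ᶜ = ψ '' {w | 1 < ‖w‖ ∧ r ≤ ‖w‖} := by
  ext z
  by_cases hz : z ∈ quadFilledJulia c
  · simp only [mem_compl_iff, mem_image]
    refine ⟨fun h => absurd (Or.inl hz) h, ?_⟩
    rintro ⟨w, hw, rfl⟩
    exact absurd hz (hψ.notMem hw.1)
  · obtain ⟨w, hw, rfl⟩ := hψ.exists_of_notMem hz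
    rw [mem_compl_iff, hψ.mem_potentialDisk hw, not_lt]
    refine ⟨fun h => ⟨w, ⟨hw, h⟩, rfl⟩, ?_⟩
    rintro ⟨w', hw', h⟩
    rw [← hψ.injOn hw'.1 hw h]; exact hw'.2

lemma compl_closedPotentialDisk {r : ℝ} :
    (closedPotentialDisk c ψ r)ᶜ = ψ '' {w | 1 < ‖w‖ ∧ r < ‖w‖} := by
  ext z
  by_cases hz : z ∈ quadFilledJulia c
  · simp only [mem_compl_iff, mem_image]
    refine ⟨fun h => absurd (Or.inl hz) h, ?_⟩
    rintro ⟨w, hw, rfl⟩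
    exact absurd hz (hψ.notMem hw.1)
  · obtain ⟨w, hw, rfl⟩ := hψ.exists_of_notMem hz
    rw [mem_compl_iff, hψ.mem_closedPotentialDisk hw, not_le]
    refine ⟨fun h => ⟨w, ⟨hw, h⟩, rfl⟩, ?_⟩
    rintro ⟨w', hw', h⟩
    rw [← hψ.injOn hw'.1 hw h]; exact hw'.2

lemma isOpen_potentialDisk {r : ℝ} (hr : 1 < r) : IsOpen (potentialDisk c ψ r) := by
  rw [← isClosed_compl_iff, hψ.compl_potentialDisk]
  have : {w : ℂ | 1 < ‖w‖ ∧ r ≤ ‖w‖} = {w | r ≤ ‖w‖} := by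
    ext w; simp only [mem_ofPred_eq, and_iff_right_iff_imp]; intro h; linarith
  rw [this]
  exact hψ.isClosed_image (isClosed_le continuous_const continuous_norm)
    (fun w hw => lt_of_lt_of_le hr hw)

lemma isClosed_closedPotentialDisk {r : ℝ} : IsClosed (closedPotentialDisk c ψ r) := by
  rw [← isOpen_compl_iff, hψ.compl_closedPotentialDisk]
  exact hψ.isOpen_image ((isOpen_lt continuous_const continuous_norm).inter
    (isOpen_lt continuous_const continuous_norm)) (fun w hw => hw.1)

/-- The comparison of `‖ψ w‖` with `‖w‖` is known only near infinity. Applying it to a far iterate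
and taking a root of order `2 ^ n` extends it to every point of large modulus, which bounds the
disk. -/
lemma isCompact_closedPotentialDisk {r : ℝ} : IsCompact (closedPotentialDisk c ψ r) := by
  refine Metric.isCompact_of_isClosed_isBounded hψ.isClosed_closedPotentialDisk ?_
  refine (Metric.isBounded_iff_subset_closedBall 0).2 ⟨‖c‖ + 5 + 4 * |r|, fun z hz => ?_⟩
  rw [mem_closedBall_zero_iff]
  by_contra! hlt
  have h5 : 5 ≤ ‖z‖ := by linarith [norm_nonneg c, abs_nonneg r]
  have hc : ‖c‖ ≤ ‖z‖ := by linarith [norm_nonneg c, abs_nonneg r]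
  obtain ⟨w, hw, rfl⟩ := hψ.exists_of_notMem (notMem_quadFilledJulia h5 hc)
  rw [hψ.mem_closedPotentialDisk hw] at hz
  have ht : Tendsto (fun n : ℕ => w ^ 2 ^ n) atTop (cocompact ℂ) := by
    rw [tendsto_cocompact_iff_tendsto_norm]
    simp only [norm_pow]
    exact (tendsto_pow_atTop_atTop_of_one_lt hw).comp
      (tendsto_pow_atTop_atTop_of_one_lt (by norm_num))
  obtain ⟨n, hn⟩ := (ht.eventually hψ.eventually_norm_le).exists
  have h1 := (norm_iterate_quad_ge (c := c) (by linarith : 4 ≤ ‖ψ w‖) hc n).1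
  rw [hψ.iterate hw, ] at h1
  have h2 : (‖ψ w‖ / 2) ^ 2 ^ n ≤ ‖w‖ ^ 2 ^ n := by
    rw [← norm_pow]; linarith [hn.2]
  have h3 := (pow_le_pow_iff_left₀ (by positivity) (by positivity)
    (by positivity : (2 : ℕ) ^ n ≠ 0)).1 h2
  linarith [le_abs_self r, norm_nonneg c, abs_nonneg r]

omit hψ in
lemma potentialDisk_subset_closed {r : ℝ} : potentialDisk c ψ r ⊆ closedPotentialDisk c ψ r :=
  union_subset_union_right _ (image_mono fun _ hw => ⟨hw.1, hw.2.le⟩)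

lemma quad_mem_potentialDisk {r : ℝ} (hr : 0 ≤ r) {z : ℂ} :
    quad c z ∈ potentialDisk c ψ (r ^ 2) ↔ z ∈ potentialDisk c ψ r := by
  by_cases hz : z ∈ quadFilledJulia c
  · exact ⟨fun _ => Or.inl hz, fun _ => Or.inl (quad_mem_quadFilledJulia.2 hz)⟩
  · obtain ⟨w, hw, rfl⟩ := hψ.exists_of_notMem hz
    rw [← hψ.conj w hw, hψ.mem_potentialDisk hw, hψ.mem_potentialDisk, norm_pow]
    · exact pow_lt_pow_iff_left₀ (norm_nonneg _) hr two_ne_zero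
    · rw [norm_pow]; exact one_lt_pow₀ hw two_ne_zero

lemma neg_mem_potentialDisk {r : ℝ} (hr : 0 ≤ r) {z : ℂ} :
    -z ∈ potentialDisk c ψ r ↔ z ∈ potentialDisk c ψ r := by
  rw [← hψ.quad_mem_potentialDisk hr, quad_neg, hψ.quad_mem_potentialDisk hr]

end IsInverseBottcher
end Yoccoz

namespace Yoccoz

/-! ### Two rays with a common landing point separate the plane -/

lemma Circle_norm_mul (r : ℝ) (ζ : Circle) : ‖(r : ℂ) * ζ‖ = |r| := by
  rw [norm_mul, Circle.norm_coe, mul_one, Complex.norm_real, Real.norm_eq_abs]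

lemma one_lt_norm_mul {r : ℝ} (hr : 1 < r) (ζ : Circle) : 1 < ‖(r : ℂ) * ζ‖ := by
  rw [Circle_norm_mul, abs_of_pos (by linarith)]; exact hr

lemma exists_polar (w : ℂ) : ∃ ζ : Circle, w = (‖w‖ : ℝ) * ζ := by
  refine ⟨Circle.exp w.arg, ?_⟩
  rw [Circle.coe_exp]
  exact (Complex.norm_mul_exp_arg_mul_I w).symm

lemma exists_angle (θ ζ : Circle) : ∃ t ∈ Ico 0 (2 * Real.pi), ζ = θ * Circle.exp t := by
  obtain ⟨s, hs⟩ : ∃ s : ℝ, Circle.exp s = θ⁻¹ * ζ := ⟨_, Circle.exp_arg _⟩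
  refine ⟨toIcoMod Real.two_pi_pos 0 s, ?_, ?_⟩
  · simpa using toIcoMod_mem_Ico Real.two_pi_pos 0 s
  · have : Circle.exp (toIcoMod Real.two_pi_pos 0 s) = Circle.exp s := by
      rw [toIcoMod, zsmul_eq_mul]
      exact Circle.periodic_exp.sub_int_mul_eq _
    rw [this, hs, mul_inv_cancel_left]

lemma circle_exp_inj {θ : Circle} {s t : ℝ} (hs : 0 ≤ s) (hs' : s < 2 * Real.pi) (ht : 0 ≤ t)
    (ht' : t < 2 * Real.pi) (h : θ * Circle.exp s = θ * Circle.exp t) : s = t := by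
  obtain ⟨m, hm⟩ := Circle.exp_eq_exp.1 (mul_left_cancel h)
  have hm0 : m = 0 := by
    have h1 : (m : ℝ) * (2 * Real.pi) < 1 * (2 * Real.pi) := by linarith
    have h2 : (-1 : ℝ) * (2 * Real.pi) < m * (2 * Real.pi) := by linarith
    have h1' := lt_of_mul_lt_mul_right h1 Real.two_pi_pos.le
    have h2' := lt_of_mul_lt_mul_right h2 Real.two_pi_pos.le
    have h1'' : m < 1 := by exact_mod_cast h1'
    have h2'' : -1 < m := by exact_mod_cast h2'
    omega
  simpa [hm0] using hm

/-- The sector of the basin of infinity formed by the rays with angles between `θ e^{is}` and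
`θ e^{it}`. -/
def raySector (ψ : ℂ → ℂ) (θ : Circle) (s t : ℝ) : Set ℂ :=
  (fun p : ℝ × ℝ => ψ (p.1 * (θ * Circle.exp p.2 : Circle))) '' (Ioi 1 ×ˢ Ioo s t)

/-- The ray in direction `ζ`, extended by its landing point `a`. -/
def closedRay (ψ : ℂ → ℂ) (a : ℂ) (ζ : Circle) : Set ℂ := insert a (externalRay ψ ζ)

open Classical in
/-- A parametrization of `closedRay` by the real line, constant on `r ≤ 1`. -/
noncomputable def closedRayMap (ψ : ℂ → ℂ) (a : ℂ) (ζ : Circle) (r : ℝ) : ℂ :=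
  if r ≤ 1 then a else ψ (r * ζ)

lemma range_closedRayMap (ψ : ℂ → ℂ) (a : ℂ) (ζ : Circle) :
    range (closedRayMap ψ a ζ) = closedRay ψ a ζ := by
  ext z
  constructor
  · rintro ⟨r, rfl⟩
    by_cases hr : r ≤ 1
    · simp [closedRayMap, hr, closedRay]
    · simp only [closedRayMap, hr, if_false]
      exact Or.inr ⟨r, not_le.1 hr, rfl⟩
  · rintro (rfl | ⟨r, hr, rfl⟩)
    · exact ⟨0, by simp [closedRayMap]⟩
    · exact ⟨r, by simp [closedRayMap, not_le.2 (mem_Ioi.1 hr)]⟩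

/-- A continuous logarithm of `z - a` on the complement of a point does not exist. -/
lemma no_log_compl_point (a : ℂ) (L : ℂ → ℂ) (hL : ContinuousOn L {a}ᶜ)
    (hexp : ∀ z, z ≠ a → Complex.exp (L z) = z - a) : False := by
  have hne : ∀ t : ℝ, a + Complex.exp (t * Complex.I) ≠ a := fun t h =>
    Complex.exp_ne_zero _ (add_eq_left.1 h)
  have hc1 : ContinuousOn (fun t : ℝ => L (a + Complex.exp (t * Complex.I))) univ :=
    hL.comp (by fun_prop) (fun t _ => hne t)
  -- Along the unit circle about `a` the logarithm must equal `it` plus a constant, which does not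
  -- close up after a full turn.
  have heq := Complex.isCoveringMap_exp.eqOn_of_comp_eqOn isPreconnected_univ hc1
    (g₂ := fun t : ℝ => (t : ℂ) * Complex.I + L (a + 1)) (by fun_prop)
    (by
      intro t _
      simp only [Function.comp, Subtype.mk.injEq]
      rw [hexp _ (hne t), Complex.exp_add, hexp (a + 1) (by simp)]
      ring)
    (mem_univ 0) (by simp)
  have := heq (mem_univ (2 * Real.pi))
  simp [Complex.exp_two_pi_mul_I, Real.pi_ne_zero] at this

lemma const_of_exp_eq {S : Set ℂ} (hS : IsPreconnected S) {F G : ℂ → ℂ} (hF : ContinuousOn F S)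
    (hG : ContinuousOn G S) (h : ∀ z ∈ S, Complex.exp (F z) = Complex.exp (G z)) {z₀ : ℂ}
    (hz₀ : z₀ ∈ S) : ∀ z ∈ S, F z = G z + (F z₀ - G z₀) := by
  refine Complex.isCoveringMap_exp.eqOn_of_comp_eqOn hS hF (hG.add continuousOn_const) ?_ hz₀
    (by ring)
  intro z hz
  simp only [Function.comp, Subtype.mk.injEq]
  rw [Complex.exp_add, Complex.exp_sub, h z hz, h z₀ hz₀, div_self (Complex.exp_ne_zero _), mul_one]

namespace IsInverseBottcher

variable {c : ℂ} {ψ : ℂ → ℂ} (hψ : IsInverseBottcher c ψ)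
include hψ

lemma continuous_closedRayMap {a : ℂ} {ζ : Circle} (hζ : ζ ∈ landingAngles ψ a) :
    Continuous (closedRayMap ψ a ζ) := by
  rw [continuous_iff_continuousAt]
  intro r
  rcases lt_trichotomy r 1 with hr | rfl | hr
  · refine (continuousAt_const (y := a)).congr ?_
    filter_upwards [Iio_mem_nhds hr] with s hs
    simp [closedRayMap, (mem_Iio.1 hs).le]
  · rw [continuousAt_iff_continuous_left'_right']
    constructor
    · refine (continuousWithinAt_const (b := a)).congr (fun s hs => ?_) ?_
      · simp [closedRayMap, (mem_Iio.1 hs).le]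
      · simp [closedRayMap]
    · have h1 : closedRayMap ψ a ζ 1 = a := by simp [closedRayMap]
      rw [ContinuousWithinAt, h1]
      refine Tendsto.congr' ?_ hζ
      filter_upwards [self_mem_nhdsWithin] with s hs
      simp [closedRayMap, not_le.2 (mem_Ioi.1 hs)]
  · have h1 : ContinuousAt (fun s : ℝ => ψ (s * ζ)) r := by
      refine ContinuousAt.comp (f := fun s : ℝ => (s : ℂ) * ζ) (g := ψ) ?_ (by fun_prop)
      exact hψ.continuousOn.continuousAt
        ((isOpen_lt continuous_const continuous_norm).mem_nhds (one_lt_norm_mul hr ζ))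
    refine h1.congr ?_
    filter_upwards [Ioi_mem_nhds hr] with s hs
    simp [closedRayMap, not_le.2 (mem_Ioi.1 hs)]

lemma tendsto_closedRayMap (a : ℂ) (ζ : Circle) :
    Tendsto (closedRayMap ψ a ζ) atTop (cocompact ℂ) := by
  have h1 : Tendsto (fun r : ℝ => (r : ℂ) * ζ) atTop (cocompact ℂ) := by
    rw [tendsto_cocompact_iff_tendsto_norm]
    simp only [Circle_norm_mul]
    exact tendsto_abs_atTop_atTop
  refine (hψ.tendsto_cocompact.comp h1).congr' ?_
  filter_upwards [eventually_gt_atTop 1] with s hs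
  simp [closedRayMap, not_le.2 hs]

lemma isClosed_closedRay {a : ℂ} {ζ : Circle} (hζ : ζ ∈ landingAngles ψ a) :
    IsClosed (closedRay ψ a ζ) := by
  have hp : IsProperMap (fun r : ℝ => closedRayMap ψ a ζ |r|) := by
    rw [isProperMap_iff_tendsto_cocompact]
    refine ⟨(hψ.continuous_closedRayMap hζ).comp continuous_abs, ?_⟩
    exact (hψ.tendsto_closedRayMap a ζ).comp (tendsto_norm_cocompact_atTop (E := ℝ))
  have : closedRay ψ a ζ = range (fun r : ℝ => closedRayMap ψ a ζ |r|) := by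
    rw [← range_closedRayMap]
    refine subset_antisymm ?_ (range_subset_iff.2 fun r => mem_range_self _)
    rintro _ ⟨r, rfl⟩
    rcases le_total 0 r with h | h
    · exact ⟨r, by simp [abs_of_nonneg h]⟩
    · refine ⟨0, ?_⟩
      simp [closedRayMap, h.trans zero_le_one]
  rw [this]
  exact hp.isClosedMap.isClosed_range

lemma isPreconnected_closedRay {a : ℂ} {ζ : Circle} (hζ : ζ ∈ landingAngles ψ a) :
    IsPreconnected (closedRay ψ a ζ) := by
  rw [← range_closedRayMap]
  exact isPreconnected_range (hψ.continuous_closedRayMap hζ)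

lemma closedRayMap_ne_zero {a : ℂ} (ha : a ≠ 0) (ζ : Circle) (r : ℝ) :
    closedRayMap ψ a ζ r ≠ 0 := by
  unfold closedRayMap
  split_ifs with h
  · exact ha
  · intro h0
    exact hψ.notMem (one_lt_norm_mul (not_le.1 h) ζ) (h0 ▸ hψ.zero_mem)

/-- A ray from `a` to infinity admits a branch of `log (z - a)` in its complement. -/
lemma exists_log_compl_closedRay {a : ℂ} (ha : a ≠ 0) {ζ : Circle}
    (hζ : ζ ∈ landingAngles ψ a) : ∃ L : ℂ → ℂ, ContinuousOn L (closedRay ψ a ζ)ᶜ ∧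
      ∀ z ∉ closedRay ψ a ζ, Complex.exp (L z) = z - a := by
  classical
  -- `Y` is the reciprocal of the ray travelled from infinity to `a`, so `1 - z * Y s` vanishes only
  -- if `z` is on the ray. It is `1` at `s = 0` and `1 - z / a` at `s = 1`.
  set Y : ℝ → ℂ := fun s => if s ≤ 0 then 0 else (closedRayMap ψ a ζ s⁻¹)⁻¹ with hY
  have hYc : Continuous Y := by
    rw [continuous_iff_continuousAt]
    intro s
    rcases lt_trichotomy s 0 with hs | rfl | hs
    · refine (continuousAt_const (y := 0)).congr ?_
      filter_upwards [Iio_mem_nhds hs] with t ht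
      simp [hY, (mem_Iio.1 ht).le]
    · rw [continuousAt_iff_continuous_left'_right']
      constructor
      · refine (continuousWithinAt_const (b := 0)).congr (fun t ht => ?_) ?_
        · simp [hY, (mem_Iio.1 ht).le]
        · simp [hY]
      · have h1 : Y 0 = 0 := by simp [hY]
        rw [ContinuousWithinAt, h1]
        have h2 := tendsto_inv₀_cobounded (α := ℂ)
        rw [Metric.cobounded_eq_cocompact] at h2
        refine Tendsto.congr' ?_ (h2.comp ((hψ.tendsto_closedRayMap a ζ).comp
          tendsto_inv_nhdsGT_zero))
        filter_upwards [self_mem_nhdsWithin] with t ht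
        simp [hY, not_le.2 (mem_Ioi.1 ht)]
    · have h1 : ContinuousAt (fun t : ℝ => (closedRayMap ψ a ζ t⁻¹)⁻¹) s := by
        refine ContinuousAt.inv₀ ?_ (hψ.closedRayMap_ne_zero ha ζ _)
        exact ((hψ.continuous_closedRayMap hζ).continuousAt).comp (continuousAt_inv₀ hs.ne')
      refine h1.congr ?_
      filter_upwards [Ioi_mem_nhds hs] with t ht
      simp [hY, not_le.2 (mem_Ioi.1 ht)]
  have hne : ∀ z ∉ closedRay ψ a ζ, ∀ s, 1 - z * Y s ≠ 0 := by
    intro z hz s h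
    by_cases hs : s ≤ 0
    · simp [hY, hs] at h
    · apply hz
      rw [← range_closedRayMap]
      refine ⟨s⁻¹, ?_⟩
      have h0 := hψ.closedRayMap_ne_zero ha ζ s⁻¹
      simp only [hY, hs, if_false] at h
      rw [← div_eq_mul_inv, sub_eq_zero, eq_div_iff h0, one_mul] at h
      exact h
  let H : C(unitInterval × {z : ℂ // z ∉ closedRay ψ a ζ}, {z : ℂ // z ≠ 0}) :=
    ⟨fun p => ⟨1 - p.2.1 * Y p.1, hne _ p.2.2 _⟩, by fun_prop⟩
  have H0 : ∀ z, H (0, z) = ⟨Complex.exp ((ContinuousMap.const _ (0 : ℂ)) z),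
      Complex.exp_ne_zero _⟩ := by
    intro z
    simp [H, hY]
  -- Lifting from the logarithm `0` of `1` ends at a logarithm of `1 - z / a`; adding `log (-a)`
  -- gives one of `z - a`.
  let G := Complex.isCoveringMap_exp.liftHomotopy H (ContinuousMap.const _ 0) H0
  have hG := Complex.isCoveringMap_exp.liftHomotopy_lifts H (ContinuousMap.const _ 0) H0
  have ha0 : (-a) ≠ 0 := neg_ne_zero.2 ha
  refine ⟨fun z => if hz : z ∈ closedRay ψ a ζ then 0 else G (1, ⟨z, hz⟩) + Complex.log (-a),
    ?_, ?_⟩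
  · rw [continuousOn_iff_continuous_domRestrict]
    have : Continuous fun z : ((closedRay ψ a ζ)ᶜ : Set ℂ) =>
        G (1, ⟨z.1, z.2⟩) + Complex.log (-a) := by
      fun_prop
    refine this.congr fun z => ?_
    have hz : z.1 ∉ closedRay ψ a ζ := z.2
    simp [hz]
  · intro z hz
    simp only [hz, dif_neg, not_false_iff]
    have h1 := congrArg Subtype.val (congrFun hG (1, ⟨z, hz⟩))
    simp only [Function.comp] at h1
    rw [Complex.exp_add, Complex.exp_log ha0]
    change Complex.exp (G (1, ⟨z, hz⟩)) = 1 - z * Y 1 at h1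
    rw [h1]
    have hY1 : Y 1 = a⁻¹ := by simp [hY, closedRayMap]
    rw [hY1]
    field_simp
    ring

lemma isPreconnected_raySector (θ : Circle) (s t : ℝ) : IsPreconnected (raySector ψ θ s t) := by
  refine (isPreconnected_Ioi.prod isPreconnected_Ioo).image _ ?_
  refine hψ.continuousOn.comp (by fun_prop) ?_
  rintro ⟨r, x⟩ ⟨hr, -⟩
  exact one_lt_norm_mul hr _

lemma ray_inj {r s : ℝ} (hr : 1 < r) (hs : 1 < s) {ζ ξ : Circle} (h : ψ (r * ζ) = ψ (s * ξ)) :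
    r = s ∧ ζ = ξ := by
  have h1 := hψ.injOn (one_lt_norm_mul hr ζ) (one_lt_norm_mul hs ξ) h
  have h2 : r = s := by
    have := congrArg norm h1
    rwa [Circle_norm_mul, Circle_norm_mul, abs_of_pos (by linarith), abs_of_pos (by linarith)] at this
  refine ⟨h2, ?_⟩
  subst h2
  have h0 : (r : ℂ) ≠ 0 := by exact_mod_cast (by linarith : r ≠ 0)
  exact Circle.ext (mul_left_cancel₀ h0 h1)

lemma ray_mem_closedRay {a : ℂ} (ha : a ∈ quadFilledJulia c) {r : ℝ} (hr : 1 < r) {ζ ξ : Circle} :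
    ψ (r * ζ) ∈ closedRay ψ a ξ ↔ ζ = ξ := by
  constructor
  · rintro (h | ⟨s, hs, h⟩)
    · exact absurd (h ▸ ha) (hψ.notMem (one_lt_norm_mul hr ζ))
    · exact (hψ.ray_inj hs hr h).2.symm
  · rintro rfl
    exact Or.inr ⟨r, hr, rfl⟩

lemma exists_ray_of_notMem {z : ℂ} (hz : z ∉ quadFilledJulia c) :
    ∃ r : ℝ, 1 < r ∧ ∃ ζ : Circle, z = ψ (r * ζ) := by
  obtain ⟨w, hw, rfl⟩ := hψ.exists_of_notMem hz
  obtain ⟨ζ, h⟩ := exists_polar w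
  exact ⟨‖w‖, hw, ζ, by rw [← h]⟩

/-- Two rays with a common landing point separate the sectors on their two sides. -/
theorem separation {a : ℂ} (ha : a ≠ 0) (haK : a ∈ quadFilledJulia c) {θ : Circle} {φ : ℝ}
    (hφ0 : 0 < φ) (hφ : φ < 2 * Real.pi) (h1 : θ ∈ landingAngles ψ a)
    (h2 : θ * Circle.exp φ ∈ landingAngles ψ a) {C : Set ℂ} (hC : IsPreconnected C)
    (hC1 : Disjoint C (closedRay ψ a θ)) (hC2 : Disjoint C (closedRay ψ a (θ * Circle.exp φ)))
    (hm1 : (C ∩ raySector ψ θ 0 φ).Nonempty)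
    (hm2 : (C ∩ raySector ψ θ φ (2 * Real.pi)).Nonempty) : False := by
  classical
  obtain ⟨L₁, hL₁, hE₁⟩ := hψ.exists_log_compl_closedRay ha h1
  obtain ⟨L₂, hL₂, hE₂⟩ := hψ.exists_log_compl_closedRay ha h2
  set X₁ := closedRay ψ a θ
  set X₂ := closedRay ψ a (θ * Circle.exp φ)
  -- If `C` joins the two sectors, their union with `C` is connected and misses both rays, so the
  -- two branches of the logarithm differ on it by one constant.
  set W := C ∪ raySector ψ θ 0 φ ∪ raySector ψ θ φ (2 * Real.pi) with hW
  have hWc : IsPreconnected W := by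
    refine IsPreconnected.union' ?_ (IsPreconnected.union' hm1 hC (hψ.isPreconnected_raySector θ 0 φ))
      (hψ.isPreconnected_raySector θ φ (2 * Real.pi))
    obtain ⟨z, hz, hz'⟩ := hm2
    exact ⟨z, Or.inl hz, hz'⟩
  have hX : W ⊆ X₁ᶜ ∩ X₂ᶜ := by
    have hθ : θ = θ * Circle.exp 0 := by simp
    rintro z ((hz | ⟨⟨r, t⟩, ⟨hr, ht⟩, rfl⟩) | ⟨⟨r, t⟩, ⟨hr, ht⟩, rfl⟩)
    · exact ⟨disjoint_left.1 hC1 hz, disjoint_left.1 hC2 hz⟩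
    all_goals
      simp only [mem_Ioi, mem_Ioo] at hr ht
      constructor
      · intro h
        rw [hψ.ray_mem_closedRay haK hr] at h
        have := circle_exp_inj (t := 0) (by linarith) (by linarith) le_rfl Real.two_pi_pos
          (h.trans hθ)
        linarith
      · intro h
        rw [hψ.ray_mem_closedRay haK hr] at h
        have := circle_exp_inj (by linarith) (by linarith) hφ0.le hφ h
        linarith
  obtain ⟨z₀, hz₀, -⟩ := hm1
  have hz₀W : z₀ ∈ W := Or.inl (Or.inl hz₀)
  have hconst := const_of_exp_eq hWc (hL₁.mono (hX.trans inter_subset_left))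
    (hL₂.mono (hX.trans inter_subset_right))
    (fun z hz => (hE₁ z (hX hz).1).trans (hE₂ z (hX hz).2).symm) hz₀W
  set k := L₁ z₀ - L₂ z₀ with hk
  have hexpk : Complex.exp k = 1 := by
    rw [hk, Complex.exp_sub, hE₁ _ (hX hz₀W).1, hE₂ _ (hX hz₀W).2, div_self]
    intro h
    exact (hX hz₀W).1 (Or.inl (sub_eq_zero.1 h))
  -- The first branch is continued across its cut by the second one: near a point of the first ray
  -- other than `a`, all points off that ray lie in one of the two sectors, where the branches agree
  -- up to `k`.
  refine no_log_compl_point a (fun z => if z ∈ X₁ then L₂ z + k else L₁ z) ?_ ?_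
  · intro z hz
    refine ContinuousAt.continuousWithinAt ?_
    by_cases hz1 : z ∈ X₁
    · obtain ⟨r, hr, rfl⟩ : z ∈ externalRay ψ θ := hz1.resolve_left hz
      have hr' : 1 < r := hr
      have hz2 : ψ (r * θ) ∉ X₂ := by
        intro h
        rw [hψ.ray_mem_closedRay haK hr'] at h
        have := circle_exp_inj (θ := θ) (s := 0) (t := φ) le_rfl Real.two_pi_pos hφ0.le hφ (by simpa using h)
        linarith
      have hopen2 : IsOpen X₂ᶜ := (hψ.isClosed_closedRay h2).isOpen_compl
      have hc2 : ContinuousAt (fun z => L₂ z + k) (ψ (r * θ)) :=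
        (hL₂.continuousAt (hopen2.mem_nhds hz2)).add continuousAt_const
      refine hc2.congr ?_
      filter_upwards [hopen2.mem_nhds hz2, hψ.isClosed_quadFilledJulia.isOpen_compl.mem_nhds
        (hψ.notMem (one_lt_norm_mul hr' θ))] with y hy2 hyK
      split_ifs with hy1
      · rfl
      · obtain ⟨s, hs, ζ, rfl⟩ := hψ.exists_ray_of_notMem hyK
        obtain ⟨t, ht, rfl⟩ := exists_angle θ ζ
        have ht0 : t ≠ 0 := by
          rintro rfl
          exact hy1 ((hψ.ray_mem_closedRay haK hs).2 (by simp))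
        have htφ : t ≠ φ := by
          rintro rfl
          exact hy2 ((hψ.ray_mem_closedRay haK hs).2 rfl)
        refine (hconst _ ?_).symm
        rcases lt_or_gt_of_ne htφ with h | h
        · exact Or.inl (Or.inr ⟨(s, t), ⟨hs, lt_of_le_of_ne ht.1 ht0.symm, h⟩, rfl⟩)
        · exact Or.inr ⟨(s, t), ⟨hs, h, ht.2⟩, rfl⟩
    · have hopen1 : IsOpen X₁ᶜ := (hψ.isClosed_closedRay h1).isOpen_compl
      refine (hL₁.continuousAt (hopen1.mem_nhds hz1)).congr ?_
      filter_upwards [hopen1.mem_nhds hz1] with y hy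
      exact (if_neg hy).symm
  · intro z hz
    split_ifs with hz1
    · rw [Complex.exp_add, hexpk, mul_one]
      refine hE₂ z fun hz2 => ?_
      obtain ⟨r, hr, rfl⟩ : z ∈ externalRay ψ θ := hz1.resolve_left hz
      rw [hψ.ray_mem_closedRay haK hr] at hz2
      have := circle_exp_inj (θ := θ) (s := 0) (t := φ) le_rfl Real.two_pi_pos hφ0.le hφ (by simpa using hz2)
      linarith
    · exact hE₁ z hz1

end IsInverseBottcher
end Yoccoz

namespace Yoccoz

/-! ### The sectors at a dividing fixed point -/

/-- Adding a limit point to a connected set keeps it connected, so components are relatively closed.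
This is the closedness input of the open-closed arguments below. -/
lemma closure_comp_inter_subset {F : Set ℂ} {z : ℂ} :
    closure (connectedComponentIn F z) ∩ F ⊆ connectedComponentIn F z := by
  rintro x ⟨hx, hxF⟩
  by_cases hz : z ∈ F
  · have hsub : insert x (connectedComponentIn F z) ⊆ connectedComponentIn F z := by
      refine IsPreconnected.subset_connectedComponentIn ?_
        (mem_insert_of_mem _ (mem_connectedComponentIn hz))
        (insert_subset hxF (connectedComponentIn_subset _ _))
      exact isPreconnected_connectedComponentIn.subset_closure (subset_insert _ _)
        (insert_subset hx subset_closure)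
    exact hsub (mem_insert _ _)
  · simp [connectedComponentIn_eq_empty hz] at hx

/-- A component of an open set contains each connected subset which it meets. -/
lemma subset_comp {F C : Set ℂ} {z : ℂ} (hC : IsPreconnected C) (hCF : C ⊆ F)
    (h : (C ∩ connectedComponentIn F z).Nonempty) : C ⊆ connectedComponentIn F z := by
  obtain ⟨x, hxC, hx⟩ := h
  rw [connectedComponentIn_eq hx]
  exact hC.subset_connectedComponentIn hxC hCF

lemma tendsto_circle_exp (θ : Circle) : Tendsto (fun t : ℝ => θ * Circle.exp t) (𝓝 0) (𝓝 θ) := by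
  have : Continuous fun t : ℝ => θ * Circle.exp t := by fun_prop
  simpa using this.tendsto 0

lemma circle_sq_injOn {ψ : ℂ → ℂ} {a : ℂ} (h : ∀ ζ ∈ landingAngles ψ a, -ζ ∉ landingAngles ψ a) :
    InjOn (fun ζ : Circle => ζ ^ 2) (landingAngles ψ a) := by
  intro ζ hζ ξ hξ hsq
  have h1 : (ζ : ℂ) ^ 2 = (ξ : ℂ) ^ 2 := by
    have := congrArg (fun z : Circle => (z : ℂ)) hsq
    simpa using this
  rcases sq_eq_sq_iff_eq_or_eq_neg.1 h1 with h2 | h2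
  · exact Circle.ext h2
  · exfalso
    have : ζ = -ξ := Circle.ext (by simpa using h2)
    exact h ξ hξ (this ▸ hζ)

namespace IsInverseBottcher

variable {c : ℂ} {ψ : ℂ → ℂ} (hψ : IsInverseBottcher c ψ)
include hψ

lemma conj_ray {r : ℝ} (hr : 1 < r) (ζ : Circle) :
    quad c (ψ (r * ζ)) = ψ ((r ^ 2 : ℝ) * (ζ ^ 2 : Circle)) := by
  rw [← hψ.conj _ (one_lt_norm_mul hr ζ)]
  push_cast
  ring_nf

lemma neg_ray {r : ℝ} (hr : 1 < r) (ζ : Circle) : -ψ (r * ζ) = ψ (r * (-ζ : Circle)) := by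
  rw [← hψ.map_neg (one_lt_norm_mul hr ζ)]
  simp

lemma landing_neg {a : ℂ} {ζ : Circle} (hζ : ζ ∈ landingAngles ψ a) :
    -ζ ∈ landingAngles ψ (-a) := by
  refine (Tendsto.neg hζ).congr' ?_
  filter_upwards [self_mem_nhdsWithin] with r hr
  exact hψ.neg_ray hr ζ

/-- The point of potential `r` on the image ray is the image of the point of potential `√r`, and the
polynomial is continuous at its fixed point. -/
lemma landing_sq {a : ℂ} (ha : quad c a = a) {ζ : Circle} (hζ : ζ ∈ landingAngles ψ a) :
    ζ ^ 2 ∈ landingAngles ψ a := by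
  have h1 : Tendsto (fun r : ℝ => √r) (𝓝[>] 1) (𝓝[>] 1) := by
    refine tendsto_nhdsWithin_iff.2 ⟨?_, ?_⟩
    · have := (Real.continuous_sqrt.tendsto 1)
      rw [Real.sqrt_one] at this
      exact this.mono_left nhdsWithin_le_nhds
    · filter_upwards [self_mem_nhdsWithin] with r hr
      exact Real.lt_sqrt_of_sq_lt (by simpa using hr)
  have h2 := ((continuous_quad c).tendsto a).comp ((show Tendsto _ _ _ from hζ).comp h1)
  rw [ha] at h2
  refine h2.congr' ?_
  filter_upwards [self_mem_nhdsWithin, h1.eventually self_mem_nhdsWithin] with r hr hr'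
  have hr0 : (0 : ℝ) ≤ r := by linarith [mem_Ioi.1 hr]
  simp only [Function.comp]
  rw [hψ.conj_ray hr', Real.sq_sqrt hr0]

lemma landing_neg_notMem {a : ℂ} (ha0 : a ≠ 0) {ζ : Circle} (hζ : ζ ∈ landingAngles ψ a) :
    -ζ ∉ landingAngles ψ a := by
  intro h
  have := tendsto_nhds_unique (show Tendsto _ _ _ from h) (hψ.landing_neg hζ)
  exact ha0 (self_eq_neg.1 this)

/-- A ray whose image under the polynomial lands at the fixed point `a` lands at `a` or `-a`. -/
lemma landing_of_sq {a : ℂ} (ha : quad c a = a) (ha0 : a ≠ 0) {ζ : Circle}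
    (hζ : ζ ^ 2 ∈ landingAngles ψ a) : ζ ∈ landingAngles ψ a ∨ -ζ ∈ landingAngles ψ a := by
  set F : ℝ → ℂ := fun r => ψ (r * ζ) with hF
  have h1 : Tendsto (fun r : ℝ => r ^ 2) (𝓝[>] 1) (𝓝[>] 1) := by
    refine tendsto_nhdsWithin_iff.2 ⟨?_, ?_⟩
    · have := ((continuous_pow 2 : Continuous fun r : ℝ => r ^ 2).tendsto 1)
      rw [one_pow] at this
      exact this.mono_left nhdsWithin_le_nhds
    · filter_upwards [self_mem_nhdsWithin] with r hr
      exact one_lt_pow₀ (mem_Ioi.1 hr) two_ne_zero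
  have h2 : Tendsto (fun r => quad c (F r)) (𝓝[>] 1) (𝓝 a) := by
    refine ((show Tendsto _ _ _ from hζ).comp h1).congr' ?_
    filter_upwards [self_mem_nhdsWithin] with r hr
    exact (hψ.conj_ray hr ζ).symm
  have h3 : Tendsto (fun r => (F r - a) * (F r + a)) (𝓝[>] 1) (𝓝 0) := by
    have := h2.sub_const a
    rw [sub_self] at this
    refine this.congr fun r => ?_
    nth_rw 1 [← ha]
    simp only [quad]
    ring
  have hpos : 0 < ‖a‖ := norm_pos_iff.2 ha0
  have h4 : ∀ᶠ r in 𝓝[>] (1 : ℝ), ‖F r - a‖ * ‖F r + a‖ < ‖a‖ * ‖a‖ := by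
    have := h3.norm.eventually (gt_mem_nhds (show ‖(0 : ℂ)‖ < ‖a‖ * ‖a‖ by simp [hpos]))
    simpa using this
  obtain ⟨u, hu, hsub⟩ := mem_nhdsGT_iff_exists_Ioo_subset.1 h4
  have hu1 : (1 : ℝ) < u := hu
  have htri : ∀ r, 2 * ‖a‖ ≤ ‖F r - a‖ + ‖F r + a‖ := fun r => by
    have : ‖(F r + a) - (F r - a)‖ ≤ _ := norm_sub_le _ _
    have h2a : (F r + a) - (F r - a) = 2 * a := by ring
    rw [h2a, norm_mul] at this
    simp at this
    linarith
  have hcont : ContinuousOn F (Ioo 1 u) := by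
    refine hψ.continuousOn.comp (by fun_prop) fun r hr => one_lt_norm_mul hr.1 ζ
  have hconn : IsPreconnected (F '' Ioo 1 u) := isPreconnected_Ioo.image _ hcont
  have hIoo : ∀ᶠ r in 𝓝[>] (1 : ℝ), r ∈ Ioo 1 u := Ioo_mem_nhdsGT hu1
  -- Where the product of the distances to `a` and `-a` is below `‖a‖ ^ 2`, a point cannot be
  -- equidistant from both, so the connected end of the ray stays nearer to one of them.
  rcases hconn.subset_or_subset (u := {z | ‖z - a‖ < ‖z + a‖}) (v := {z | ‖z + a‖ < ‖z - a‖})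
    (isOpen_lt (by fun_prop) (by fun_prop)) (isOpen_lt (by fun_prop) (by fun_prop))
    (disjoint_left.2 fun z h h' => lt_asymm (mem_ofPred_eq.mp h) (mem_ofPred_eq.mp h')) (by
      rintro _ ⟨r, hr, rfl⟩
      by_contra hcon
      simp only [mem_union, mem_ofPred_eq, not_or, not_lt] at hcon
      have heq := le_antisymm hcon.1 hcon.2
      have := hsub hr
      simp only [mem_ofPred_eq] at this
      rw [heq] at this
      have h2 := htri r
      nlinarith) with h | h
  · left
    refine tendsto_iff_norm_sub_tendsto_zero.2 (squeeze_zero' (g := fun r =>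
      ‖(F r - a) * (F r + a)‖ / ‖a‖) (by simp) ?_ (by simpa using h3.norm.div_const ‖a‖))
    filter_upwards [hIoo] with r hr
    have hlt : ‖F r - a‖ < ‖F r + a‖ := h ⟨r, hr, rfl⟩
    have h2 := htri r
    rw [norm_mul, le_div_iff₀ hpos]
    exact mul_le_mul_of_nonneg_left (by linarith) (norm_nonneg _)
  · right
    have hm : Tendsto F (𝓝[>] 1) (𝓝 (-a)) := by
      refine tendsto_iff_norm_sub_tendsto_zero.2 (squeeze_zero' (g := fun r =>
        ‖(F r - a) * (F r + a)‖ / ‖a‖) (by simp) ?_ (by simpa using h3.norm.div_const ‖a‖))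
      filter_upwards [hIoo] with r hr
      have hlt : ‖F r + a‖ < ‖F r - a‖ := h ⟨r, hr, rfl⟩
      have h2 := htri r
      rw [norm_mul, le_div_iff₀ hpos, sub_neg_eq_add, mul_comm ‖F r - a‖]
      exact mul_le_mul_of_nonneg_left (by linarith) (norm_nonneg _)
    simpa using hψ.landing_neg hm

/-- A square root of the direction lands at `a` or its opposite does, and both have the same square.
-/
lemma exists_landing_sq_eq {a : ℂ} (ha : quad c a = a) (ha0 : a ≠ 0) {ζ : Circle}
    (hζ : ζ ∈ landingAngles ψ a) : ∃ ξ ∈ landingAngles ψ a, ξ ^ 2 = ζ := by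
  obtain ⟨ξ, hξ⟩ : ∃ ξ : Circle, ξ ^ 2 = ζ := by
    refine ⟨Circle.exp (Complex.arg ζ / 2), ?_⟩
    rw [← Circle.exp_nsmul]
    conv_rhs => rw [← Circle.exp_arg ζ]
    congr 1
    simp; ring
  rcases hψ.landing_of_sq ha ha0 (hξ ▸ hζ) with h | h
  · exact ⟨ξ, h, hξ⟩
  · exact ⟨-ξ, h, by simpa⟩

lemma exists_landing_pow_eq {a : ℂ} (ha : quad c a = a) (ha0 : a ≠ 0) (n : ℕ) {ζ : Circle}
    (hζ : ζ ∈ landingAngles ψ a) : ∃ ξ ∈ landingAngles ψ a, ξ ^ 2 ^ n = ζ := by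
  induction n generalizing ζ with
  | zero => exact ⟨ζ, hζ, by simp⟩
  | succ n ih =>
    obtain ⟨ξ, hξ, rfl⟩ := ih hζ
    obtain ⟨η, hη, rfl⟩ := hψ.exists_landing_sq_eq ha ha0 hξ
    exact ⟨η, hη, by rw [← pow_mul, ← pow_succ']⟩

lemma landing_pow {a : ℂ} (ha : quad c a = a) (n : ℕ) {ζ : Circle}
    (hζ : ζ ∈ landingAngles ψ a) : ζ ^ 2 ^ n ∈ landingAngles ψ a := by
  induction n with
  | zero => simpa
  | succ n ih => rw [pow_succ, pow_mul]; exact hψ.landing_sq ha ih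

/-- Two directions with the same square differ by a sign, and opposite rays land at the different
points `a` and `-a`. -/
lemma injOn_landing_pow {a : ℂ} (ha : quad c a = a) (ha0 : a ≠ 0) (n : ℕ) :
    InjOn (fun ζ : Circle => ζ ^ 2 ^ n) (landingAngles ψ a) := by
  induction n with
  | zero => simp
  | succ n ih =>
    intro ζ hζ ξ hξ h
    simp only [pow_succ 2, pow_mul] at h
    exact ih hζ hξ (circle_sq_injOn (fun _ h => hψ.landing_neg_notMem ha0 h)
      (hψ.landing_pow ha n hζ) (hψ.landing_pow ha n hξ) h)

end IsInverseBottcher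

/-- `a` is a fixed point of `z ↦ z ^ 2 + c` which is the landing point of at least two and of
finitely many rays, and which does not lie on the orbit of the critical point. -/
structure IsDividing (c : ℂ) (ψ : ℂ → ℂ) (a : ℂ) : Prop where
  bottcher : IsInverseBottcher c ψ
  fixed : quad c a = a
  ne_zero : a ≠ 0
  value_ne : c ≠ a
  finite : (landingAngles ψ a).Finite
  nontrivial : (landingAngles ψ a).Nontrivial

namespace IsDividing

variable {c : ℂ} {ψ : ℂ → ℂ} {a : ℂ} (D : IsDividing c ψ a)
include D

lemma mem_julia : a ∈ quadFilledJulia c := mem_quadFilledJulia_of_fixed D.fixed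

lemma sq_mem {ζ : Circle} (hζ : ζ ∈ landingAngles ψ a) : ζ ^ 2 ∈ landingAngles ψ a :=
  D.bottcher.landing_sq D.fixed hζ

lemma pow_mem {ζ : Circle} (hζ : ζ ∈ landingAngles ψ a) (k : ℕ) :
    ζ ^ 2 ^ k ∈ landingAngles ψ a := D.bottcher.landing_pow D.fixed k hζ

lemma sq_injOn : InjOn (fun ζ : Circle => ζ ^ 2) (landingAngles ψ a) :=
  circle_sq_injOn fun _ h => D.bottcher.landing_neg_notMem D.ne_zero h

lemma sq_surj {ζ : Circle} (hζ : ζ ∈ landingAngles ψ a) : ∃ ξ ∈ landingAngles ψ a, ξ ^ 2 = ζ :=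
  D.bottcher.exists_landing_sq_eq D.fixed D.ne_zero hζ

lemma ray_mem {r : ℝ} (hr : 1 < r) {ζ : Circle} :
    ψ (r * ζ) ∈ rayConfig ψ a ↔ ζ ∈ landingAngles ψ a := by
  constructor
  · rintro (h | h)
    · exact absurd (h ▸ D.mem_julia) (D.bottcher.notMem (one_lt_norm_mul hr ζ))
    · simp only [mem_iUnion] at h
      obtain ⟨ξ, hξ, s, hs, h⟩ := h
      rw [← (D.bottcher.ray_inj hs hr h).2]
      exact hξ
  · intro h
    refine Or.inr (mem_iUnion₂.2 ⟨ζ, h, r, hr, rfl⟩)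

lemma julia_mem {z : ℂ} (hz : z ∈ quadFilledJulia c) : z ∈ rayConfig ψ a ↔ z = a := by
  constructor
  · rintro (h | h)
    · exact h
    · simp only [mem_iUnion] at h
      obtain ⟨ξ, hξ, s, hs, rfl⟩ := h
      exact absurd hz (D.bottcher.notMem (one_lt_norm_mul hs ξ))
  · rintro rfl
    exact mem_insert _ _

lemma rayConfig_eq : rayConfig ψ a = ⋃ ζ ∈ landingAngles ψ a, closedRay ψ a ζ := by
  obtain ⟨ζ, hζ⟩ := D.nontrivial.nonempty
  ext z
  simp only [rayConfig, closedRay, mem_insert_iff, mem_iUnion]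
  constructor
  · rintro (rfl | ⟨ξ, hξ, h⟩)
    · exact ⟨ζ, hζ, Or.inl rfl⟩
    · exact ⟨ξ, hξ, Or.inr h⟩
  · rintro ⟨ξ, hξ, h | h⟩
    · exact Or.inl h
    · exact Or.inr ⟨ξ, hξ, h⟩

lemma closedRay_subset {ζ : Circle} (hζ : ζ ∈ landingAngles ψ a) :
    closedRay ψ a ζ ⊆ rayConfig ψ a := by
  rw [D.rayConfig_eq]
  exact subset_biUnion_of_mem (u := fun ζ => closedRay ψ a ζ) hζ

lemma isClosed_rayConfig : IsClosed (rayConfig ψ a) := by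
  rw [D.rayConfig_eq]
  exact D.finite.isClosed_biUnion fun ζ hζ => D.bottcher.isClosed_closedRay hζ

lemma isPreconnected_rayConfig : IsPreconnected (rayConfig ψ a) := by
  rw [D.rayConfig_eq]
  rw [← sUnion_image]
  refine isPreconnected_sUnion a _ ?_ ?_
  · rintro _ ⟨ζ, -, rfl⟩
    exact mem_insert _ _
  · rintro _ ⟨ζ, hζ, rfl⟩
    exact D.bottcher.isPreconnected_closedRay hζ

lemma quad_mem_rayConfig {z : ℂ} :
    quad c z ∈ rayConfig ψ a ↔ z ∈ rayConfig ψ a ∨ -z ∈ rayConfig ψ a := by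
  by_cases hz : z ∈ quadFilledJulia c
  · rw [D.julia_mem hz, D.julia_mem (quad_mem_quadFilledJulia.2 hz),
      D.julia_mem (neg_mem_quadFilledJulia.2 hz), neg_eq_iff_eq_neg]
    conv_lhs => rw [← D.fixed]
    exact quad_eq_quad_iff
  · obtain ⟨r, hr, ζ, rfl⟩ := D.bottcher.exists_ray_of_notMem hz
    rw [D.bottcher.conj_ray hr, D.bottcher.neg_ray hr, D.ray_mem hr, D.ray_mem hr,
      D.ray_mem (one_lt_pow₀ hr two_ne_zero)]
    constructor
    · exact D.bottcher.landing_of_sq D.fixed D.ne_zero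
    · rintro (h | h)
      · exact D.sq_mem h
      · simpa using D.sq_mem h

lemma neg_notMem {z : ℂ} (hz : z ∈ rayConfig ψ a) : -z ∉ rayConfig ψ a := by
  intro hz'
  by_cases hK : z ∈ quadFilledJulia c
  · rw [D.julia_mem hK] at hz
    rw [D.julia_mem (neg_mem_quadFilledJulia.2 hK), hz] at hz'
    exact D.ne_zero (neg_eq_self.1 hz')
  · obtain ⟨r, hr, ζ, rfl⟩ := D.bottcher.exists_ray_of_notMem hK
    rw [D.bottcher.neg_ray hr, D.ray_mem hr] at hz'
    rw [D.ray_mem hr] at hz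
    exact D.bottcher.landing_neg_notMem D.ne_zero hz hz'

/-- Finiteness of the set of landing directions gives one bound for all of them. -/
lemma exists_gap : ∃ δ : ℝ, 0 < δ ∧ ∀ θ ∈ landingAngles ψ a, ∀ t : ℝ, t ≠ 0 → |t| < δ →
    θ * Circle.exp t ∉ landingAngles ψ a ∧ -(θ * Circle.exp t) ∉ landingAngles ψ a := by
  set B : Set Circle := landingAngles ψ a ∪ Neg.neg '' landingAngles ψ a with hB
  have hBf : B.Finite := D.finite.union (D.finite.image _)
  have h1 : ∀ᶠ t : ℝ in 𝓝 0, ∀ θ ∈ landingAngles ψ a, θ * Circle.exp t ∉ B \ {θ} := by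
    rw [eventually_all_finite D.finite]
    intro θ _
    have hθ : θ ∈ (B \ {θ})ᶜ := fun h => h.2 rfl
    exact (tendsto_circle_exp θ).eventually
      ((hBf.subset sdiff_subset).isClosed.isOpen_compl.mem_nhds hθ)
  obtain ⟨δ, hδ, hball⟩ := Metric.eventually_nhds_iff.1 h1
  refine ⟨min δ 1, by positivity, fun θ hθ t ht0 ht => ?_⟩
  have hne : θ * Circle.exp t ≠ θ := by
    intro h
    have h1 : Circle.exp t = Circle.exp 0 := by simpa using h
    obtain ⟨m, hm⟩ := Circle.exp_eq_exp.1 h1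
    rw [zero_add] at hm
    have ht1 : |t| < 1 := ht.trans_le (min_le_right _ _)
    have hm0 : m ≠ 0 := by rintro rfl; simp at hm; exact ht0 hm
    have : (1 : ℝ) ≤ |(m : ℝ)| := by exact_mod_cast Int.one_le_abs hm0
    rw [hm, abs_mul, abs_of_pos Real.two_pi_pos] at ht1
    nlinarith [Real.pi_gt_three]
  have hn := hball (y := t) (by simpa using ht.trans_le (min_le_left _ _)) θ hθ
  constructor
  · exact fun h => hn ⟨Or.inl h, hne⟩
  · exact fun h => hn ⟨Or.inr ⟨_, h, neg_neg _⟩, hne⟩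

/-- An angle less than the distances between the directions of the rays at `a` and at `-a`. -/
noncomputable def gap : ℝ := D.exists_gap.choose

lemma gap_pos : 0 < D.gap := D.exists_gap.choose_spec.1

lemma gap_spec {θ : Circle} (hθ : θ ∈ landingAngles ψ a) {t : ℝ} (h0 : t ≠ 0) (ht : |t| < D.gap) :
    θ * Circle.exp t ∉ landingAngles ψ a ∧ -(θ * Circle.exp t) ∉ landingAngles ψ a :=
  D.exists_gap.choose_spec.2 θ hθ t h0 ht

/-- The component of the complement of the rays at `a` adjacent to the ray in direction `θ` in the
positive direction. -/
def sector (θ : Circle) : Set ℂ :=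
  connectedComponentIn (rayConfig ψ a)ᶜ
    (ψ ((2 : ℝ) * (θ * Circle.exp (D.gap / 2) : Circle)))

lemma raySector_subset {θ : Circle} {s t : ℝ}
    (h : ∀ x ∈ Ioo s t, θ * Circle.exp x ∉ landingAngles ψ a) :
    raySector ψ θ s t ⊆ (rayConfig ψ a)ᶜ := by
  rintro _ ⟨⟨r, x⟩, ⟨hr, hx⟩, rfl⟩
  rw [mem_compl_iff, D.ray_mem hr]
  exact h x hx

lemma raySector_pos_subset {θ : Circle} (hθ : θ ∈ landingAngles ψ a) :
    raySector ψ θ 0 D.gap ⊆ (rayConfig ψ a)ᶜ :=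
  D.raySector_subset fun x hx => (D.gap_spec hθ hx.1.ne'
    (by rw [abs_of_pos hx.1]; exact hx.2)).1

lemma raySector_neg_subset {θ : Circle} (hθ : θ ∈ landingAngles ψ a) :
    raySector ψ θ (-D.gap) 0 ⊆ (rayConfig ψ a)ᶜ :=
  D.raySector_subset fun x hx => (D.gap_spec hθ hx.2.ne
    (by rw [abs_of_neg hx.2]; linarith [hx.1])).1

lemma base_mem (θ : Circle) :
    ψ ((2 : ℝ) * (θ * Circle.exp (D.gap / 2) : Circle)) ∈ raySector ψ θ 0 D.gap :=
  ⟨(2, D.gap / 2), ⟨by norm_num, by linarith [D.gap_pos], by linarith [D.gap_pos]⟩, rfl⟩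

lemma raySector_subset_sector {θ : Circle} (hθ : θ ∈ landingAngles ψ a) :
    raySector ψ θ 0 D.gap ⊆ D.sector θ :=
  (D.bottcher.isPreconnected_raySector θ 0 D.gap).subset_connectedComponentIn (D.base_mem θ)
    (D.raySector_pos_subset hθ)

lemma isOpen_sector (θ : Circle) : IsOpen (D.sector θ) :=
  D.isClosed_rayConfig.isOpen_compl.connectedComponentIn

lemma isPreconnected_sector (θ : Circle) : IsPreconnected (D.sector θ) :=
  isPreconnected_connectedComponentIn

lemma sector_subset (θ : Circle) : D.sector θ ⊆ (rayConfig ψ a)ᶜ := connectedComponentIn_subset _ _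

lemma base_mem_sector {θ : Circle} (hθ : θ ∈ landingAngles ψ a) :
    ψ ((2 : ℝ) * (θ * Circle.exp (D.gap / 2) : Circle)) ∈ D.sector θ :=
  D.raySector_subset_sector hθ (D.base_mem θ)

lemma subset_sector {θ : Circle} {C : Set ℂ} (hC : IsPreconnected C) (hCR : C ⊆ (rayConfig ψ a)ᶜ)
    (h : (C ∩ D.sector θ).Nonempty) : C ⊆ D.sector θ := subset_comp hC hCR h

lemma closure_sector (θ : Circle) : closure (D.sector θ) ∩ (rayConfig ψ a)ᶜ ⊆ D.sector θ :=
  closure_comp_inter_subset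

/-- Every component of the complement reaches the basin of infinity. From a point there, turning in
the negative direction up to the first ray landing at `a` sweeps out a region free of rays that runs
into the sector of that ray. -/
lemma exists_sector {z : ℂ} (hz : z ∉ rayConfig ψ a) :
    ∃ θ ∈ landingAngles ψ a, z ∈ D.sector θ := by
  set C := connectedComponentIn (rayConfig ψ a)ᶜ z with hC
  have hzC : z ∈ C := mem_connectedComponentIn hz
  have hCo : IsOpen C := D.isClosed_rayConfig.isOpen_compl.connectedComponentIn
  obtain ⟨y, hyC, hyK⟩ : ∃ y ∈ C, y ∉ quadFilledJulia c := by
    by_contra! hcon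
    -- A component inside the filled Julia set could have no boundary point other than `a`, so it
    -- would fill the punctured plane.
    have hsub : ({a}ᶜ : Set ℂ) ⊆ C := by
      refine (isConnected_compl_singleton_of_one_lt_rank (by simp)
        a).isPreconnected.subset_of_closure_inter_subset hCo ⟨z, ?_, hzC⟩ ?_
      · rintro rfl
        exact hz (mem_insert _ _)
      · rintro x ⟨hx, hxa⟩
        have hxK := closure_minimal hcon D.bottcher.isClosed_quadFilledJulia hx
        exact closure_comp_inter_subset
          ⟨hx, fun h => hxa ((D.julia_mem hxK).1 h)⟩
    have h2 : (1 : ℝ) < 2 := by norm_num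
    have hn := D.bottcher.notMem (one_lt_norm_mul h2 1)
    exact hn (hcon _ (hsub fun h => hn (h ▸ D.mem_julia)))
  obtain ⟨r, hr, ζ, rfl⟩ := D.bottcher.exists_ray_of_notMem hyK
  choose! T hT hTζ using fun θ => exists_angle θ ζ
  -- `T θ` is the angle from `θ` to `ζ` in the positive direction; its minimum selects the nearest
  -- ray.
  obtain ⟨θ, hθ, hmin⟩ := exists_min_image _ T D.finite D.nontrivial.nonempty
  have hζA : ζ ∉ landingAngles ψ a := fun h =>
    connectedComponentIn_subset _ _ hyC ((D.ray_mem hr).2 h)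
  have hT0 : 0 < T θ := by
    refine lt_of_le_of_ne (hT θ).1 fun h => hζA ?_
    rw [hTζ θ, ← h]
    simpa using hθ
  have hfree : raySector ψ θ 0 (T θ) ⊆ (rayConfig ψ a)ᶜ := by
    refine D.raySector_subset fun x hx hA => ?_
    have h1 := hmin _ hA
    have h2 : θ * Circle.exp x * Circle.exp (T θ - x) =
        θ * Circle.exp x * Circle.exp (T (θ * Circle.exp x)) := by
      rw [← hTζ (θ * Circle.exp x), mul_assoc, ← Circle.exp_add, add_sub_cancel, ← hTζ]
    have h3 := circle_exp_inj (by linarith [hx.2]) (by linarith [hx.1, (hT θ).2])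
      (hT (θ * Circle.exp x)).1 (hT (θ * Circle.exp x)).2 h2
    linarith [hx.1]
  have hpre : IsPreconnected (insert (ψ (r * ζ)) (raySector ψ θ 0 (T θ))) := by
    refine (D.bottcher.isPreconnected_raySector θ 0 (T θ)).subset_closure (subset_insert _ _)
      (insert_subset ?_ subset_closure)
    have hlim : Tendsto (fun t : ℝ => ψ (r * (θ * Circle.exp t : Circle))) (𝓝[<] (T θ))
        (𝓝 (ψ (r * ζ))) := by
      have : ContinuousAt (fun t : ℝ => ψ (r * (θ * Circle.exp t : Circle))) (T θ) := by
        refine ContinuousAt.comp (g := ψ) (D.bottcher.continuousOn.continuousAt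
          ((isOpen_lt continuous_const continuous_norm).mem_nhds (one_lt_norm_mul hr _)))
          (by fun_prop)
      have h := this.tendsto
      rw [← hTζ] at h
      exact h.mono_left nhdsWithin_le_nhds
    refine mem_closure_of_tendsto hlim ?_
    filter_upwards [Ioo_mem_nhdsLT hT0] with t ht
    exact ⟨(r, t), ⟨hr, ht⟩, rfl⟩
  have hsub : insert (ψ (r * ζ)) (raySector ψ θ 0 (T θ)) ⊆ D.sector θ := by
    refine D.subset_sector hpre
      (insert_subset (connectedComponentIn_subset _ _ hyC) hfree) ?_
    set t := min (T θ / 2) (D.gap / 2)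
    have ht0 : 0 < t := lt_min (by linarith) (by linarith [D.gap_pos])
    refine ⟨ψ ((2 : ℝ) * (θ * Circle.exp t : Circle)),
      Or.inr ⟨(2, t), ⟨by norm_num, ht0, ?_⟩, rfl⟩,
      D.raySector_subset_sector hθ ⟨(2, t), ⟨by norm_num, ht0, ?_⟩, rfl⟩⟩
    · have := min_le_left (T θ / 2) (D.gap / 2)
      change t < T θ
      linarith
    · have := min_le_right (T θ / 2) (D.gap / 2)
      change t < D.gap
      linarith [D.gap_pos]
  exact ⟨θ, hθ, D.subset_sector isPreconnected_connectedComponentIn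
    (connectedComponentIn_subset _ _) ⟨_, hyC, hsub (mem_insert _ _)⟩ hzC⟩

end IsDividing
end Yoccoz

/-! ### Images and preimages of the sectors under the polynomial -/

namespace Yoccoz

lemma isProperMap_quad (c : ℂ) : IsProperMap (quad c) := by
  rw [isProperMap_iff_tendsto_cocompact]
  refine ⟨continuous_quad c, ?_⟩
  rw [tendsto_cocompact_iff_tendsto_norm]
  have h1 := (tendsto_norm_cocompact_atTop (E := ℂ))
  refine tendsto_atTop_mono' _ ?_ h1
  filter_upwards [h1.eventually_ge_atTop 4, h1.eventually_ge_atTop ‖c‖] with z h4 hc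
  have := norm_quad_ge h4 hc
  nlinarith

lemma isOpenMap_quad (c : ℂ) : IsOpenMap (quad c) := by
  have han : AnalyticOnNhd ℂ (quad c) univ := by
    have : Differentiable ℂ (quad c) := by unfold quad; fun_prop
    exact this.differentiableOn.analyticOnNhd isOpen_univ
  rcases han.is_constant_or_isOpenMap with ⟨w, h⟩ | h
  · exfalso
    have h0 := h 0
    have h1 := h 1
    rw [← h0] at h1
    simp [quad] at h1
  · exact h

/-- The image of `O` is open, and by properness it is closed relative to `T`. The hypothesis `hcl`
holds for components of the preimage of `T`. -/
lemma quad_image_eq_of_closure {c : ℂ} {O T : Set ℂ} (hO : IsOpen O) (hne : O.Nonempty)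
    (hT : IsPreconnected T) (hm : MapsTo (quad c) O T) (hcl : closure O ∩ quad c ⁻¹' T ⊆ O) :
    T ⊆ quad c '' O := by
  obtain ⟨x, hx⟩ := hne
  refine hT.subset_of_closure_inter_subset (isOpenMap_quad c _ hO)
    ⟨_, hm hx, mem_image_of_mem _ hx⟩ ?_
  rintro y ⟨hy, hyT⟩
  have : y ∈ quad c '' closure O := by
    have h1 : IsClosed (quad c '' closure O) := (isProperMap_quad c).isClosedMap _ isClosed_closure
    exact closure_minimal (image_mono subset_closure) h1 hy
  obtain ⟨z, hz, rfl⟩ := this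
  exact ⟨z, hcl ⟨hz, hyT⟩, rfl⟩

lemma isPreconnected_neg {S : Set ℂ} (hS : IsPreconnected S) : IsPreconnected (-S) := by
  rw [← image_neg_eq_neg]
  exact hS.image _ continuous_neg.continuousOn

namespace IsDividing

variable {c : ℂ} {ψ : ℂ → ℂ} {a : ℂ} (D : IsDividing c ψ a)
include D

/-- If the components coincided, one connected set would miss both rays and reach both sides of the
pair, against `separation`. -/
lemma sector_disjoint_raySector {θ : Circle} (hθ : θ ∈ landingAngles ψ a) {φ : ℝ} (hφ0 : 0 < φ)
    (hφ : φ < 2 * Real.pi) (hη : θ * Circle.exp φ ∈ landingAngles ψ a) {η : Circle}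
    (hSη : (D.sector η ∩ raySector ψ θ φ (2 * Real.pi)).Nonempty) :
    Disjoint (D.sector η) (D.sector θ) := by
  rw [disjoint_iff_inter_eq_empty, ← not_nonempty_iff_eq_empty]
  intro hne
  have hsub := D.subset_sector (D.isPreconnected_sector θ) (D.sector_subset θ)
    (inter_comm _ _ ▸ hne)
  have hdisj : ∀ {ξ}, ξ ∈ landingAngles ψ a → Disjoint (D.sector η) (closedRay ψ a ξ) := fun h =>
    disjoint_left.2 fun z hz hz' => D.sector_subset η hz (D.closedRay_subset h hz')
  refine D.bottcher.separation D.ne_zero D.mem_julia hφ0 hφ hθ hη (D.isPreconnected_sector η)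
    (hdisj hθ) (hdisj hη) ?_ hSη
  set t := min (φ / 2) (D.gap / 2)
  have ht0 : 0 < t := lt_min (by linarith) (by linarith [D.gap_pos])
  have h1 : t < φ := (min_le_left _ _).trans_lt (by linarith)
  have h2 : t < D.gap := (min_le_right _ _).trans_lt (by linarith [D.gap_pos])
  exact ⟨ψ ((2 : ℝ) * (θ * Circle.exp t : Circle)),
    hsub (D.raySector_subset_sector hθ ⟨(2, t), ⟨by norm_num, ht0, h2⟩, rfl⟩),
    ⟨(2, t), ⟨by norm_num, ht0, h1⟩, rfl⟩⟩

omit D in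
lemma exists_angle_of_ne {θ η : Circle} (h : θ ≠ η) :
    ∃ φ : ℝ, 0 < φ ∧ φ < 2 * Real.pi ∧ η = θ * Circle.exp φ := by
  obtain ⟨φ, hφ, hη⟩ := exists_angle θ η
  refine ⟨φ, lt_of_le_of_ne hφ.1 ?_, hφ.2, hη⟩
  rintro rfl
  simp at hη
  exact h hη.symm

/-- Sectors adjacent to different rays are different. -/
lemma sector_disjoint {θ η : Circle} (hθ : θ ∈ landingAngles ψ a) (hη : η ∈ landingAngles ψ a)
    (hne : θ ≠ η) : Disjoint (D.sector θ) (D.sector η) := by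
  obtain ⟨φ, h0, h2, rfl⟩ := exists_angle_of_ne hne
  refine (D.sector_disjoint_raySector hθ h0 h2 hη ?_).symm
  set t := min ((2 * Real.pi - φ) / 2) (D.gap / 2)
  have ht0 : 0 < t := lt_min (by linarith) (by linarith [D.gap_pos])
  have h1 : t < 2 * Real.pi - φ := (min_le_left _ _).trans_lt (by linarith)
  have h2 : t < D.gap := (min_le_right _ _).trans_lt (by linarith [D.gap_pos])
  refine ⟨ψ ((2 : ℝ) * (θ * Circle.exp φ * Circle.exp t : Circle)),
    D.raySector_subset_sector hη ⟨(2, t), ⟨by norm_num, ht0, h2⟩, rfl⟩, ⟨(2, φ + t),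
      ⟨by norm_num, by dsimp only; linarith, by dsimp only; linarith⟩, ?_⟩⟩
  dsimp only
  rw [Circle.exp_add, mul_assoc]

/-- The filter `l` allows the ray to be approached from one side only. -/
lemma closedRay_subset_closure {θ : Circle} (hθ : θ ∈ landingAngles ψ a) {C : Set ℂ}
    {l : Filter ℝ} [l.NeBot] (hl : l ≤ 𝓝 0)
    (h : ∀ r : ℝ, 1 < r → ∀ᶠ t in l, ψ (r * (θ * Circle.exp t : Circle)) ∈ C) :
    closedRay ψ a θ ⊆ closure C := by
  have h1 : externalRay ψ θ ⊆ closure C := by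
    rintro _ ⟨r, hr, rfl⟩
    have hc : ContinuousAt (fun t : ℝ => ψ (r * (θ * Circle.exp t : Circle))) 0 := by
      refine ContinuousAt.comp (g := ψ) (D.bottcher.continuousOn.continuousAt
        ((isOpen_lt continuous_const continuous_norm).mem_nhds (one_lt_norm_mul hr _)))
        (by fun_prop)
    have := hc.tendsto.mono_left hl
    simp only [Circle.exp_zero, mul_one] at this
    exact mem_closure_of_tendsto this (h r hr)
  refine insert_subset ?_ h1
  refine isClosed_closure.mem_of_tendsto (show Tendsto _ _ _ from hθ) ?_
  filter_upwards [self_mem_nhdsWithin] with r hr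
  exact h1 ⟨r, hr, rfl⟩

lemma closedRay_subset_closure_sector {θ : Circle} (hθ : θ ∈ landingAngles ψ a) :
    closedRay ψ a θ ⊆ closure (D.sector θ) := by
  refine D.closedRay_subset_closure hθ (l := 𝓝[>] 0) nhdsWithin_le_nhds fun r hr => ?_
  filter_upwards [Ioo_mem_nhdsGT D.gap_pos] with t ht
  exact D.raySector_subset_sector hθ ⟨(r, t), ⟨hr, ht⟩, rfl⟩

lemma mem_closure_sector {θ : Circle} (hθ : θ ∈ landingAngles ψ a) : a ∈ closure (D.sector θ) :=
  D.closedRay_subset_closure_sector hθ (mem_insert _ _)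

/-- The two sides of a ray belong to different sectors, because a second ray lands at `a`. This is
used to show that passing to the closure creates no new interior points. -/
lemma exists_ne_mem_closure_sector {x : ℂ} (hx : x ∈ rayConfig ψ a) {θ : Circle}
    (_hθ : θ ∈ landingAngles ψ a) :
    ∃ η ∈ landingAngles ψ a, η ≠ θ ∧ x ∈ closure (D.sector η) := by
  rw [D.rayConfig_eq] at hx
  simp only [mem_iUnion] at hx
  obtain ⟨ξ, hξ, hx⟩ := hx
  by_cases hne : ξ = θ
  · subst hne
    obtain ⟨η, hη, hne⟩ := D.nontrivial.exists_ne ξ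
    obtain ⟨φ, h0, h2, rfl⟩ := exists_angle_of_ne hne.symm
    -- A point on the negative side of `ξ`, close enough to precede the next turn of the second ray:
    -- after adding `2π` its angle lies between `φ` and `2π`.
    set t := max ((φ - 2 * Real.pi) / 2) (-D.gap / 2)
    have ht0 : t < 0 := max_lt (by linarith) (by linarith [D.gap_pos])
    have ht1 : φ - 2 * Real.pi < t := lt_of_lt_of_le (by linarith) (le_max_left _ _)
    have ht2 : -D.gap < t := lt_of_lt_of_le (by linarith [D.gap_pos]) (le_max_right _ _)
    have hmem : ψ ((2 : ℝ) * (ξ * Circle.exp t : Circle)) ∈ raySector ψ ξ (-D.gap) 0 :=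
      ⟨(2, t), ⟨by norm_num, ht2, ht0⟩, rfl⟩
    obtain ⟨η', hη', hmem'⟩ := D.exists_sector (D.raySector_neg_subset hξ hmem)
    have hsub := D.subset_sector (D.bottcher.isPreconnected_raySector ξ (-D.gap) 0)
      (D.raySector_neg_subset hξ) ⟨_, hmem, hmem'⟩
    refine ⟨η', hη', ?_, ?_⟩
    · rintro rfl
      have hd := D.sector_disjoint_raySector hξ h0 h2 hη (η := η') ⟨_, hmem', (2, t + 2 * Real.pi),
        ⟨by norm_num, by dsimp only; linarith, by dsimp only; linarith⟩, ?_⟩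
      · exact disjoint_left.1 hd hmem' hmem'
      · dsimp only
        rw [Circle.exp_add, Circle.exp_two_pi, mul_one]
    · refine D.closedRay_subset_closure hξ (l := 𝓝[<] 0) nhdsWithin_le_nhds (fun r hr => ?_) hx
      have : -D.gap < 0 := by linarith [D.gap_pos]
      filter_upwards [Ioo_mem_nhdsLT this] with t ht
      exact hsub ⟨(r, t), ⟨hr, ht⟩, rfl⟩
  · exact ⟨ξ, hξ, hne, D.closedRay_subset_closure_sector hξ hx⟩

/-- The opposite configuration is connected through `-a` and disjoint from the rays at `a`, so a
single component contains it. -/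
lemma exists_crit : ∃ θ ∈ landingAngles ψ a, -rayConfig ψ a ⊆ D.sector θ := by
  have hsub : -rayConfig ψ a ⊆ (rayConfig ψ a)ᶜ := fun z hz hz' => D.neg_notMem hz' hz
  have ha : -a ∈ -rayConfig ψ a := neg_mem_neg.2 (mem_insert a _)
  obtain ⟨θ, hθ, h⟩ := D.exists_sector (hsub ha)
  exact ⟨θ, hθ, D.subset_sector (isPreconnected_neg D.isPreconnected_rayConfig) hsub ⟨_, ha, h⟩⟩

/-- The direction of the ray adjacent to the sector that contains the critical point. -/
noncomputable def crit : Circle := D.exists_crit.choose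

lemma crit_mem : D.crit ∈ landingAngles ψ a := D.exists_crit.choose_spec.1

lemma neg_rayConfig_subset : -rayConfig ψ a ⊆ D.sector D.crit := D.exists_crit.choose_spec.2

lemma neg_rayConfig_disjoint {θ : Circle} (hθ : θ ∈ landingAngles ψ a) (hne : θ ≠ D.crit) {z : ℂ}
    (hz : z ∈ D.sector θ) : -z ∉ rayConfig ψ a := fun h =>
  disjoint_left.1 (D.sector_disjoint hθ D.crit_mem hne) hz (D.neg_rayConfig_subset h)

/-- The mirror image of a noncritical sector stays connected when its boundary point `-a` is added;
it avoids the rays, and `-a` is in the critical sector. -/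
lemma neg_sector_subset {θ : Circle} (hθ : θ ∈ landingAngles ψ a) (hne : θ ≠ D.crit) :
    -D.sector θ ⊆ D.sector D.crit := by
  have hpre : IsPreconnected (insert (-a) (-D.sector θ)) := by
    refine (isPreconnected_neg (D.isPreconnected_sector θ)).subset_closure (subset_insert _ _)
      (insert_subset ?_ subset_closure)
    rw [← neg_closure]
    simpa using D.mem_closure_sector hθ
  have ha : -a ∈ -rayConfig ψ a := neg_mem_neg.2 (mem_insert a _)
  refine (subset_insert _ _).trans (D.subset_sector hpre ?_
    ⟨_, mem_insert _ _, D.neg_rayConfig_subset ha⟩)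
  refine insert_subset (D.sector_subset _ (D.neg_rayConfig_subset ha)) fun z hz hz' => ?_
  exact D.neg_rayConfig_disjoint hθ hne hz (by simpa)

lemma zero_mem_crit : (0 : ℂ) ∈ D.sector D.crit := by
  have h0 : (0 : ℂ) ∉ rayConfig ψ a := by
    rw [D.julia_mem D.bottcher.zero_mem]
    exact D.ne_zero.symm
  obtain ⟨θ, hθ, h⟩ := D.exists_sector h0
  by_cases hne : θ = D.crit
  · exact hne ▸ h
  · exact D.neg_sector_subset hθ hne (by simpa using h)

/-- The preimage of the rays consists of the rays and their opposites, and a noncritical sector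
meets neither. Which component contains the image is read off next to the ray. -/
lemma quad_sector_subset {θ : Circle} (hθ : θ ∈ landingAngles ψ a) (hne : θ ≠ D.crit) :
    MapsTo (quad c) (D.sector θ) (D.sector (θ ^ 2)) := by
  rw [mapsTo_iff_image_subset]
  refine D.subset_sector ((D.isPreconnected_sector θ).image _ (continuous_quad c).continuousOn)
    ?_ ?_
  · rintro _ ⟨z, hz, rfl⟩ h
    rcases D.quad_mem_rayConfig.1 h with h | h
    · exact D.sector_subset θ hz h
    · exact D.neg_rayConfig_disjoint hθ hne hz h
  · have hg := D.gap_pos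
    have h2 : (1 : ℝ) < 2 := by norm_num
    refine ⟨_, mem_image_of_mem _ (D.raySector_subset_sector hθ
      ⟨(2, D.gap / 4), ⟨h2, ?_, ?_⟩, rfl⟩), D.raySector_subset_sector (D.sq_mem hθ)
      ⟨(2 ^ 2, D.gap / 2), ⟨?_, ?_, ?_⟩, ?_⟩⟩
    · change 0 < D.gap / 4
      linarith
    · change D.gap / 4 < D.gap
      linarith
    · change (1 : ℝ) < 2 ^ 2
      norm_num
    · change 0 < D.gap / 2
      linarith
    · change D.gap / 2 < D.gap
      linarith
    · dsimp only
      rw [D.bottcher.conj_ray h2, mul_pow, ← Circle.exp_nsmul]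
      congr 5
      simp
      ring

/-- The boundary of a sector is sent to the rays, so a noncritical sector covers its image sector;
the remaining preimages are the opposite points. -/
lemma sector_quad_cases {θ : Circle} (hθ : θ ∈ landingAngles ψ a) (hne : θ ≠ D.crit) {z : ℂ}
    (hz : quad c z ∈ D.sector (θ ^ 2)) : z ∈ D.sector θ ∨ -z ∈ D.sector θ := by
  have hsub := quad_image_eq_of_closure (c := c) (D.isOpen_sector θ) ⟨_, D.base_mem_sector hθ⟩
    (D.isPreconnected_sector (θ ^ 2)) (D.quad_sector_subset hθ hne) ?_
  · obtain ⟨w, hw, h⟩ := hsub hz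
    rcases quad_eq_quad_iff.1 h with rfl | rfl
    · exact Or.inl hw
    · exact Or.inr hw
  · rintro x ⟨hx, hxT⟩
    refine D.closure_sector θ ⟨hx, fun h => D.sector_subset _ hxT ?_⟩
    exact D.quad_mem_rayConfig.2 (Or.inl h)

lemma sq_ne {θ η : Circle} (hθ : θ ∈ landingAngles ψ a) (hη : η ∈ landingAngles ψ a)
    (hne : θ ≠ η) : θ ^ 2 ≠ η ^ 2 := fun h => hne (D.sq_injOn hθ hη h)

/-- Were `c` in the image of a noncritical sector, its only preimage `0` would lie in that sector.
-/
lemma value_mem_sector : c ∈ D.sector (D.crit ^ 2) := by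
  have hq0 : quad c 0 = c := by simp [quad]
  have hcK : c ∈ quadFilledJulia c := by
    have := quad_mem_quadFilledJulia.2 D.bottcher.zero_mem
    rwa [hq0] at this
  obtain ⟨η, hη, h⟩ := D.exists_sector fun h => D.value_ne ((D.julia_mem hcK).1 h)
  obtain ⟨ξ, hξ, rfl⟩ := D.sq_surj hη
  by_cases hne : ξ = D.crit
  · exact hne ▸ h
  · exfalso
    have h0 := D.sector_quad_cases hξ hne (z := 0) (by rwa [hq0])
    rw [neg_zero, or_self] at h0
    exact disjoint_left.1 (D.sector_disjoint hξ D.crit_mem hne) h0 D.zero_mem_crit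

/-- The preimage of the sector of the critical value. -/
def central : Set ℂ := quad c ⁻¹' D.sector (D.crit ^ 2)

lemma isOpen_central : IsOpen D.central := (D.isOpen_sector _).preimage (continuous_quad c)

lemma zero_mem_central : (0 : ℂ) ∈ D.central := by
  simpa [central, quad] using D.value_mem_sector

/-- Every component covers the sector of the critical value, and the critical value has the single
preimage `0`; so every component contains `0`. -/
lemma isPreconnected_central : IsPreconnected D.central := by
  refine isPreconnected_of_forall 0 fun z hz => ⟨connectedComponentIn D.central z,
    connectedComponentIn_subset _ _, ?_, mem_connectedComponentIn hz,
    isPreconnected_connectedComponentIn⟩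
  have hsub := quad_image_eq_of_closure (c := c) (O := connectedComponentIn D.central z)
    D.isOpen_central.connectedComponentIn ⟨z, mem_connectedComponentIn hz⟩
    (D.isPreconnected_sector (D.crit ^ 2)) (fun x hx => connectedComponentIn_subset D.central z hx)
    closure_comp_inter_subset
  obtain ⟨w, hw, h⟩ := hsub D.value_mem_sector
  have : w = 0 := by simpa [quad] using h
  exact this ▸ hw

lemma central_notMem {z : ℂ} (hz : z ∈ D.central) : z ∉ rayConfig ψ a ∧ -z ∉ rayConfig ψ a := by
  have h := D.sector_subset _ hz
  rw [mem_compl_iff, D.quad_mem_rayConfig, not_or] at h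
  exact h

lemma central_subset : D.central ⊆ D.sector D.crit :=
  D.subset_sector D.isPreconnected_central (fun _ hz => (D.central_notMem hz).1)
    ⟨0, D.zero_mem_central, D.zero_mem_crit⟩

lemma central_disjoint_neg_sector {θ : Circle} (hθ : θ ∈ landingAngles ψ a) (hne : θ ≠ D.crit)
    {z : ℂ} (hz : z ∈ D.central) : -z ∉ D.sector θ := fun h =>
  disjoint_left.1 (D.sector_disjoint (D.sq_mem hθ) (D.sq_mem D.crit_mem)
    (D.sq_ne hθ D.crit_mem hne)) (D.quad_sector_subset hθ hne h) (by rw [quad_neg]; exact hz)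

/-- The partition into sectors is pulled back by the polynomial: the image sector is either that of
the critical value or that of a noncritical ray. -/
lemma crit_cases {z : ℂ} (hz : z ∈ D.sector D.crit) (hz' : -z ∉ rayConfig ψ a) :
    z ∈ D.central ∨ ∃ θ ∈ landingAngles ψ a, θ ≠ D.crit ∧ -z ∈ D.sector θ := by
  have h : quad c z ∉ rayConfig ψ a := by
    rw [D.quad_mem_rayConfig, not_or]
    exact ⟨D.sector_subset _ hz, hz'⟩
  obtain ⟨η, hη, h⟩ := D.exists_sector h
  obtain ⟨ξ, hξ, rfl⟩ := D.sq_surj hη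
  by_cases hne : ξ = D.crit
  · exact Or.inl (by rw [hne] at h; exact h)
  · right
    refine ⟨ξ, hξ, hne, (D.sector_quad_cases hξ hne h).resolve_left fun h' => ?_⟩
    exact disjoint_left.1 (D.sector_disjoint hξ D.crit_mem hne) h' hz

/-- The directions of the rays at `a` form a single cycle under squaring. -/
lemma exists_pow_eq_crit {θ : Circle} (hθ : θ ∈ landingAngles ψ a) :
    ∃ k : ℕ, θ ^ 2 ^ k = D.crit := by
  by_contra! hcon
  obtain ⟨k, hk⟩ : ∃ k : ℕ, 2 * Real.pi / 2 ^ k < D.gap := by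
    have : Tendsto (fun k : ℕ => 2 * Real.pi / 2 ^ k) atTop (𝓝 0) :=
      tendsto_const_nhds.div_atTop (tendsto_pow_atTop_atTop_of_one_lt (by norm_num))
    exact (this.eventually (gt_mem_nhds D.gap_pos)).exists
  -- Suppose the cycle of `θ` avoids `crit`. A point in the sector of `θ`, at angle `φ / 2 ^ k` from
  -- the ray, is carried by `k` doublings onto the ray opposite to `crit`. That ray is in the
  -- critical sector, but the orbit passes only through noncritical ones.
  have hne : θ ^ 2 ^ k ≠ -D.crit := fun h =>
    D.bottcher.landing_neg_notMem D.ne_zero D.crit_mem (h ▸ D.pow_mem hθ k)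
  obtain ⟨φ, h0, h2, hφ⟩ := exists_angle_of_ne hne
  set t := φ / 2 ^ k with ht
  have hpow : (0 : ℝ) < 2 ^ k := by positivity
  have ht0 : 0 < t := by positivity
  have htg : t < D.gap := lt_trans ((div_lt_div_iff_of_pos_right hpow).2 h2) hk
  have h12 : (1 : ℝ) < 2 := by norm_num
  have hz0 : ψ ((2 : ℝ) * (θ * Circle.exp t : Circle)) ∈ D.sector θ :=
    D.raySector_subset_sector hθ ⟨(2, t), ⟨h12, ht0, htg⟩, rfl⟩
  have horb : ∀ j : ℕ, (quad c)^[j] (ψ ((2 : ℝ) * (θ * Circle.exp t : Circle))) ∈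
      D.sector (θ ^ 2 ^ j) := by
    intro j
    induction j with
    | zero => simpa using hz0
    | succ j ih =>
      rw [Function.iterate_succ_apply', pow_succ, pow_mul]
      exact D.quad_sector_subset (D.pow_mem hθ j) (hcon j) ih
  have hend : (quad c)^[k] (ψ ((2 : ℝ) * (θ * Circle.exp t : Circle))) =
      ψ ((2 ^ 2 ^ k : ℝ) * (-D.crit : Circle)) := by
    rw [D.bottcher.iterate (one_lt_norm_mul h12 _), hφ, mul_pow, ← Circle.coe_pow, mul_pow θ,
      ← Circle.exp_nsmul]
    have : (2 ^ k) • t = φ := by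
      rw [nsmul_eq_mul, ht]
      push_cast
      field_simp
    rw [this]
    push_cast
    rfl
  have h1 := horb k
  rw [hend] at h1
  refine D.neg_rayConfig_disjoint (D.pow_mem hθ k) (hcon k) h1 ?_
  have hlt : (1 : ℝ) < 2 ^ 2 ^ k := one_lt_pow₀ h12 (by positivity)
  rw [D.bottcher.neg_ray hlt, neg_neg, D.ray_mem hlt]
  exact D.crit_mem

lemma pow_injOn (k : ℕ) : InjOn (fun ζ : Circle => ζ ^ 2 ^ k) (landingAngles ψ a) :=
  D.bottcher.injOn_landing_pow D.fixed D.ne_zero k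

/-- If the critical sector returns after `j` steps, so do all rays. -/
lemma pow_eq_self_of_crit {j : ℕ} (hj : D.crit ^ 2 ^ j = D.crit) {θ : Circle}
    (hθ : θ ∈ landingAngles ψ a) : θ ^ 2 ^ j = θ := by
  obtain ⟨k, hk⟩ := D.exists_pow_eq_crit hθ
  refine D.pow_injOn k (D.pow_mem hθ j) hθ ?_
  dsimp only
  rw [hk, ← pow_mul, mul_comm, pow_mul, hk, hj]

end IsDividing

/-! ### Truncation by equipotentials -/

lemma closedPotentialDisk_mono {c : ℂ} {ψ : ℂ → ℂ} {r s : ℝ} (h : r ≤ s) :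
    closedPotentialDisk c ψ r ⊆ closedPotentialDisk c ψ s :=
  union_subset_union_right _ (image_mono fun _ hw => ⟨hw.1, hw.2.trans h⟩)

lemma potentialDisk_mono {c : ℂ} {ψ : ℂ → ℂ} {r s : ℝ} (h : r ≤ s) :
    potentialDisk c ψ r ⊆ potentialDisk c ψ s :=
  union_subset_union_right _ (image_mono fun _ hw => ⟨hw.1, hw.2.trans_le h⟩)

lemma closedPotentialDisk_subset {c : ℂ} {ψ : ℂ → ℂ} {r s : ℝ} (h : r < s) :
    closedPotentialDisk c ψ r ⊆ potentialDisk c ψ s :=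
  union_subset_union_right _ (image_mono fun _ hw => ⟨hw.1, hw.2.trans_lt h⟩)

/-- A set which contains with a point of a ray the whole ray. -/
def IsRadial (ψ : ℂ → ℂ) (X : Set ℂ) : Prop :=
  ∀ ζ : Circle, ∀ r s : ℝ, 1 < r → 1 < s → ψ (r * ζ) ∈ X → ψ (s * ζ) ∈ X

lemma IsDividing.isRadial_sector {c : ℂ} {ψ : ℂ → ℂ} {a : ℂ} (D : IsDividing c ψ a) (θ : Circle) :
    IsRadial ψ (D.sector θ) := by
  intro ζ r s hr hs h
  have hζ := D.sector_subset θ h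
  rw [mem_compl_iff, D.ray_mem hr] at hζ
  refine D.subset_sector (C := externalRay ψ ζ) ?_ ?_ ⟨_, ⟨r, hr, rfl⟩, h⟩ ⟨s, hs, rfl⟩
  · exact isPreconnected_Ioi.image _ (D.bottcher.continuousOn.comp (by fun_prop)
      fun r hr => one_lt_norm_mul hr ζ)
  · rintro _ ⟨t, ht, rfl⟩
    rw [mem_compl_iff, D.ray_mem ht]
    exact hζ

lemma IsDividing.isRadial_central {c : ℂ} {ψ : ℂ → ℂ} {a : ℂ} (D : IsDividing c ψ a) :
    IsRadial ψ D.central := by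
  intro ζ r s hr hs h
  simp only [central, mem_preimage, D.bottcher.conj_ray hs, D.bottcher.conj_ray hr] at h ⊢
  exact D.isRadial_sector _ _ _ _ (one_lt_pow₀ hr two_ne_zero) (one_lt_pow₀ hs two_ne_zero) h

open Classical in
/-- The truncation of a connected radial set by an equipotential is connected. -/
lemma IsInverseBottcher.isPreconnected_inter_potentialDisk {c : ℂ} {ψ : ℂ → ℂ}
    (hψ : IsInverseBottcher c ψ) {X : Set ℂ} (hX : IsPreconnected X) (hrad : IsRadial ψ X) {R : ℝ}
    (hR : 1 < R) : IsPreconnected (X ∩ potentialDisk c ψ R) := by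
  -- a retraction of the closed disks of smaller level
  have key : ∀ r : ℝ, 1 < r → IsPreconnected (X ∩ closedPotentialDisk c ψ r) := by
    intro r hr
    have hr0 : 0 < r := by linarith
    -- `m` lowers the modulus to at most `r` along rays. Conjugated by `ψ` it becomes a retraction
    -- `Φ` of the plane onto the closed disk of level `r`, which preserves radial sets.
    set E : Set ℂ := {w | 1 < ‖w‖}
    set m : ℂ → ℂ := fun w => (min 1 (r / ‖w‖) : ℝ) * w with hm
    have hmnorm : ∀ w, 1 < ‖w‖ → ‖m w‖ = min ‖w‖ r := by
      intro w hw
      have hw0 : 0 < ‖w‖ := by linarith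
      simp only [hm, norm_mul, Complex.norm_real, Real.norm_eq_abs]
      rw [abs_of_nonneg (by positivity), min_mul_of_nonneg _ _ hw0.le, one_mul,
        div_mul_cancel₀ _ hw0.ne']
    have hmE : ∀ w ∈ E, m w ∈ E := fun w hw => by
      change 1 < ‖m w‖
      rw [hmnorm w hw]
      exact lt_min hw hr
    set Φ : ℂ → ℂ := fun z => if z ∈ closedPotentialDisk c ψ r then z
      else ψ (m (Function.invFunOn ψ E z)) with hΦ
    have hΦψ : ∀ w ∈ E, Φ (ψ w) = ψ (m w) := by
      intro w hw
      have hinv : Function.invFunOn ψ E (ψ w) = w := hψ.injOn.leftInvOn_invFunOn hw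
      by_cases h : ‖w‖ ≤ r
      · have hmw : m w = w := by
          have : (1 : ℝ) ≤ r / ‖w‖ := (one_le_div (by linarith [mem_ofPred_eq.mp hw])).2 h
          simp [hm, min_eq_left this]
        simp [hΦ, hψ.mem_closedPotentialDisk hw, h, hmw]
      · simp [hΦ, hψ.mem_closedPotentialDisk hw, h, hinv]
    have hcont : Continuous Φ := by
      rw [continuous_iff_continuousAt]
      intro z
      by_cases hz : z ∈ potentialDisk c ψ r
      · refine continuousAt_id.congr ?_
        filter_upwards [(hψ.isOpen_potentialDisk hr).mem_nhds hz] with y hy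
        simp [hΦ, IsInverseBottcher.potentialDisk_subset_closed hy]
      · obtain ⟨w, hw, rfl⟩ := hψ.exists_of_notMem fun h => hz (Or.inl h)
        rw [ContinuousAt, hΦψ w hw]
        intro V hV
        have hmc : ContinuousAt (fun w => ψ (m w)) w := by
          refine ContinuousAt.comp (g := ψ) (hψ.continuousOn.continuousAt
            ((isOpen_lt continuous_const continuous_norm).mem_nhds (hmE w hw))) ?_
          have hw0 : ‖w‖ ≠ 0 := by linarith [mem_ofPred_eq.mp hw]
          simp only [hm]
          fun_prop (disch := assumption)
        obtain ⟨W, hW, hWo, hwW⟩ := mem_nhds_iff.1 (inter_mem (hmc hV)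
          ((isOpen_lt continuous_const continuous_norm).mem_nhds hw))
        rw [mem_map]
        refine mem_of_superset ((hψ.isOpen_image hWo (fun x hx => (hW hx).2)).mem_nhds
          (mem_image_of_mem _ hwW)) ?_
        rintro _ ⟨x, hx, rfl⟩
        rw [mem_preimage, hΦψ x (hW hx).2]
        exact (hW hx).1
    have himage : Φ '' X = X ∩ closedPotentialDisk c ψ r := by
      ext y
      constructor
      · rintro ⟨z, hz, rfl⟩
        by_cases hK : z ∈ quadFilledJulia c
        · have : z ∈ closedPotentialDisk c ψ r := Or.inl hK
          simp [hΦ, this, hz]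
        · obtain ⟨w, hw, rfl⟩ := hψ.exists_of_notMem hK
          rw [hΦψ w hw]
          refine ⟨?_, (hψ.mem_closedPotentialDisk (hmE w hw)).2 ?_⟩
          · obtain ⟨ζ, hζ⟩ := exists_polar w
            have hw0 : 0 < ‖w‖ := by linarith
            have hmw : m w = ((min ‖w‖ r : ℝ) : ℂ) * ζ := by
              conv_lhs => rw [hm]
              dsimp only
              conv_lhs => rw [hζ]
              rw [Circle_norm_mul, abs_of_pos hw0, ← mul_assoc, ← Complex.ofReal_mul,
                min_mul_of_nonneg _ _ hw0.le, one_mul, div_mul_cancel₀ _ hw0.ne']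
            rw [hmw]
            rw [hζ] at hz
            exact hrad ζ _ _ hw (lt_min hw hr) hz
          · rw [hmnorm w hw]
            exact min_le_right _ _
      · rintro ⟨hy, hyr⟩
        exact ⟨y, hy, by simp [hΦ, hyr]⟩
    rw [← himage]
    exact hX.image _ hcont.continuousOn
  -- Any two points of the open truncation lie in a common closed truncation of smaller level.
  intro u v hu hv huv hxu hxv
  obtain ⟨x, ⟨hxX, hxR⟩, hxu⟩ := hxu
  obtain ⟨y, ⟨hyX, hyR⟩, hyv⟩ := hxv
  have hlev : ∀ z ∈ potentialDisk c ψ R, ∃ r, 1 < r ∧ r < R ∧ z ∈ closedPotentialDisk c ψ r := by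
    rintro z (hz | ⟨w, hw, rfl⟩)
    · exact ⟨(1 + R) / 2, by linarith, by linarith, Or.inl hz⟩
    · exact ⟨‖w‖, hw.1, hw.2, Or.inr ⟨w, ⟨hw.1, le_rfl⟩, rfl⟩⟩
  obtain ⟨r, hr1, hrR, hxr⟩ := hlev x hxR
  obtain ⟨s, hs1, hsR, hys⟩ := hlev y hyR
  have hsub : closedPotentialDisk c ψ (max r s) ⊆ potentialDisk c ψ R :=
    closedPotentialDisk_subset (max_lt hrR hsR)
  obtain ⟨z, hz, hzuv⟩ := key (max r s) (hr1.trans_le (le_max_left _ _)) u v hu hv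
    ((inter_subset_inter_right _ hsub).trans huv) ⟨x, ⟨hxX, closedPotentialDisk_mono (le_max_left _ _) hxr⟩, hxu⟩
    ⟨y, ⟨hyX, closedPotentialDisk_mono (le_max_right _ _) hys⟩, hyv⟩
  exact ⟨z, ⟨hz.1, hsub hz.2⟩, hzuv⟩

end Yoccoz

namespace Yoccoz

/-! ### Transfer to the dynamical plane of a quadratic-like map -/

namespace IsQuadraticLike

variable {f : ℂ → ℂ} {U' U : Set ℂ} (hf : IsQuadraticLike f U' U)
include hf

lemma isOpen_dom : IsOpen U' := hf.disk_dom.1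

lemma continuousAt {z : ℂ} (hz : z ∈ U') : ContinuousAt f z :=
  hf.holo.continuousOn.continuousAt (hf.isOpen_dom.mem_nhds hz)

lemma dom_subset : U' ⊆ U := fun _ hz => interior_subset (hf.compactly.2 (subset_closure hz))

lemma isPreconnected_dom : IsPreconnected U' := by
  have := hf.disk_dom.2
  exact (isPreconnected_iff_preconnectedSpace (s := U')).2 inferInstance

lemma isOpen_preimage {S : Set ℂ} (hS : IsOpen S) : IsOpen (U' ∩ f ⁻¹' S) :=
  hf.holo.continuousOn.isOpen_inter_preimage hf.isOpen_dom hS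

lemma isOpen_image {S : Set ℂ} (hS : IsOpen S) (hSU : S ⊆ U') : IsOpen (f '' S) := by
  have han : AnalyticOnNhd ℂ f U' := hf.holo.analyticOnNhd hf.isOpen_dom
  rcases han.is_constant_or_isOpen hf.isPreconnected_dom with ⟨w, h⟩ | h
  · exfalso
    have hsub : U' ⊆ {z ∈ U' | f z = f 0} := fun z hz => ⟨hz, (h z hz).trans (h 0 hf.zero_mem).symm⟩
    rw [hf.fiber_critical] at hsub
    have h1 : U' = {0} := subset_antisymm hsub (singleton_subset_iff.2 hf.zero_mem)
    have h2 := hf.isOpen_dom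
    rw [h1] at h2
    exact not_isOpen_singleton (0 : ℂ) h2
  · exact h S hSU hS

/-- Points close to `f x` have preimages close to `x`. -/
lemma mem_closure_preimage {S : Set ℂ} {x : ℂ} (hx : x ∈ U') (h : f x ∈ closure S) :
    x ∈ closure (U' ∩ f ⁻¹' S) := by
  rw [mem_closure_iff] at h ⊢
  intro o ho hxo
  obtain ⟨_, ⟨y, hy, rfl⟩, hyS⟩ := h _ (hf.isOpen_image (ho.inter hf.isOpen_dom) inter_subset_right)
    ⟨x, ⟨hxo, hx⟩, rfl⟩
  exact ⟨y, hy.1, hy.2, hyS⟩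

lemma closure_preimage_subset {S : Set ℂ} (hS : IsCompact (closure S)) (hSU : closure S ⊆ U) :
    closure (U' ∩ f ⁻¹' S) ⊆ U' ∩ f ⁻¹' closure S :=
  closure_minimal (inter_subset_inter_right _ (preimage_mono subset_closure))
    (hf.proper _ hSU hS).isClosed

/-- Components of preimages of connected open sets are mapped onto these sets. -/
lemma image_eq_of_closure {O T : Set ℂ} (hO : IsOpen O) (hOU : O ⊆ U') (hne : O.Nonempty)
    (hT : IsPreconnected T) (hTc : IsCompact (closure T)) (hTU : closure T ⊆ U)
    (hm : MapsTo f O T) (hcl : closure O ∩ (U' ∩ f ⁻¹' T) ⊆ O) : T ⊆ f '' O := by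
  obtain ⟨x, hx⟩ := hne
  refine hT.subset_of_closure_inter_subset (hf.isOpen_image hO hOU)
    ⟨_, hm hx, mem_image_of_mem _ hx⟩ ?_
  rintro y ⟨hy, hyT⟩
  have hsub : closure O ⊆ U' ∩ f ⁻¹' closure T :=
    (closure_mono (fun z hz => ⟨hOU hz, hm hz⟩ : O ⊆ U' ∩ f ⁻¹' T)).trans (hf.closure_preimage_subset hTc hTU)
  have hcomp : IsCompact (closure O) := (hf.proper _ hTU hTc).of_isClosed_subset isClosed_closure hsub
  have h1 : IsCompact (f '' closure O) :=
    hcomp.image_of_continuousOn (hf.holo.continuousOn.mono (hsub.trans inter_subset_left))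
  obtain ⟨z, hz, rfl⟩ := closure_minimal (image_mono subset_closure) h1.isClosed hy
  exact ⟨z, hcl ⟨hz, (hsub hz).1, hyT⟩, rfl⟩

end IsQuadraticLike

lemma filledJulia_subset {f : ℂ → ℂ} {U' : Set ℂ} : filledJulia f U' ⊆ U' := fun _ hz => hz 0

lemma map_mem_filledJulia {f : ℂ → ℂ} {U' : Set ℂ} {z : ℂ} (hz : z ∈ filledJulia f U') :
    f z ∈ filledJulia f U' := fun n => by
  rw [← Function.iterate_succ_apply]; exact hz (n + 1)

lemma iterate_mem_filledJulia {f : ℂ → ℂ} {U' : Set ℂ} {z : ℂ} (hz : z ∈ filledJulia f U') (n : ℕ) :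
    f^[n] z ∈ filledJulia f U' := by
  induction n with
  | zero => exact hz
  | succ n ih => rw [Function.iterate_succ_apply']; exact map_mem_filledJulia ih

lemma mem_filledJulia_of_map {f : ℂ → ℂ} {U' : Set ℂ} {z : ℂ} (hz : z ∈ U')
    (h : f z ∈ filledJulia f U') : z ∈ filledJulia f U'
  | 0 => hz
  | n + 1 => by rw [Function.iterate_succ_apply]; exact h n

namespace PuzzleData

variable {f : ℂ → ℂ} {U' U : Set ℂ} (P : PuzzleData f U')

lemma julia_source {z : ℂ} (hz : z ∈ filledJulia f U') : z ∈ P.h.source :=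
  P.conj.filledJulia_subset hz

lemma julia_map {z : ℂ} (hz : z ∈ filledJulia f U') : P.h z ∈ quadFilledJulia P.c := by
  rw [← P.conj.image_filledJulia]
  exact mem_image_of_mem _ hz

lemma julia_conj {z : ℂ} (hz : z ∈ filledJulia f U') : P.h (f z) = quad P.c (P.h z) :=
  P.conj.conj z (P.julia_source hz) (P.julia_source (map_mem_filledJulia hz))

lemma α_mem_julia : P.α ∈ filledJulia f U' := fun n => by
  rw [Function.iterate_fixed P.α_fixed]; exact P.α_mem

lemma fixed : quad P.c (P.h P.α) = P.h P.α := by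
  rw [← P.julia_conj P.α_mem_julia, P.α_fixed]

lemma source_subset : P.h.source ⊆ U' := P.conj.source_subset

lemma potentialDisk_subset_target {r : ℝ} (hr : r ≤ P.ρ ^ 2) :
    closedPotentialDisk P.c P.ψ r ⊆ P.h.target :=
  (closedPotentialDisk_mono hr).trans P.level

lemma ρ_le_sq : P.ρ ≤ P.ρ ^ 2 := by nlinarith [P.one_lt_ρ]

lemma isOpen_domain : IsOpen P.domain :=
  P.h.isOpen_inter_preimage (P.bottcher.isOpen_potentialDisk P.one_lt_ρ)

lemma julia_domain {z : ℂ} (hz : z ∈ filledJulia f U') : z ∈ P.domain :=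
  ⟨P.julia_source hz, Or.inl (P.julia_map hz)⟩

/-- The part of the dynamical plane of `f` of level less than `r` corresponding to `X`. -/
def lift (r : ℝ) (X : Set ℂ) : Set ℂ := P.h.source ∩ P.h ⁻¹' (X ∩ potentialDisk P.c P.ψ r)

lemma lift_eq_image {r : ℝ} (hr : r ≤ P.ρ ^ 2) (X : Set ℂ) :
    P.lift r X = P.h.symm '' (X ∩ potentialDisk P.c P.ψ r) := by
  rw [P.h.symm_image_eq_source_inter_preimage]
  · rfl
  · exact (inter_subset_right.trans IsInverseBottcher.potentialDisk_subset_closed).trans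
      (P.potentialDisk_subset_target hr)

lemma isPreconnected_lift {r : ℝ} (hr1 : 1 < r) (hr : r ≤ P.ρ ^ 2) {X : Set ℂ}
    (hX : IsPreconnected X) (hrad : IsRadial P.ψ X) : IsPreconnected (P.lift r X) := by
  rw [P.lift_eq_image hr]
  refine (P.bottcher.isPreconnected_inter_potentialDisk hX hrad hr1).image _
    (P.h.continuousOn_symm.mono ?_)
  exact (inter_subset_right.trans IsInverseBottcher.potentialDisk_subset_closed).trans
      (P.potentialDisk_subset_target hr)

lemma isOpen_lift {r : ℝ} (hr1 : 1 < r) {X : Set ℂ} (hX : IsOpen X) : IsOpen (P.lift r X) :=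
  P.h.isOpen_inter_preimage (hX.inter (P.bottcher.isOpen_potentialDisk hr1))

lemma closure_lift_level {r : ℝ} (hr : r ≤ P.ρ ^ 2) (X : Set ℂ) :
    IsCompact (closure (P.lift r X)) ∧
      closure (P.lift r X) ⊆ P.h.source ∩ P.h ⁻¹' closedPotentialDisk P.c P.ψ r := by
  have hsub := P.potentialDisk_subset_target hr
  have hcomp : IsCompact (P.h.symm '' closedPotentialDisk P.c P.ψ r) :=
    P.bottcher.isCompact_closedPotentialDisk.image_of_continuousOn (P.h.continuousOn_symm.mono hsub)
  have hle : P.lift r X ⊆ P.h.symm '' closedPotentialDisk P.c P.ψ r := by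
    rw [P.lift_eq_image hr]
    exact image_mono (inter_subset_right.trans IsInverseBottcher.potentialDisk_subset_closed)
  have hcl := closure_minimal hle hcomp.isClosed
  refine ⟨hcomp.of_isClosed_subset isClosed_closure hcl, ?_⟩
  rwa [P.h.symm_image_eq_source_inter_preimage hsub] at hcl

lemma closure_lift {r : ℝ} (hr : r ≤ P.ρ ^ 2) {X : Set ℂ} {x : ℂ} (hx : x ∈ closure (P.lift r X)) :
    x ∈ P.h.source ∧ P.h x ∈ closure X ∧ P.h x ∈ closedPotentialDisk P.c P.ψ r := by
  have h1 := (P.closure_lift_level hr X).2 hx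
  refine ⟨h1.1, ?_, h1.2⟩
  exact closure_mono (image_subset_iff.2 fun z hz => hz.2.1)
    (mem_closure_image (P.h.continuousAt h1.1) hx)

lemma mem_closure_lift {r : ℝ} (hr1 : 1 < r) (hr : r ≤ P.ρ ^ 2) {X : Set ℂ} {x : ℂ}
    (hx : x ∈ P.h.source) (hxr : P.h x ∈ potentialDisk P.c P.ψ r) (hX : P.h x ∈ closure X) :
    x ∈ closure (P.lift r X) := by
  rw [P.lift_eq_image hr, ← P.h.left_inv hx]
  refine mem_closure_image (P.h.continuousAt_symm (P.h.map_source hx)) ?_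
  rw [inter_comm]
  exact (P.bottcher.isOpen_potentialDisk hr1).inter_closure ⟨hxr, hX⟩

lemma domain_eq_lift : P.domain = P.lift P.ρ univ := by simp [lift, domain]

lemma isCompact_closure_domain : IsCompact (closure P.domain) := by
  rw [domain_eq_lift]
  exact (P.closure_lift_level P.ρ_le_sq univ).1

lemma closure_domain_subset : closure P.domain ⊆ U' := by
  rw [domain_eq_lift]
  exact ((P.closure_lift_level P.ρ_le_sq univ).2.trans inter_subset_left).trans P.source_subset

section
variable (hf : IsQuadraticLike f U' U)
include hf

/-- The conjugacy is only topological, so the critical point is recognized by its fibre: the point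
sent to `0` shares its value under `f` with no other point, whereas the other fibres of `f` have two
elements. -/
lemma zero_julia : (0 : ℂ) ∈ filledJulia f U' ∧ P.h 0 = 0 := by
  obtain ⟨z, hz, hz0⟩ : ∃ z ∈ filledJulia f U', P.h z = 0 := by
    have := P.bottcher.zero_mem
    rwa [← P.conj.image_filledJulia] at this
  have key : z = 0 := by
    by_cases hv : f z = f 0
    · have : z ∈ ({0} : Set ℂ) := by
        rw [← hf.fiber_critical]
        exact ⟨filledJulia_subset hz, hv⟩
      exact this
    · exfalso
      have h2 := hf.fiber (f z) (hf.mapsTo (filledJulia_subset hz)) hv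
      have hsub : {y ∈ U' | f y = f z} ⊆ {z} := by
        rintro y ⟨hy, he⟩
        have hyJ := mem_filledJulia_of_map hy (he ▸ map_mem_filledJulia hz)
        have h3 := P.julia_conj hyJ
        rw [he, P.julia_conj hz, hz0, quad_eq_quad_iff] at h3
        have h0 : P.h y = 0 := by
          rcases h3 with h | h
          · exact h.symm
          · exact neg_eq_zero.1 h.symm
        exact P.h.injOn (P.julia_source hyJ) (P.julia_source hz) (h0.trans hz0.symm)
      have := ncard_le_ncard hsub (finite_singleton z)
      rw [ncard_singleton, h2] at this
      omega
  exact ⟨key ▸ hz, key ▸ hz0⟩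

/-- The conjugacy relation presupposes that `f z` is in the source of `h`. This condition is open in
the connected domain; it is also closed, since where it holds `f` equals `h⁻¹ ∘ quad ∘ h`, which is
continuous on the domain because the level `ρ ^ 2` is still in the target. -/
lemma conj_domain {z : ℂ} (hz : z ∈ P.domain) :
    f z ∈ P.h.source ∧ P.h (f z) = quad P.c (P.h z) := by
  suffices h : P.domain ⊆ P.domain ∩ (U' ∩ f ⁻¹' P.h.source) from
    ⟨(h hz).2.2, P.conj.conj z hz.1 (h hz).2.2⟩
  have hpre : IsPreconnected P.domain := by
    rw [domain_eq_lift]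
    exact P.isPreconnected_lift P.one_lt_ρ P.ρ_le_sq isPreconnected_univ (fun _ _ _ _ _ h => h)
  refine hpre.subset_of_closure_inter_subset
    (P.isOpen_domain.inter (hf.isOpen_preimage P.h.open_source)) ?_ ?_
  · have h0 := (P.zero_julia hf).1
    exact ⟨0, P.julia_domain h0, P.julia_domain h0, filledJulia_subset h0,
      P.julia_source (map_mem_filledJulia h0)⟩
  · rintro x ⟨hx, hxD⟩
    refine ⟨hxD, P.source_subset hxD.1, ?_⟩
    have hq : quad P.c (P.h x) ∈ P.h.target :=
      P.level (IsInverseBottcher.potentialDisk_subset_closed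
        ((P.bottcher.quad_mem_potentialDisk (by linarith [P.one_lt_ρ])).2 hxD.2))
    set G : ℂ → ℂ := fun y => P.h.symm (quad P.c (P.h y)) with hG
    have hGc : ContinuousAt G x :=
      ContinuousAt.comp (g := P.h.symm) (P.h.continuousAt_symm hq)
        ((continuous_quad P.c).continuousAt.comp (P.h.continuousAt hxD.1))
    have hfc : ContinuousAt f x := hf.continuousAt (P.source_subset hxD.1)
    have : (𝓝[P.domain ∩ (U' ∩ f ⁻¹' P.h.source)] x).NeBot :=
      mem_closure_iff_nhdsWithin_neBot.1 hx
    have hfG : f x = G x := by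
      refine tendsto_nhds_unique (l := 𝓝[P.domain ∩ (U' ∩ f ⁻¹' P.h.source)] x)
        (hfc.tendsto.mono_left nhdsWithin_le_nhds) (Tendsto.congr' ?_
        (hGc.tendsto.mono_left nhdsWithin_le_nhds))
      filter_upwards [self_mem_nhdsWithin] with y hy
      simp only [hG]
      rw [← P.conj.conj y hy.1.1 hy.2.2, P.h.left_inv hy.2.2]
    rw [mem_preimage, hfG]
    exact P.h.map_target hq

/-- Both preimages under the polynomial transfer to points of the domain with value `f z`. They
exhaust the two-point fibre, so there is no preimage where `h` is undefined. -/
lemma mem_domain_of_map {z : ℂ} (hz : z ∈ U') (h : f z ∈ P.domain) : z ∈ P.domain := by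
  obtain ⟨h0J, h00⟩ := P.zero_julia hf
  by_cases hv : f z = f 0
  · have : z ∈ ({0} : Set ℂ) := by
      rw [← hf.fiber_critical]
      exact ⟨hz, hv⟩
    rw [mem_singleton_iff.1 this]
    exact P.julia_domain h0J
  · obtain ⟨s, hs⟩ : ∃ s : ℂ, quad P.c s = P.h (f z) := by
      obtain ⟨s, hs⟩ := IsAlgClosed.exists_pow_nat_eq (P.h (f z) - P.c) two_pos
      exact ⟨s, by rw [quad, hs]; ring⟩
    have hρ0 : 0 ≤ P.ρ := by linarith [P.one_lt_ρ]
    have hsD : s ∈ potentialDisk P.c P.ψ P.ρ := by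
      rw [← P.bottcher.quad_mem_potentialDisk hρ0, hs]
      exact potentialDisk_mono P.ρ_le_sq h.2
    have hpt : ∀ t ∈ potentialDisk P.c P.ψ P.ρ, quad P.c t = P.h (f z) →
        P.h.symm t ∈ P.domain ∧ P.h (P.h.symm t) = t ∧ f (P.h.symm t) = f z := by
      intro t ht hq
      have htt : t ∈ P.h.target := P.potentialDisk_subset_target P.ρ_le_sq
        (IsInverseBottcher.potentialDisk_subset_closed ht)
      have hD : P.h.symm t ∈ P.domain := ⟨P.h.map_target htt, by
        rw [mem_preimage, P.h.right_inv htt]; exact ht⟩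
      obtain ⟨h1, h2⟩ := P.conj_domain hf hD
      rw [P.h.right_inv htt, hq] at h2
      exact ⟨hD, P.h.right_inv htt, P.h.injOn h1 h.1 h2⟩
    obtain ⟨hD1, hr1, hf1⟩ := hpt s hsD hs
    obtain ⟨hD2, hr2, hf2⟩ := hpt (-s) ((P.bottcher.neg_mem_potentialDisk hρ0).2 hsD)
      ((quad_neg _ _).trans hs)
    have hne : P.h.symm s ≠ P.h.symm (-s) := by
      intro he
      have : s = -s := hr1.symm.trans ((congrArg P.h he).trans hr2)
      have hs0 : s = 0 := self_eq_neg.1 this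
      apply hv
      refine P.h.injOn h.1 (P.julia_source (map_mem_filledJulia h0J)) ?_
      rw [P.julia_conj h0J, h00, ← hs, hs0]
    have h2 := hf.fiber (f z) (hf.mapsTo hz) hv
    have hsub : {P.h.symm s, P.h.symm (-s)} ⊆ {y ∈ U' | f y = f z} := by
      rintro y (rfl | rfl)
      · exact ⟨P.source_subset hD1.1, hf1⟩
      · exact ⟨P.source_subset hD2.1, hf2⟩
    have heq := eq_of_subset_of_ncard_le hsub (by rw [h2, ncard_pair hne])
      (finite_of_ncard_ne_zero (by rw [h2]; norm_num))
    have hzm : z ∈ ({P.h.symm s, P.h.symm (-s)} : Set ℂ) := by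
      rw [heq]
      exact ⟨hz, rfl⟩
    rcases hzm with rfl | rfl
    · exact hD1
    · exact hD2

end

end PuzzleData
end Yoccoz

/-! ### Puzzle pieces of depth zero and one -/

namespace Yoccoz

lemma IsDividing.preimage_sector {c : ℂ} {ψ : ℂ → ℂ} {a : ℂ} (D : IsDividing c ψ a) {θ : Circle}
    (hθ : θ ∈ landingAngles ψ a) (hne : θ ≠ D.crit) :
    quad c ⁻¹' D.sector (θ ^ 2) = D.sector θ ∪ -D.sector θ := by
  ext z
  refine ⟨D.sector_quad_cases hθ hne, ?_⟩
  rintro (h | h)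
  · exact D.quad_sector_subset hθ hne h
  · rw [mem_preimage, ← quad_neg]
    exact D.quad_sector_subset hθ hne h

lemma IsInverseBottcher.interior_closedPotentialDisk {c : ℂ} {ψ : ℂ → ℂ}
    (hψ : IsInverseBottcher c ψ) {r : ℝ} :
    interior (closedPotentialDisk c ψ r) ⊆ potentialDisk c ψ r := by
  intro z hz
  by_cases hK : z ∈ quadFilledJulia c
  · exact Or.inl hK
  · obtain ⟨s, hs, ζ, rfl⟩ := hψ.exists_ray_of_notMem hK
    rw [hψ.mem_potentialDisk (one_lt_norm_mul hs ζ), Circle_norm_mul, abs_of_pos (by linarith)]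
    have hc : ContinuousAt (fun t : ℝ => ψ (t * ζ)) s :=
      ContinuousAt.comp (f := fun t : ℝ => (t : ℂ) * ζ) (g := ψ) (hψ.continuousOn.continuousAt
        ((isOpen_lt continuous_const continuous_norm).mem_nhds (one_lt_norm_mul hs _)))
        (by fun_prop)
    have hev : ∀ᶠ t : ℝ in 𝓝[>] s, ψ (t * ζ) ∈ closedPotentialDisk c ψ r :=
      (hc.tendsto.mono_left nhdsWithin_le_nhds).eventually (mem_interior_iff_mem_nhds.1 hz)
    obtain ⟨t, ht, hts⟩ := (hev.and self_mem_nhdsWithin).exists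
    have hts' : s < t := hts
    rw [hψ.mem_closedPotentialDisk (one_lt_norm_mul (hs.trans hts') ζ), Circle_norm_mul,
      abs_of_pos (by linarith)] at ht
    linarith

/-- Puzzle data for a quadratic-like map, with finitely many periodic rays landing at `α` and the
critical orbit off `α`. -/
structure PuzzleData.IsAdmissible {f : ℂ → ℂ} {U' : Set ℂ} (U : Set ℂ) (P : PuzzleData f U') :
    Prop where
  ql : IsQuadraticLike f U' U
  dividing : IsDividing P.c P.ψ (P.h P.α)
  land : ∀ n : ℕ, f^[n] 0 ≠ P.α
  period_pos : 0 < P.period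
  period_spec : ∀ ζ ∈ landingAngles P.ψ (P.h P.α), ζ ^ 2 ^ P.period = ζ

namespace PuzzleData

variable {f : ℂ → ℂ} {U' U : Set ℂ} {P : PuzzleData f U'}

lemma one_lt_sqrt (P : PuzzleData f U') : 1 < √P.ρ :=
  Real.lt_sqrt_of_sq_lt (by simpa using P.one_lt_ρ)

lemma sq_sqrt (P : PuzzleData f U') : √P.ρ ^ 2 = P.ρ := Real.sq_sqrt (by linarith [P.one_lt_ρ])

lemma sqrt_lt (P : PuzzleData f U') : √P.ρ < P.ρ := by
  nlinarith [P.one_lt_sqrt, P.sq_sqrt]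

lemma sqrt_le_sq (P : PuzzleData f U') : √P.ρ ≤ P.ρ ^ 2 := P.sqrt_lt.le.trans P.ρ_le_sq

/-- A preimage has level `√ρ` instead of `ρ`. This drop keeps closed pieces of depth one away from
the equipotential `E`. -/
lemma preimage_lift (P : PuzzleData f U') (hf : IsQuadraticLike f U' U) (X : Set ℂ) :
    U' ∩ f ⁻¹' P.lift P.ρ X = P.lift √P.ρ (quad P.c ⁻¹' X) := by
  ext z
  constructor
  · rintro ⟨hz, h⟩
    have hD := P.mem_domain_of_map hf hz ⟨h.1, h.2.2⟩
    refine ⟨hD.1, ?_, ?_⟩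
    · rw [mem_preimage, ← (P.conj_domain hf hD).2]
      exact h.2.1
    · rw [← P.bottcher.quad_mem_potentialDisk (by positivity), P.sq_sqrt,
        ← (P.conj_domain hf hD).2]
      exact h.2.2
  · rintro ⟨hz, hX, hr⟩
    have hD : z ∈ P.domain := ⟨hz, potentialDisk_mono P.sqrt_lt.le hr⟩
    obtain ⟨h1, h2⟩ := P.conj_domain hf hD
    refine ⟨P.source_subset hz, h1, ?_⟩
    rw [mem_preimage, h2]
    refine ⟨hX, ?_⟩
    rw [← P.sq_sqrt, P.bottcher.quad_mem_potentialDisk (by positivity)]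
    exact hr

lemma lift_sqrt_subset (P : PuzzleData f U') (X : Set ℂ) : P.lift √P.ρ X ⊆ P.lift P.ρ X :=
  fun _ hz => ⟨hz.1, hz.2.1, potentialDisk_mono P.sqrt_lt.le hz.2.2⟩

lemma lift_mono (P : PuzzleData f U') {r : ℝ} {X Y : Set ℂ} (h : X ⊆ Y) :
    P.lift r X ⊆ P.lift r Y := fun _ hz => ⟨hz.1, h hz.2.1, hz.2.2⟩

lemma lift_union (P : PuzzleData f U') {r : ℝ} {X Y : Set ℂ} :
    P.lift r (X ∪ Y) = P.lift r X ∪ P.lift r Y := by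
  ext z
  simp only [lift, mem_inter_iff, mem_preimage, mem_union]
  tauto

lemma julia_lift {r : ℝ} {X : Set ℂ} {z : ℂ} (hz : z ∈ filledJulia f U') (h : P.h z ∈ X) :
    z ∈ P.lift r X := ⟨P.julia_source hz, h, Or.inl (P.julia_map hz)⟩

lemma domain_diff_rays (P : PuzzleData f U') :
    P.domain \ P.rays = P.lift P.ρ (rayConfig P.ψ (P.h P.α))ᶜ := by
  ext z
  simp only [lift, domain, rays, mem_inter_iff, mem_preimage, Set.mem_sdiff, mem_compl_iff]
  tauto

/-- Orbits which leave the complement of the rays in the domain bounded by the equipotential do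
not come back. -/
lemma mem_of_map_mem (P : PuzzleData f U') (hf : IsQuadraticLike f U' U)
    (D : IsDividing P.c P.ψ (P.h P.α)) {z : ℂ} (hz : z ∈ U') (h : f z ∈ P.domain \ P.rays) :
    z ∈ P.domain \ P.rays ∧ z ∉ P.symmRays := by
  have h1 : z ∈ U' ∩ f ⁻¹' P.lift P.ρ (rayConfig P.ψ (P.h P.α))ᶜ := ⟨hz, P.domain_diff_rays ▸ h⟩
  rw [P.preimage_lift hf] at h1
  have h2 : quad P.c (P.h z) ∉ rayConfig P.ψ (P.h P.α) := h1.2.1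
  rw [D.quad_mem_rayConfig, not_or] at h2
  refine ⟨?_, fun h => h2.2 h.2⟩
  rw [domain_diff_rays]
  exact P.lift_sqrt_subset _ ⟨h1.1, h2.1, h1.2.2⟩

namespace IsAdmissible

variable (Q : P.IsAdmissible U)
include Q

/-- The open puzzle piece of depth zero adjacent to the ray in direction `θ`. -/
def piece (θ : Circle) : Set ℂ := P.lift P.ρ (Q.dividing.sector θ)

/-- The open puzzle piece of depth one symmetric to the piece adjacent to the ray in
direction `θ`. -/
def symmPiece (θ : Circle) : Set ℂ := P.lift √P.ρ (-Q.dividing.sector θ)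

/-- The open central piece of depth one. -/
def centralPiece : Set ℂ := P.lift √P.ρ Q.dividing.central

lemma isOpen_piece (θ : Circle) : IsOpen (Q.piece θ) :=
  P.isOpen_lift P.one_lt_ρ (Q.dividing.isOpen_sector θ)

lemma isPreconnected_piece (θ : Circle) : IsPreconnected (Q.piece θ) :=
  P.isPreconnected_lift P.one_lt_ρ P.ρ_le_sq (Q.dividing.isPreconnected_sector θ)
    (Q.dividing.isRadial_sector θ)

lemma isRadial_neg_sector (θ : Circle) : IsRadial P.ψ (-Q.dividing.sector θ) := by
  intro ζ r s hr hs h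
  rw [Set.mem_neg, P.bottcher.neg_ray hr] at h
  rw [Set.mem_neg, P.bottcher.neg_ray hs]
  exact Q.dividing.isRadial_sector θ _ r s hr hs h

lemma isPreconnected_symmPiece (θ : Circle) : IsPreconnected (Q.symmPiece θ) :=
  P.isPreconnected_lift P.one_lt_sqrt P.sqrt_le_sq
    (isPreconnected_neg (Q.dividing.isPreconnected_sector θ)) (Q.isRadial_neg_sector θ)

lemma isOpen_symmPiece (θ : Circle) : IsOpen (Q.symmPiece θ) :=
  P.isOpen_lift P.one_lt_sqrt (Q.dividing.isOpen_sector θ).neg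

lemma isPreconnected_centralPiece : IsPreconnected Q.centralPiece :=
  P.isPreconnected_lift P.one_lt_sqrt P.sqrt_le_sq Q.dividing.isPreconnected_central
    Q.dividing.isRadial_central

lemma piece_subset (θ : Circle) : Q.piece θ ⊆ P.domain \ P.rays := by
  rw [P.domain_diff_rays]
  exact P.lift_mono (Q.dividing.sector_subset θ)

lemma exists_piece {z : ℂ} (hz : z ∈ P.domain \ P.rays) :
    ∃ θ ∈ landingAngles P.ψ (P.h P.α), z ∈ Q.piece θ := by
  rw [P.domain_diff_rays] at hz
  obtain ⟨θ, hθ, h⟩ := Q.dividing.exists_sector hz.2.1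
  exact ⟨θ, hθ, hz.1, h, hz.2.2⟩

lemma piece_disjoint {θ η : Circle} (hθ : θ ∈ landingAngles P.ψ (P.h P.α))
    (hη : η ∈ landingAngles P.ψ (P.h P.α)) (hne : θ ≠ η) : Disjoint (Q.piece θ) (Q.piece η) :=
  disjoint_left.2 fun _ h h' =>
    disjoint_left.1 (Q.dividing.sector_disjoint hθ hη hne) h.2.1 h'.2.1

lemma comp_eq_piece {θ : Circle} {z : ℂ} (hz : z ∈ Q.piece θ) :
    connectedComponentIn (P.domain \ P.rays) z = Q.piece θ := by
  have hzm := Q.piece_subset θ hz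
  refine subset_antisymm (fun x hx => ?_)
    ((Q.isPreconnected_piece θ).subset_connectedComponentIn hz (Q.piece_subset θ))
  have hsub := connectedComponentIn_subset (P.domain \ P.rays) z
  have h := Q.dividing.subset_sector (θ := θ)
    (C := P.h '' connectedComponentIn (P.domain \ P.rays) z) ?_ ?_
    ⟨P.h z, mem_image_of_mem _ (mem_connectedComponentIn hzm), hz.2.1⟩ (mem_image_of_mem _ hx)
  · exact ⟨(hsub hx).1.1, h, (hsub hx).1.2⟩
  · exact isPreconnected_connectedComponentIn.image _
      (P.h.continuousOn.mono fun y hy => (hsub hy).1.1)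
  · rintro _ ⟨y, hy, rfl⟩
    have := hsub hy
    rw [P.domain_diff_rays] at this
    exact this.2.1

lemma zero_mem_julia : (0 : ℂ) ∈ filledJulia f U' := (P.zero_julia Q.ql).1

lemma map_zero : P.h 0 = 0 := (P.zero_julia Q.ql).2

lemma zero_mem_piece : (0 : ℂ) ∈ Q.piece Q.dividing.crit :=
  julia_lift Q.zero_mem_julia (by rw [Q.map_zero]; exact Q.dividing.zero_mem_crit)

lemma zero_mem_centralPiece : (0 : ℂ) ∈ Q.centralPiece :=
  julia_lift Q.zero_mem_julia (by rw [Q.map_zero]; exact Q.dividing.zero_mem_central)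

lemma criticalPiece_eq : P.criticalPiece = closure (Q.piece Q.dividing.crit) := by
  rw [criticalPiece, Q.comp_eq_piece Q.zero_mem_piece]

lemma zeroPieces_eq :
    P.zeroPieces = {Y | ∃ θ ∈ landingAngles P.ψ (P.h P.α), Y = closure (Q.piece θ)} := by
  ext Y
  constructor
  · rintro ⟨z, hz, rfl⟩
    obtain ⟨θ, hθ, h⟩ := Q.exists_piece hz
    exact ⟨θ, hθ, by rw [Q.comp_eq_piece h]⟩
  · rintro ⟨θ, hθ, rfl⟩
    have hne : (Q.piece θ).Nonempty := by
      have hα : P.α ∈ closure (Q.piece θ) := P.mem_closure_lift P.one_lt_ρ P.ρ_le_sq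
        (P.julia_source P.α_mem_julia) (Or.inl (P.julia_map P.α_mem_julia))
        (Q.dividing.mem_closure_sector hθ)
      exact closure_nonempty_iff.1 ⟨_, hα⟩
    obtain ⟨z, hz⟩ := hne
    exact ⟨z, Q.piece_subset θ hz, by rw [Q.comp_eq_piece hz]⟩

lemma α_mem_closure_piece {θ : Circle} (hθ : θ ∈ landingAngles P.ψ (P.h P.α)) :
    P.α ∈ closure (Q.piece θ) :=
  P.mem_closure_lift P.one_lt_ρ P.ρ_le_sq (P.julia_source P.α_mem_julia)
    (Or.inl (P.julia_map P.α_mem_julia)) (Q.dividing.mem_closure_sector hθ)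

lemma preimage_piece {θ : Circle} (hθ : θ ∈ landingAngles P.ψ (P.h P.α))
    (hne : θ ≠ Q.dividing.crit) :
    U' ∩ f ⁻¹' Q.piece (θ ^ 2) = P.lift √P.ρ (Q.dividing.sector θ) ∪ Q.symmPiece θ := by
  rw [piece, P.preimage_lift Q.ql, Q.dividing.preimage_sector hθ hne, lift_union]
  rfl

lemma preimage_piece_crit : U' ∩ f ⁻¹' Q.piece (Q.dividing.crit ^ 2) = Q.centralPiece :=
  P.preimage_lift Q.ql _

lemma centralPiece_subset : Q.centralPiece ⊆ Q.piece Q.dividing.crit :=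
  (P.lift_sqrt_subset _).trans (P.lift_mono Q.dividing.central_subset)

lemma symmPiece_subset {θ : Circle} (hθ : θ ∈ landingAngles P.ψ (P.h P.α))
    (hne : θ ≠ Q.dividing.crit) : Q.symmPiece θ ⊆ Q.piece Q.dividing.crit :=
  (P.lift_sqrt_subset _).trans (P.lift_mono (Q.dividing.neg_sector_subset hθ hne))

lemma closure_sector_subset {θ : Circle} :
    closure (Q.dividing.sector θ) ⊆ Q.dividing.sector θ ∪ rayConfig P.ψ (P.h P.α) := by
  intro x hx
  by_cases h : x ∈ rayConfig P.ψ (P.h P.α)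
  · exact Or.inr h
  · exact Or.inl (Q.dividing.closure_sector θ ⟨hx, h⟩)

lemma closure_symmPiece {θ : Circle} {x : ℂ} (hx : x ∈ closure (Q.symmPiece θ)) :
    x ∈ P.h.source ∧ (-P.h x ∈ Q.dividing.sector θ ∨ -P.h x ∈ rayConfig P.ψ (P.h P.α)) ∧
      P.h x ∈ closedPotentialDisk P.c P.ψ √P.ρ := by
  obtain ⟨h1, h2, h3⟩ := P.closure_lift P.sqrt_le_sq hx
  refine ⟨h1, ?_, h3⟩
  rw [← neg_closure] at h2
  exact Q.closure_sector_subset h2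

/-- The source of all strict inclusions: the boundary consists of opposite rays, which are interior
to the critical sector, and of an equipotential of level `√ρ < ρ`. -/
lemma closure_symmPiece_subset {θ : Circle} (hθ : θ ∈ landingAngles P.ψ (P.h P.α))
    (hne : θ ≠ Q.dividing.crit) : closure (Q.symmPiece θ) ⊆ Q.piece Q.dividing.crit := by
  intro x hx
  obtain ⟨h1, h2, h3⟩ := Q.closure_symmPiece hx
  refine ⟨h1, ?_, closedPotentialDisk_subset P.sqrt_lt h3⟩
  rcases h2 with h | h
  · exact Q.dividing.neg_sector_subset hθ hne h
  · exact Q.dividing.neg_rayConfig_subset h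

lemma closure_symmPiece_disjoint_central {θ : Circle} (hθ : θ ∈ landingAngles P.ψ (P.h P.α))
    (hne : θ ≠ Q.dividing.crit) : Disjoint (closure (Q.symmPiece θ)) Q.centralPiece := by
  refine disjoint_left.2 fun x hx hx' => ?_
  rcases (Q.closure_symmPiece hx).2.1 with h | h
  · exact Q.dividing.central_disjoint_neg_sector hθ hne hx'.2.1 h
  · exact (Q.dividing.central_notMem hx'.2.1).2 h

/-- Boundary points of the symmetric pieces are mapped to the rays or to the equipotential. -/
lemma mem_symmPiece_of_map {θ : Circle} {x : ℂ} (hx : x ∈ closure (Q.symmPiece θ))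
    (h : f x ∈ P.domain \ P.rays) : x ∈ Q.symmPiece θ := by
  obtain ⟨h1, h2, -⟩ := Q.closure_symmPiece hx
  have hxU := P.source_subset h1
  have hm := P.mem_of_map_mem Q.ql Q.dividing hxU h
  have hd : x ∈ U' ∩ f ⁻¹' P.lift P.ρ (rayConfig P.ψ (P.h P.α))ᶜ := ⟨hxU, P.domain_diff_rays ▸ h⟩
  rw [P.preimage_lift Q.ql] at hd
  refine ⟨h1, h2.resolve_right fun h' => hm.2 ⟨h1, h'⟩, hd.2.2⟩

/-- A boundary point on an opposite ray is also a limit of another, disjoint mirror sector, and a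
point of the equipotential is not interior to the closed disk. Needed because pull-backs are formed
from interiors of closed pieces. -/
lemma interior_closure_symmPiece {θ : Circle} (hθ : θ ∈ landingAngles P.ψ (P.h P.α)) :
    interior (closure (Q.symmPiece θ)) = Q.symmPiece θ := by
  refine subset_antisymm (fun x hx => ?_) (interior_maximal subset_closure (Q.isOpen_symmPiece θ))
  obtain ⟨h1, h2, h3⟩ := Q.closure_symmPiece (interior_subset hx)
  have hopen : IsOpen (P.h '' interior (closure (Q.symmPiece θ))) :=
    P.h.isOpen_image_of_subset_source isOpen_interior
      fun y hy => (Q.closure_symmPiece (interior_subset hy)).1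
  have hxm : P.h x ∈ P.h '' interior (closure (Q.symmPiece θ)) := mem_image_of_mem _ hx
  have hint : P.h x ∈ interior (closedPotentialDisk P.c P.ψ √P.ρ) := by
    refine mem_interior.2 ⟨_, ?_, hopen, hxm⟩
    rintro _ ⟨y, hy, rfl⟩
    exact (Q.closure_symmPiece (interior_subset hy)).2.2
  refine ⟨h1, h2.resolve_right fun hR => ?_, P.bottcher.interior_closedPotentialDisk hint⟩
  obtain ⟨η, hη, hne, hcl⟩ := Q.dividing.exists_ne_mem_closure_sector hR hθ
  obtain ⟨y, ⟨z, hz, hzy⟩, hy'⟩ := mem_closure_iff.1 hcl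
    (-(P.h '' interior (closure (Q.symmPiece θ)))) hopen.neg (by simpa using hxm)
  have h4 : -P.h z ∈ closure (Q.dividing.sector θ) := by
    have := (P.closure_lift P.sqrt_le_sq (interior_subset hz)).2.1
    rwa [← neg_closure] at this
  rw [hzy, neg_neg] at h4
  obtain ⟨w, hw, hw'⟩ := mem_closure_iff.1 h4 _ (Q.dividing.isOpen_sector η) hy'
  exact disjoint_left.1 (Q.dividing.sector_disjoint hη hθ hne) hw hw'

lemma map_centralPiece {z : ℂ} (hz : z ∈ Q.centralPiece) :
    z ∈ U' ∧ f z ∈ Q.piece (Q.dividing.crit ^ 2) := by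
  rw [← Q.preimage_piece_crit] at hz
  exact hz

/-- The preimage of a closed noncritical piece of depth zero. -/
lemma preimage_closure_piece {θ : Circle} (hθ : θ ∈ landingAngles P.ψ (P.h P.α))
    (hne : θ ≠ Q.dividing.crit) :
    U' ∩ f ⁻¹' closure (Q.piece (θ ^ 2)) =
      closure (P.lift √P.ρ (Q.dividing.sector θ)) ∪ closure (Q.symmPiece θ) := by
  rw [← closure_union, ← Q.preimage_piece hθ hne]
  have hcl : closure (Q.piece (θ ^ 2)) ⊆ closure P.domain :=
    closure_mono ((Q.piece_subset _).trans sdiff_subset)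
  refine subset_antisymm (fun z hz => Q.ql.mem_closure_preimage hz.1 hz.2)
    (Q.ql.closure_preimage_subset (P.isCompact_closure_domain.of_isClosed_subset isClosed_closure hcl)
      ((hcl.trans P.closure_domain_subset).trans Q.ql.dom_subset))

omit Q in
lemma preimageIter_one (S : Set ℂ) : preimageIter f U' 1 S = U' ∩ f ⁻¹' S := by
  ext z
  simp [preimageIter]

omit Q in
lemma map_eq_of_symm {z : ℂ} (hz : z ∈ U') (hfz : f z = P.α) (hne : z ≠ P.α) :
    P.h z = -P.h P.α := by
  have hJ := mem_filledJulia_of_map hz (hfz ▸ P.α_mem_julia)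
  have h1 := P.julia_conj hJ
  rw [hfz, ← P.fixed, quad_eq_quad_iff] at h1
  rcases h1 with h | h
  · exact absurd (P.h.injOn (P.julia_source hJ) (P.julia_source P.α_mem_julia) h.symm) hne
  · rw [h, neg_neg]

/-- The noncritical pieces of depth one attached to the symmetric point. -/
lemma symmPieces_eq : P.symmPieces = {Z | ∃ θ ∈ landingAngles P.ψ (P.h P.α),
    θ ≠ Q.dividing.crit ∧ Z = closure (Q.symmPiece θ)} := by
  -- The two closed halves of the preimage are disjoint, since one lies in the open critical piece;
  -- hence each connected half is a full component.
  have key : ∀ θ ∈ landingAngles P.ψ (P.h P.α), θ ≠ Q.dividing.crit →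
      Disjoint (closure (P.lift √P.ρ (Q.dividing.sector θ))) (closure (Q.symmPiece θ)) := by
    intro θ hθ hne
    refine disjoint_left.2 fun x hx hx' => ?_
    have h1 := (P.closure_lift P.sqrt_le_sq hx).2.1
    have h2 := (Q.closure_symmPiece_subset hθ hne hx').2.1
    rcases Q.closure_sector_subset h1 with h | h
    · exact disjoint_left.1 (Q.dividing.sector_disjoint hθ Q.dividing.crit_mem hne) h h2
    · exact Q.dividing.sector_subset _ h2 h
  have hcomp : ∀ θ ∈ landingAngles P.ψ (P.h P.α), θ ≠ Q.dividing.crit → ∀ z,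
      z ∈ closure (Q.symmPiece θ) → connectedComponentIn
        (preimageIter f U' 1 (closure (Q.piece (θ ^ 2)))) z = closure (Q.symmPiece θ) := by
    intro θ hθ hne z hz
    rw [preimageIter_one, Q.preimage_closure_piece hθ hne]
    refine subset_antisymm ?_ ((Q.isPreconnected_symmPiece θ).closure.subset_connectedComponentIn
      hz subset_union_right)
    intro x hx
    by_contra hx2
    obtain ⟨y, -, hy1, hy2⟩ := isPreconnected_closed_iff.1 isPreconnected_connectedComponentIn _ _
      isClosed_closure isClosed_closure (connectedComponentIn_subset _ _)
      ⟨x, hx, (connectedComponentIn_subset _ _ hx).resolve_right hx2⟩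
      ⟨z, mem_connectedComponentIn (Or.inr hz), hz⟩
    exact disjoint_left.1 (key θ hθ hne) hy1 hy2
  ext Z
  constructor
  · rintro ⟨⟨Y, hY, z, hz, rfl⟩, h0, α', hα', hfα, hαne, hmem⟩
    rw [Q.zeroPieces_eq] at hY
    obtain ⟨η, hη, rfl⟩ := hY
    obtain ⟨θ, hθ, rfl⟩ := Q.dividing.sq_surj hη
    have hz' := hz
    rw [preimageIter_one] at hz'
    by_cases hne : θ = Q.dividing.crit
    -- For the critical ray the whole closed preimage is connected and contains `0`, so it is not
    -- among the symmetric pieces.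
    · exfalso
      subst hne
      apply h0
      have hpre : IsPreconnected (U' ∩ f ⁻¹' closure (Q.piece (Q.dividing.crit ^ 2))) := by
        refine Q.isPreconnected_centralPiece.subset_closure ?_ fun x hx => ?_
        · rw [← Q.preimage_piece_crit]
          exact inter_subset_inter_right _ (preimage_mono subset_closure)
        · rw [← Q.preimage_piece_crit]
          exact Q.ql.mem_closure_preimage hx.1 hx.2
      rw [preimageIter_one]
      refine hpre.subset_connectedComponentIn hz' subset_rfl ?_
      have h1 := Q.map_centralPiece Q.zero_mem_centralPiece
      exact ⟨h1.1, subset_closure h1.2⟩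
    · refine ⟨θ, hθ, hne, ?_⟩
      rw [connectedComponentIn_eq hmem]
      refine hcomp θ hθ hne α' ?_
      have h1 := connectedComponentIn_subset _ _ hmem
      rw [preimageIter_one, Q.preimage_closure_piece hθ hne] at h1
      refine h1.resolve_left fun h => ?_
      have h2 := (P.closure_lift P.sqrt_le_sq h).2.1
      rw [map_eq_of_symm hα' hfα hαne] at h2
      have hmα : -P.h P.α ∈ Q.dividing.sector Q.dividing.crit :=
        Q.dividing.neg_rayConfig_subset (neg_mem_neg.2 (mem_insert _ _))
      rcases Q.closure_sector_subset h2 with h | h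
      · exact disjoint_left.1 (Q.dividing.sector_disjoint hθ Q.dividing.crit_mem hne) h hmα
      · exact Q.dividing.sector_subset _ hmα h
  · rintro ⟨θ, hθ, hne, rfl⟩
    have hK : -P.h P.α ∈ quadFilledJulia P.c :=
      neg_mem_quadFilledJulia.2 (P.julia_map P.α_mem_julia)
    obtain ⟨α', hα'J, hα'⟩ : ∃ z ∈ filledJulia f U', P.h z = -P.h P.α := by
      rwa [← P.conj.image_filledJulia] at hK
    have hcl : α' ∈ closure (Q.symmPiece θ) := by
      refine P.mem_closure_lift P.one_lt_sqrt P.sqrt_le_sq (P.julia_source hα'J)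
        (Or.inl (P.julia_map hα'J)) ?_
      rw [hα', ← neg_closure]
      exact neg_mem_neg.2 (Q.dividing.mem_closure_sector hθ)
    refine ⟨⟨closure (Q.piece (θ ^ 2)), ?_, α', ?_, (hcomp θ hθ hne α' hcl).symm⟩, ?_, α',
      filledJulia_subset hα'J, ?_, ?_, hcl⟩
    · rw [Q.zeroPieces_eq]
      exact ⟨_, Q.dividing.sq_mem hθ, rfl⟩
    · rw [preimageIter_one, Q.preimage_closure_piece hθ hne]
      exact Or.inr hcl
    · intro h
      exact disjoint_left.1 (Q.closure_symmPiece_disjoint_central hθ hne) h Q.zero_mem_centralPiece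
    · refine P.h.injOn (P.julia_source (map_mem_filledJulia hα'J))
        (P.julia_source P.α_mem_julia) ?_
      rw [P.julia_conj hα'J, hα', quad_neg, P.fixed]
    · rintro rfl
      exact Q.dividing.ne_zero (self_eq_neg.1 hα')

end IsAdmissible
end PuzzleData
end Yoccoz

namespace Yoccoz

/-! ### Pull-backs -/

/-- A connected open set, relatively compact in `U'`, which is the interior of its closure. -/
structure IsRegularPiece (U' O : Set ℂ) : Prop where
  isOpen : IsOpen O
  isPreconnected : IsPreconnected O
  isCompact : IsCompact (closure O)
  closure_subset : closure O ⊆ U'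
  interior_closure : interior (closure O) = O

/-- The open version of `pullback`. -/
def openPullback (f : ℂ → ℂ) (U' : Set ℂ) (O : Set ℂ) : ℕ → ℂ → Set ℂ
  | 0, _ => O
  | l + 1, z => connectedComponentIn (U' ∩ f ⁻¹' openPullback f U' O l (f z)) z

/-- Orbits of boundary points of `O` never return to the closure of `O`. -/
def IsNice (f : ℂ → ℂ) (U' O : Set ℂ) : Prop :=
  ∀ x ∈ closure O, x ∉ O → ∀ i : ℕ, 0 < i → (∀ j < i, f^[j] x ∈ U') → f^[i] x ∉ closure O

section
variable {f : ℂ → ℂ} {U' U O : Set ℂ} (hf : IsQuadraticLike f U' U)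
include hf

/-- `f` is open, so the interior of the closure of the component is mapped into the interior of the
closure of `O`, which is `O`; and the component is relatively closed in the preimage of `O`. -/
lemma IsRegularPiece.comp (hO : IsRegularPiece U' O) (z : ℂ) :
    IsRegularPiece U' (connectedComponentIn (U' ∩ f ⁻¹' O) z) ∧
      closure (connectedComponentIn (U' ∩ f ⁻¹' O) z) ⊆ U' ∩ f ⁻¹' closure O := by
  set C := connectedComponentIn (U' ∩ f ⁻¹' O) z with hC
  have hsub : C ⊆ U' ∩ f ⁻¹' O := connectedComponentIn_subset _ _
  have hOU : closure O ⊆ U := hO.closure_subset.trans hf.dom_subset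
  have hcl : closure C ⊆ U' ∩ f ⁻¹' closure O :=
    (closure_mono hsub).trans (hf.closure_preimage_subset hO.isCompact hOU)
  have hCo : IsOpen C := (hf.isOpen_preimage hO.isOpen).connectedComponentIn
  refine ⟨⟨hCo, isPreconnected_connectedComponentIn,
    (hf.proper _ hOU hO.isCompact).of_isClosed_subset isClosed_closure hcl,
    hcl.trans inter_subset_left, ?_⟩, hcl⟩
  refine subset_antisymm (fun x hx => ?_) (interior_maximal subset_closure hCo)
  have hx' := interior_subset hx
  refine closure_comp_inter_subset ⟨hx', (hcl hx').1, ?_⟩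
  have : f '' interior (closure C) ⊆ interior (closure O) := by
    refine interior_maximal ?_ (hf.isOpen_image isOpen_interior
      (interior_subset.trans (hcl.trans inter_subset_left)))
    rintro _ ⟨y, hy, rfl⟩
    exact (hcl (interior_subset hy)).2
  rw [hO.interior_closure] at this
  exact this (mem_image_of_mem _ hx)

/-- Because regularity is inherited, taking a closure and then an interior at each step changes
nothing. -/
lemma pullback_eq (hO : IsRegularPiece U' O) {l : ℕ} {z : ℂ} (hz : ∀ k < l, f^[k] z ∈ U')
    (hl : f^[l] z ∈ O) : pullback f U' (closure O) l z = closure (openPullback f U' O l z) ∧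
      IsRegularPiece U' (openPullback f U' O l z) ∧ z ∈ openPullback f U' O l z := by
  induction l generalizing z with
  | zero => exact ⟨rfl, hO, hl⟩
  | succ l ih =>
    obtain ⟨h1, h2, h3⟩ := ih (z := f z)
      (fun k hk => by rw [← Function.iterate_succ_apply]; exact hz _ (by omega))
      (by rwa [← Function.iterate_succ_apply])
    refine ⟨?_, (h2.comp hf z).1, mem_connectedComponentIn ⟨hz 0 (by omega), h3⟩⟩
    rw [pullback, h1, h2.interior_closure]
    rfl

lemma iterate_mem_closure_openPullback (hO : IsRegularPiece U' O) {l : ℕ} {z : ℂ}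
    (hz : ∀ k < l, f^[k] z ∈ U') (hl : f^[l] z ∈ O) {x : ℂ}
    (hx : x ∈ closure (openPullback f U' O l z)) {k : ℕ} (hk : k ≤ l) :
    f^[k] x ∈ closure (openPullback f U' O (l - k) (f^[k] z)) := by
  induction k with
  | zero => exact hx
  | succ k ih =>
    have h1 := ih (by omega)
    obtain ⟨m, hm⟩ : ∃ m, l - k = m + 1 := ⟨l - k - 1, by omega⟩
    rw [hm] at h1
    have h2 := (pullback_eq hf hO (l := m) (z := f^[k + 1] z)
      (fun j hj => by rw [← Function.iterate_add_apply]; exact hz _ (by omega))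
      (by rw [← Function.iterate_add_apply, show m + (k + 1) = l by omega]; exact hl)).2.1
    have h3 := ((h2.comp hf (f^[k] z)).2)
    rw [show l - (k + 1) = m by omega, Function.iterate_succ_apply' f k x]
    rw [Function.iterate_succ_apply'] at h3 ⊢
    exact (h3 h1).2

lemma iterate_mem_dom_of_closure (hO : IsRegularPiece U' O) {l : ℕ} {z : ℂ}
    (hz : ∀ k < l, f^[k] z ∈ U') (hl : f^[l] z ∈ O) {x : ℂ}
    (hx : x ∈ closure (openPullback f U' O l z)) {k : ℕ} (hk : k ≤ l) : f^[k] x ∈ U' := by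
  refine (pullback_eq hf hO (l := l - k) (z := f^[k] z) ?_ ?_).2.1.closure_subset
    (iterate_mem_closure_openPullback hf hO hz hl hx hk)
  · intro j hj
    rw [← Function.iterate_add_apply]
    exact hz _ (by omega)
  · rw [← Function.iterate_add_apply, Nat.sub_add_cancel hk]
    exact hl

omit hf in
lemma iterate_mem_of_openPullback {l : ℕ} {z x : ℂ} (hx : x ∈ openPullback f U' O l z) :
    f^[l] x ∈ O := by
  induction l generalizing z x with
  | zero => exact hx
  | succ l ih =>
    rw [Function.iterate_succ_apply]
    exact ih (connectedComponentIn_subset _ _ hx).2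

/-- Contrapositively, the iterate sends boundary points of the pull-back to boundary points of `O`.
-/
lemma mem_openPullback_of_iterate (hO : IsRegularPiece U' O) {l : ℕ} {z : ℂ}
    (hz : ∀ k < l, f^[k] z ∈ U') (hl : f^[l] z ∈ O) {x : ℂ}
    (hx : x ∈ closure (openPullback f U' O l z)) (h : f^[l] x ∈ O) :
    x ∈ openPullback f U' O l z := by
  induction l generalizing z x with
  | zero => exact h
  | succ l ih =>
    have h1 := iterate_mem_closure_openPullback hf hO hz hl hx (k := 1) (by omega)
    have h2 : f x ∈ openPullback f U' O l (f z) := ih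
      (fun k hk => by rw [← Function.iterate_succ_apply]; exact hz _ (by omega))
      (by rwa [← Function.iterate_succ_apply]) h1 (by rwa [← Function.iterate_succ_apply])
    exact closure_comp_inter_subset
      ⟨hx, iterate_mem_dom_of_closure hf hO hz hl hx (k := 0) (by omega), h2⟩

lemma continuousOn_iterate {S : Set ℂ} {k : ℕ} (h : ∀ j < k, ∀ x ∈ S, f^[j] x ∈ U') :
    ContinuousOn f^[k] S := by
  induction k with
  | zero => exact continuousOn_id
  | succ k ih =>
    rw [Function.iterate_succ']
    exact hf.holo.continuousOn.comp (ih fun j hj => h j (by omega)) (fun x hx => h k (by omega) x hx)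

/-- The pull-back of a nice piece along the first return of the critical point is nice and
compactly contained in the piece. -/
theorem IsNice.firstReturn (hO : IsRegularPiece U' O) (hN : IsNice f U' O) (h0 : (0 : ℂ) ∈ O)
    (hJ : (0 : ℂ) ∈ filledJulia f U') {l : ℕ}
    (hl : IsLeast {k : ℕ | 0 < k ∧ f^[k] 0 ∈ O} l) :
    closure (openPullback f U' O l 0) ⊆ O ∧ IsNice f U' (openPullback f U' O l 0) := by
  obtain ⟨⟨hl0, hlO⟩, hmin⟩ := hl
  have hz : ∀ k < l, f^[k] 0 ∈ U' := fun k _ => hJ k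
  obtain ⟨-, hreg, h0'⟩ := pullback_eq hf hO hz hlO
  set O' := openPullback f U' O l 0 with hO'
  have hdom : ∀ x ∈ closure O', ∀ k ≤ l, f^[k] x ∈ U' := fun x hx k hk =>
    iterate_mem_dom_of_closure hf hO hz hlO hx hk
  have hend : ∀ x ∈ closure O', f^[l] x ∈ closure O := fun x hx => by
    have := iterate_mem_closure_openPullback hf hO hz hlO hx le_rfl
    rwa [Nat.sub_self] at this
  -- `O'` is connected and meets `O` at `0`. If it left `O`, it would contain a boundary point of
  -- `O`, which `f^[l]` brings back into `O`.
  have hsub : O' ⊆ O := by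
    refine hreg.isPreconnected.subset_of_closure_inter_subset hO.isOpen ⟨0, h0', h0⟩ ?_
    rintro x ⟨hx, hxO'⟩
    by_contra hxO
    exact hN x hx hxO l hl0 (fun j hj => hdom x (subset_closure hxO') j hj.le)
      (subset_closure (iterate_mem_of_openPullback hxO'))
  have hcl : closure O' ⊆ O := by
    intro x hx
    by_contra hxO
    exact hN x (closure_mono hsub hx) hxO l hl0 (fun j hj => hdom x hx j hj.le) (hend x hx)
  refine ⟨hcl, fun x hx hxO' i hi hxU hix => ?_⟩
  have hixO : f^[i] x ∈ O := hcl hix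
  rcases lt_trichotomy i l with h | h | h
  · -- the image of `O'` would meet the boundary of `O`
    have hcont : ContinuousOn f^[i] (closure O') :=
      continuousOn_iterate hf fun j hj x hx => hdom x hx j (by omega)
    have hpre : IsPreconnected (f^[i] '' O') :=
      hreg.isPreconnected.image _ (hcont.mono subset_closure)
    have hmeet : (f^[i] '' O' ∩ O).Nonempty := by
      have h1 : f^[i] x ∈ closure (f^[i] '' O') := by
        have : ContinuousWithinAt f^[i] O' x := (hcont x hx).mono subset_closure
        exact this.mem_closure_image hx
      obtain ⟨y, hy1, hy2⟩ := mem_closure_iff.1 h1 O hO.isOpen hixO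
      exact ⟨y, hy2, hy1⟩
    have hnot : ¬ f^[i] '' O' ⊆ O := fun hs =>
      absurd (hmin ⟨hi, hs (mem_image_of_mem _ h0')⟩) (by omega)
    apply hnot
    refine hpre.subset_of_closure_inter_subset hO.isOpen hmeet ?_
    rintro _ ⟨hy, y, hyO', rfl⟩
    by_contra hyO
    refine hN _ hy hyO (l - i) (by omega) (fun j hj => ?_) ?_
    · rw [← Function.iterate_add_apply]
      exact hdom y (subset_closure hyO') _ (by omega)
    · rw [← Function.iterate_add_apply, Nat.sub_add_cancel h.le]
      exact subset_closure (iterate_mem_of_openPullback hyO')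
  · subst h
    exact hxO' (mem_openPullback_of_iterate hf hO hz hlO hx hixO)
  -- After time `l` the orbit starts from a boundary point of `O`, and niceness of `O` applies with
  -- the remaining time `i - l`.
  · refine hN (f^[l] x) (hend x hx)
      (fun hxl => hxO' (mem_openPullback_of_iterate hf hO hz hlO hx hxl)) (i - l) (by omega)
      (fun j hj => ?_) ?_
    · rw [← Function.iterate_add_apply]
      exact hxU _ (by omega)
    · rw [← Function.iterate_add_apply, Nat.sub_add_cancel h.le]
      exact subset_closure hixO

end

end Yoccoz

namespace Yoccoz
namespace PuzzleData.IsAdmissible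

/-! ### The critical orbit and the first piece of the nest -/

variable {f : ℂ → ℂ} {U' U : Set ℂ} {P : PuzzleData f U'} (Q : P.IsAdmissible U)
include Q

/-- All rays form one cycle, so a return of the critical direction would be a common period smaller
than the least one. -/
lemma crit_pow_ne {j : ℕ} (h0 : 0 < j) (hj : j < P.period) :
    Q.dividing.crit ^ 2 ^ j ≠ Q.dividing.crit := fun h =>
  absurd (Nat.sInf_le (s := {p : ℕ | 0 < p ∧ ∀ ζ ∈ landingAngles P.ψ (P.h P.α), ζ ^ 2 ^ p = ζ})
    ⟨h0, fun _ hζ => Q.dividing.pow_eq_self_of_crit h hζ⟩) (not_le.2 hj)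

lemma crit_pow_mem (j : ℕ) : Q.dividing.crit ^ 2 ^ j ∈ landingAngles P.ψ (P.h P.α) :=
  Q.dividing.pow_mem Q.dividing.crit_mem j

lemma crit_pow_mul_add (k i : ℕ) :
    Q.dividing.crit ^ 2 ^ (k * P.period + i) = Q.dividing.crit ^ 2 ^ i := by
  induction k with
  | zero => simp
  | succ k ih =>
    rw [show (k + 1) * P.period + i = (k * P.period + i) + P.period by ring, pow_add, pow_mul,
      Q.period_spec _ (Q.crit_pow_mem _), ih]

lemma crit_pow_eq_iff {n : ℕ} : Q.dividing.crit ^ 2 ^ n = Q.dividing.crit ↔ P.period ∣ n := by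
  rw [← Nat.div_add_mod n P.period, mul_comm, Q.crit_pow_mul_add]
  rcases Nat.eq_zero_or_pos (n % P.period) with h | h
  · rw [h]
    simp
  · refine ⟨fun he => absurd he (Q.crit_pow_ne h (Nat.mod_lt _ Q.period_pos)), fun hd => ?_⟩
    exfalso
    have h1 : P.period ∣ n % P.period := (Nat.dvd_add_right (Dvd.intro_left _ rfl)).1 hd
    exact absurd (Nat.le_of_dvd h h1) (not_le.2 (Nat.mod_lt _ Q.period_pos))

/-- The `j`-th image of the critical piece. -/
def cell (j : ℕ) : Set ℂ := Q.piece (Q.dividing.crit ^ 2 ^ j)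

lemma cell_subset (j : ℕ) : Q.cell j ⊆ P.domain \ P.rays := Q.piece_subset _

lemma cell_of_dvd {j : ℕ} (h : P.period ∣ j) : Q.cell j = Q.piece Q.dividing.crit := by
  rw [cell, Q.crit_pow_eq_iff.2 h]

lemma cell_succ_of_dvd {j : ℕ} (h : P.period ∣ j) :
    Q.cell (j + 1) = Q.piece (Q.dividing.crit ^ 2) := by
  rw [cell, pow_succ, pow_mul, Q.crit_pow_eq_iff.2 h]

lemma cell_mul_add (k i : ℕ) : Q.cell (k * P.period + i) = Q.cell i := by
  rw [cell, cell, Q.crit_pow_mul_add]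

lemma cell_disjoint {j : ℕ} (h : ¬ P.period ∣ j) :
    Disjoint (Q.cell j) (Q.piece Q.dividing.crit) :=
  Q.piece_disjoint (Q.crit_pow_mem j) Q.dividing.crit_mem fun he => h (Q.crit_pow_eq_iff.1 he)

lemma preimage_cell_succ {j : ℕ} (h : ¬ P.period ∣ j) :
    U' ∩ f ⁻¹' Q.cell (j + 1) =
      P.lift √P.ρ (Q.dividing.sector (Q.dividing.crit ^ 2 ^ j)) ∪
        Q.symmPiece (Q.dividing.crit ^ 2 ^ j) := by
  rw [cell, pow_succ, pow_mul]
  exact Q.preimage_piece (Q.crit_pow_mem j) fun he => h (Q.crit_pow_eq_iff.1 he)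

lemma map_cell {j : ℕ} (h : ¬ P.period ∣ j) {z : ℂ} (hz : z ∈ Q.cell j) (hfz : f z ∈ P.domain) :
    f z ∈ Q.cell (j + 1) := by
  have hz' := Q.cell_subset j hz
  refine ⟨hfz.1, ?_, hfz.2⟩
  rw [(P.conj_domain Q.ql hz'.1).2, pow_succ, pow_mul]
  exact Q.dividing.quad_sector_subset (Q.crit_pow_mem j)
    (fun he => h (Q.crit_pow_eq_iff.1 he)) hz.2.1

lemma orbit_julia (n : ℕ) : f^[n] 0 ∈ filledJulia f U' :=
  iterate_mem_filledJulia Q.zero_mem_julia n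

lemma orbit_mem (n : ℕ) : f^[n] 0 ∈ P.domain \ P.rays := by
  have hJ := Q.orbit_julia n
  refine ⟨P.julia_domain hJ, fun h => Q.land n ?_⟩
  exact P.h.injOn (P.julia_source hJ) (P.julia_source P.α_mem_julia)
    ((Q.dividing.julia_mem (P.julia_map hJ)).1 h.2)

/-- The next point of the critical orbit is off the rays at `α`, so this one is off the opposite
rays and the splitting of the critical sector applies. -/
lemma orbit_cases {n : ℕ} (h : f^[n] 0 ∈ Q.piece Q.dividing.crit) : f^[n] 0 ∈ Q.centralPiece ∨
    ∃ θ ∈ landingAngles P.ψ (P.h P.α), θ ≠ Q.dividing.crit ∧ f^[n] 0 ∈ Q.symmPiece θ := by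
  have hJ := Q.orbit_julia n
  have hn := Q.orbit_mem (n + 1)
  rw [Function.iterate_succ_apply'] at hn
  have hs := (P.mem_of_map_mem Q.ql Q.dividing (filledJulia_subset hJ) hn).2
  rcases Q.dividing.crit_cases h.2.1 (fun hR => hs ⟨P.julia_source hJ, hR⟩) with h1 | ⟨θ, hθ, hne, h1⟩
  · exact Or.inl (julia_lift hJ h1)
  · exact Or.inr ⟨θ, hθ, hne, julia_lift hJ h1⟩

lemma orbit_cell {n : ℕ} (h : f^[n] 0 ∈ Q.centralPiece) {j : ℕ} (hj0 : 0 < j)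
    (hj : j ≤ P.period) : f^[n + j] 0 ∈ Q.cell j := by
  induction j, hj0 using Nat.le_induction with
  | base =>
    rw [Function.iterate_succ_apply']
    have := (Q.map_centralPiece h).2
    rw [Q.cell_succ_of_dvd (dvd_zero _)]
    exact this
  | succ j hj1 ih =>
    have h1 := ih (by omega)
    have h2 := (Q.orbit_mem (n + (j + 1))).1
    rw [← add_assoc, Function.iterate_succ_apply'] at h2 ⊢
    exact Q.map_cell (fun hd => absurd (Nat.le_of_dvd hj1 hd) (by omega)) h1 h2

/-- From the central piece the orbit travels once through the cycle of sectors and is back in the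
critical piece after `p` steps; until time `t` it must hit the central part there, not a mirror
piece. -/
lemma orbit_central {t : ℕ} (ht : ∀ s, 0 < s → s < t → ¬ ∃ Z ∈ P.symmPieces,
    f^[s * P.period] 0 ∈ Z) {k : ℕ} (hk : k < t) : f^[k * P.period] 0 ∈ Q.centralPiece := by
  induction k with
  | zero => simpa using Q.zero_mem_centralPiece
  | succ k ih =>
    have h1 := Q.orbit_cell (ih (by omega)) Q.period_pos le_rfl
    rw [Q.cell_of_dvd dvd_rfl, show k * P.period + P.period = (k + 1) * P.period by ring] at h1
    refine (Q.orbit_cases h1).resolve_right ?_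
    rintro ⟨θ, hθ, hne, h2⟩
    refine ht (k + 1) (by omega) hk ⟨closure (Q.symmPiece θ), ?_, subset_closure h2⟩
    rw [Q.symmPieces_eq]
    exact ⟨θ, hθ, hne, rfl⟩

lemma isRegularPiece_symmPiece {θ : Circle} (hθ : θ ∈ landingAngles P.ψ (P.h P.α)) :
    IsRegularPiece U' (Q.symmPiece θ) where
  isOpen := Q.isOpen_symmPiece θ
  isPreconnected := Q.isPreconnected_symmPiece θ
  isCompact := (P.closure_lift_level P.sqrt_le_sq _).1
  closure_subset := ((P.closure_lift_level P.sqrt_le_sq _).2.trans inter_subset_left).trans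
    P.source_subset
  interior_closure := Q.interior_closure_symmPiece hθ

section base

variable {t : ℕ} (ht0 : 0 < t) (ht : ∀ s, 0 < s → s < t → ¬ ∃ Z ∈ P.symmPieces,
    f^[s * P.period] 0 ∈ Z) {θ : Circle} (hθ : θ ∈ landingAngles P.ψ (P.h P.α))
    (hne : θ ≠ Q.dividing.crit) (hmem : f^[t * P.period] 0 ∈ Q.symmPiece θ)
include ht0 ht hθ hne hmem

omit ht0 in
/-- The location of the pieces along the orbit leading to the first piece of the nest. -/
lemma closure_openPullback_subset {m : ℕ} (hm : m ≤ t * P.period) :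
    closure (openPullback f U' (Q.symmPiece θ) m (f^[t * P.period - m] 0)) ⊆
        Q.cell (t * P.period - m) ∧
      (0 < m → P.period ∣ t * P.period - m →
        closure (openPullback f U' (Q.symmPiece θ) m (f^[t * P.period - m] 0)) ⊆
          Q.centralPiece) := by
  have hreg := Q.isRegularPiece_symmPiece hθ
  induction m with
  | zero =>
    refine ⟨?_, fun h => absurd h (lt_irrefl _)⟩
    rw [Nat.sub_zero, Q.cell_of_dvd (Dvd.intro_left _ rfl)]
    exact Q.closure_symmPiece_subset hθ hne
  | succ m ih =>
    have ih1 := (ih (by omega)).1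
    set n := t * P.period - (m + 1) with hn
    have hn1 : t * P.period - m = n + 1 := by omega
    rw [hn1, Function.iterate_succ_apply'] at ih1
    have hend : ∀ l w, f^[l] w = f^[t * P.period] 0 → f^[l] w ∈ Q.symmPiece θ :=
      fun l w h => h ▸ hmem
    have hp := pullback_eq Q.ql hreg (l := m + 1) (z := f^[n] 0)
      (fun k _ => by rw [← Function.iterate_add_apply]; exact filledJulia_subset (Q.orbit_julia _))
      (hend _ _ (by rw [← Function.iterate_add_apply]; congr 2; omega))
    have hp' := pullback_eq Q.ql hreg (l := m) (z := f (f^[n] 0))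
      (fun k _ => by
        rw [← Function.iterate_succ_apply' f n, ← Function.iterate_add_apply]
        exact filledJulia_subset (Q.orbit_julia _))
      (hend _ _ (by
        rw [← Function.iterate_succ_apply' f n, ← Function.iterate_add_apply]; congr 2; omega))
    have hcl : closure (openPullback f U' (Q.symmPiece θ) (m + 1) (f^[n] 0)) ⊆
        U' ∩ f ⁻¹' Q.cell (n + 1) := fun x hx =>
      ⟨((hp'.2.1.comp Q.ql (f^[n] 0)).2 hx).1, ih1 ((hp'.2.1.comp Q.ql (f^[n] 0)).2 hx).2⟩
    by_cases hd : P.period ∣ n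
    · have hc : closure (openPullback f U' (Q.symmPiece θ) (m + 1) (f^[n] 0)) ⊆
          Q.centralPiece := by
        rw [Q.cell_succ_of_dvd hd, Q.preimage_piece_crit] at hcl
        exact hcl
      refine ⟨?_, fun _ _ => hc⟩
      rw [Q.cell_of_dvd hd]
      exact hc.trans Q.centralPiece_subset
    · refine ⟨?_, fun _ h => absurd h hd⟩
      rw [Q.preimage_cell_succ hd] at hcl
      -- The last multiple of `p` below `n` is smaller than `t * p`, so the orbit was in the central
      -- piece at that time.
      have hcell : f^[n] 0 ∈ Q.cell n := by
        have hmod : 0 < n % P.period :=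
          Nat.pos_of_ne_zero fun h => hd (Nat.dvd_of_mod_eq_zero h)
        have hdm := Nat.div_add_mod' n P.period
        have h1 : n / P.period < t := Nat.div_lt_of_lt_mul (by rw [mul_comm]; omega)
        have h2 := Q.orbit_cell (Q.orbit_central ht h1) hmod (Nat.mod_lt _ Q.period_pos).le
        rw [hdm] at h2
        rwa [← Q.cell_mul_add (n / P.period), hdm] at h2
      have hdisj : Disjoint (P.lift √P.ρ (Q.dividing.sector (Q.dividing.crit ^ 2 ^ n)))
          (Q.symmPiece (Q.dividing.crit ^ 2 ^ n)) := by
        refine disjoint_left.2 fun x hx hx' => ?_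
        exact disjoint_left.1 (Q.cell_disjoint hd) (P.lift_sqrt_subset _ hx)
          (Q.symmPiece_subset (Q.crit_pow_mem n) (fun he => hd (Q.crit_pow_eq_iff.1 he)) hx')
      have hx0 : f^[n] 0 ∈ closure (openPullback f U' (Q.symmPiece θ) (m + 1) (f^[n] 0)) :=
        subset_closure hp.2.2
      -- The preimage of the next cell splits into the part in cell `n` and a mirror part in the
      -- critical piece; the connected pull-back follows the orbit point, which is in cell `n`.
      have hsub := hp.2.1.isPreconnected.closure.subset_left_of_subset_union
        (P.isOpen_lift P.one_lt_sqrt (Q.dividing.isOpen_sector _)) (Q.isOpen_symmPiece _) hdisj hcl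
        ⟨f^[n] 0, hx0, (hcl hx0).resolve_right fun h => disjoint_left.1 (Q.cell_disjoint hd) hcell
          (Q.symmPiece_subset (Q.crit_pow_mem n) (fun he => hd (Q.crit_pow_eq_iff.1 he)) h)⟩
      exact hsub.trans (P.lift_sqrt_subset _)

lemma closure_initial_subset :
    closure (openPullback f U' (Q.symmPiece θ) (t * P.period) 0) ⊆ Q.centralPiece := by
  have h := (Q.closure_openPullback_subset ht hθ hne hmem le_rfl).2
    (Nat.mul_pos ht0 Q.period_pos)
  simp only [Nat.sub_self, Function.iterate_zero, id_eq, dvd_zero, forall_const] at h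
  exact h

/-- The first piece of the nest is nice. -/
lemma isNice_initial : IsNice f U' (openPullback f U' (Q.symmPiece θ) (t * P.period) 0) := by
  intro x hx hxO i hi hxU hix
  have hreg := Q.isRegularPiece_symmPiece hθ
  have hz : ∀ k < t * P.period, f^[k] 0 ∈ U' := fun k _ => filledJulia_subset (Q.orbit_julia k)
  have hchain : ∀ y ∈ closure (openPullback f U' (Q.symmPiece θ) (t * P.period) 0), ∀ k,
      k ≤ t * P.period → f^[k] y ∈ closure (openPullback f U' (Q.symmPiece θ)
        (t * P.period - k) (f^[t * P.period - (t * P.period - k)] 0)) := by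
    intro y hy k hk
    rw [Nat.sub_sub_self hk]
    exact iterate_mem_closure_openPullback Q.ql hreg hz hmem hy hk
  have hyc := Q.closure_initial_subset ht0 ht hθ hne hmem hix
  have htp : ∀ y ∈ closure (openPullback f U' (Q.symmPiece θ) (t * P.period) 0),
      f^[t * P.period] y ∈ closure (Q.symmPiece θ) := by
    intro y hy
    have := hchain y hy _ le_rfl
    rwa [Nat.sub_self] at this
  -- Up to time `t * p` a return can only occur at a multiple of `p`, as the other cells miss the
  -- critical piece. At such a time, `f^[i] x` in the closure of `V⁰` would put `f^[t * p] x` in the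
  -- central piece, yet it lies in the closed mirror piece.
  rcases le_or_gt i (t * P.period) with h | h
  · by_cases hd : P.period ∣ i
    · have hdn : P.period ∣ t * P.period - i := Nat.dvd_sub (Dvd.intro_left _ rfl) hd
      have h1 := (Q.closure_openPullback_subset ht hθ hne hmem (m := i) h).2 hi hdn
      have h2 := hchain _ hix (t * P.period - i) (by omega)
      rw [Nat.sub_sub_self h] at h2
      have h3 := h1 h2
      rw [← Function.iterate_add_apply, Nat.sub_add_cancel h] at h3
      exact disjoint_left.1 (Q.closure_symmPiece_disjoint_central hθ hne) (htp x hx) h3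
    · have h1 := (Q.closure_openPullback_subset ht hθ hne hmem
        (m := t * P.period - i) (by omega)).1 (hchain x hx i h)
      rw [Nat.sub_sub_self h] at h1
      exact disjoint_left.1 (Q.cell_disjoint hd) h1 (Q.centralPiece_subset hyc)
  -- For a later return, all earlier points are off the rays and inside `E`. Looking back to time `t
  -- * p + 1` shows that `f^[t * p] x` is interior to the mirror piece, so `x` was not a boundary
  -- point.
  · have hback : ∀ j ≤ i, f^[i - j] x ∈ P.domain \ P.rays := by
      intro j hj
      induction j with
      | zero => exact Q.piece_subset _ (Q.centralPiece_subset hyc)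
      | succ j ih =>
        have h1 := ih (by omega)
        rw [show i - j = (i - (j + 1)) + 1 by omega, Function.iterate_succ_apply'] at h1
        exact (P.mem_of_map_mem Q.ql Q.dividing (hxU _ (by omega)) h1).1
    have h1 := hback (i - (t * P.period + 1)) (by omega)
    rw [Nat.sub_sub_self (by omega), Function.iterate_succ_apply'] at h1
    exact hxO (mem_openPullback_of_iterate Q.ql hreg hz hmem hx
      (Q.mem_symmPiece_of_map (htp x hx) h1))

end base

/-! ### Immediate renormalizability -/

lemma centralPiece_subset_range : Q.centralPiece ⊆ P.renormRange := by
  refine Q.isPreconnected_centralPiece.subset_connectedComponentIn Q.zero_mem_centralPiece ?_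
  intro z hz
  have h := Q.piece_subset _ (Q.centralPiece_subset hz)
  refine ⟨h.1, ?_⟩
  rintro (h' | h')
  · exact h.2 h'
  · exact (Q.dividing.central_notMem hz.2.1).2 h'.2

lemma renormRange_subset : P.renormRange ⊆ Q.piece Q.dividing.crit := by
  rw [← Q.comp_eq_piece Q.zero_mem_piece]
  exact connectedComponentIn_mono _ (sdiff_subset_sdiff_right subset_union_left)

lemma isOpen_renormRange : IsOpen P.renormRange := by
  have h : P.domain \ (P.rays ∪ P.symmRays) =
      P.lift P.ρ ((rayConfig P.ψ (P.h P.α))ᶜ ∩ (-rayConfig P.ψ (P.h P.α))ᶜ) := by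
    ext z
    simp only [lift, domain, rays, symmRays, mem_inter_iff, mem_preimage, Set.mem_sdiff,
      mem_compl_iff, Set.mem_neg, mem_union, mem_ofPred_eq]
    tauto
  rw [renormRange, h]
  exact (P.isOpen_lift P.one_lt_ρ (Q.dividing.isClosed_rayConfig.isOpen_compl.inter
    Q.dividing.isClosed_rayConfig.neg.isOpen_compl)).connectedComponentIn

omit Q in
lemma α_notMem : P.α ∉ P.domain \ P.rays := fun h =>
  h.2 ⟨P.julia_source P.α_mem_julia, mem_insert _ _⟩

lemma closure_range_bounds {G : Set ℂ} (hG : G ⊆ P.domain) :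
    IsCompact (closure G) ∧ closure G ⊆ U :=
  ⟨P.isCompact_closure_domain.of_isClosed_subset isClosed_closure (closure_mono hG),
    ((closure_mono hG).trans P.closure_domain_subset).trans Q.ql.dom_subset⟩

/-- The other point with the same image corresponds to the opposite point, which lies in the
critical sector. -/
lemma injOn_cell {j : ℕ} (h : ¬ P.period ∣ j) : InjOn f (Q.cell j) := by
  intro z hz w hw hzw
  have hz' := Q.cell_subset j hz
  have hw' := Q.cell_subset j hw
  have h1 := (P.conj_domain Q.ql hz'.1).2
  rw [hzw, (P.conj_domain Q.ql hw'.1).2, quad_eq_quad_iff] at h1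
  rcases h1 with h1 | h1
  · exact (P.h.injOn hw'.1.1 hz'.1.1 h1).symm
  · exfalso
    have hne : Q.dividing.crit ^ 2 ^ j ≠ Q.dividing.crit := fun he => h (Q.crit_pow_eq_iff.1 he)
    have h2 := Q.dividing.neg_sector_subset (Q.crit_pow_mem j) hne (neg_mem_neg.2 hz.2.1)
    rw [← h1] at h2
    exact disjoint_left.1 (Q.dividing.sector_disjoint (Q.crit_pow_mem j) Q.dividing.crit_mem hne)
      hw.2.1 h2

/-- The univalent pull-backs of the range of the renormalization along the critical orbit. -/
lemma exists_pullback_range (hall : ∀ k : ℕ, f^[k * P.period] 0 ∈ Q.centralPiece) {m : ℕ}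
    (hm : m < P.period) : ∃ G : Set ℂ, IsOpen G ∧ IsPreconnected G ∧ G ⊆ Q.cell (P.period - m) ∧
      (∀ k : ℕ, f^[k * P.period + (P.period - m)] 0 ∈ G) ∧ P.α ∈ closure G ∧
      ∀ z ∈ G, (∀ j < m, f^[j] z ∈ U') ∧ f^[m] z ∈ P.renormRange := by
  induction m with
  | zero =>
    refine ⟨P.renormRange, Q.isOpen_renormRange, isPreconnected_connectedComponentIn, ?_, ?_, ?_,
      fun z hz => ⟨by simp, hz⟩⟩
    · rw [Q.cell_of_dvd (by simp)]
      exact Q.renormRange_subset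
    · intro k
      have := hall (k + 1)
      rw [add_mul, one_mul] at this
      exact Q.centralPiece_subset_range this
    -- `α` is a preimage of itself and lies in the closure of the piece of the critical value, hence
    -- in the closure of the central piece.
    · refine closure_mono Q.centralPiece_subset_range ?_
      rw [← Q.preimage_piece_crit]
      refine Q.ql.mem_closure_preimage P.α_mem ?_
      rw [P.α_fixed]
      exact Q.α_mem_closure_piece (Q.dividing.sq_mem Q.dividing.crit_mem)
  | succ m ih =>
    obtain ⟨G, hGo, hGc, hGsub, hGorb, hGα, hGit⟩ := ih (by omega)
    set n := P.period - (m + 1) with hn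
    have hn1 : P.period - m = n + 1 := by omega
    rw [hn1] at hGsub hGorb
    have hd : ¬ P.period ∣ n := fun h => absurd (Nat.le_of_dvd (by omega) h) (by omega)
    have hcrit : Q.dividing.crit ^ 2 ^ n ≠ Q.dividing.crit := fun he => hd (Q.crit_pow_eq_iff.1 he)
    obtain ⟨hGK, hGU⟩ := Q.closure_range_bounds (hGsub.trans ((Q.cell_subset _).trans sdiff_subset))
    have hsplit : U' ∩ f ⁻¹' G ⊆ Q.cell n ∪ Q.symmPiece (Q.dividing.crit ^ 2 ^ n) := by
      intro x hx
      have h1 : x ∈ U' ∩ f ⁻¹' Q.cell (n + 1) := ⟨hx.1, hGsub hx.2⟩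
      rw [Q.preimage_cell_succ hd] at h1
      exact h1.imp (fun h => P.lift_sqrt_subset _ h) id
    have hdisj : Disjoint (Q.cell n) (Q.symmPiece (Q.dividing.crit ^ 2 ^ n)) :=
      (Q.cell_disjoint hd).mono_right (Q.symmPiece_subset (Q.crit_pow_mem n) hcrit)
    have horb : ∀ k : ℕ, f^[k * P.period + n] 0 ∈ Q.cell n ∩ (U' ∩ f ⁻¹' G) := fun k =>
      ⟨Q.orbit_cell (hall k) (by omega) (by omega), filledJulia_subset (Q.orbit_julia _), by
        rw [mem_preimage, ← Function.iterate_succ_apply' f]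
        exact hGorb k⟩
    have hopen : IsOpen (Q.cell n ∩ (U' ∩ f ⁻¹' G)) :=
      (Q.isOpen_piece _).inter (Q.ql.isOpen_preimage hGo)
    refine ⟨Q.cell n ∩ (U' ∩ f ⁻¹' G), hopen, ?_, inter_subset_left, horb, ?_, ?_⟩
    -- Each component covers `G`, and `f` is injective on the cell, so each component contains the
    -- chosen point of the critical orbit.
    · refine isPreconnected_of_forall (f^[0 * P.period + n] 0) fun z hz =>
        ⟨connectedComponentIn (Q.cell n ∩ (U' ∩ f ⁻¹' G)) z, connectedComponentIn_subset _ _, ?_,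
          mem_connectedComponentIn hz, isPreconnected_connectedComponentIn⟩
      have hCsub := connectedComponentIn_subset (Q.cell n ∩ (U' ∩ f ⁻¹' G)) z
      have himg := Q.ql.image_eq_of_closure
        (O := connectedComponentIn (Q.cell n ∩ (U' ∩ f ⁻¹' G)) z) hopen.connectedComponentIn
        (fun x hx => (hCsub hx).2.1) ⟨z, mem_connectedComponentIn hz⟩ hGc hGK hGU
        (fun x hx => (hCsub hx).2.2) (by
          rintro x ⟨hx, hxU⟩
          refine closure_comp_inter_subset ⟨hx, (hsplit hxU).resolve_right fun hxs => ?_, hxU⟩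
          obtain ⟨y, hy1, hy2⟩ := mem_closure_iff.1 hx _ (Q.isOpen_symmPiece _) hxs
          exact disjoint_left.1 hdisj (hCsub hy2).1 hy1)
      obtain ⟨w, hw, hwf⟩ := himg (horb 0).2.2
      have := Q.injOn_cell hd (hCsub hw).1 (horb 0).1 hwf
      exact this ▸ hw
    -- `α` is a limit of the preimage of `G`, but not of the mirror part, whose closure lies in the
    -- open critical piece; so it is a limit of the part in the cell.
    · have h1 : P.α ∈ closure (U' ∩ f ⁻¹' G) :=
        Q.ql.mem_closure_preimage P.α_mem (by rwa [P.α_fixed])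
      have h2 : U' ∩ f ⁻¹' G ⊆ (Q.cell n ∩ (U' ∩ f ⁻¹' G)) ∪
          Q.symmPiece (Q.dividing.crit ^ 2 ^ n) := fun x hx =>
        (hsplit hx).imp (fun h => ⟨h, hx⟩) id
      have h3 := closure_mono h2 h1
      rw [closure_union] at h3
      refine h3.resolve_right fun h => α_notMem (P := P) ?_
      exact Q.piece_subset _ (Q.closure_symmPiece_subset (Q.crit_pow_mem n) hcrit h)
    · rintro z ⟨-, hzU, hzG⟩
      obtain ⟨h1, h2⟩ := hGit _ hzG
      refine ⟨fun j hj => ?_, by rwa [Function.iterate_succ_apply]⟩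
      rcases j with _ | j
      · exact hzU
      · rw [Function.iterate_succ_apply]
        exact h1 j (by omega)

/-- Points that reach the range after `p` steps were never on the rays, nor on the opposite rays at
time zero, so the component of `0` stays within the range. -/
lemma renormDomain_subset : P.renormDomain ⊆ P.renormRange := by
  have hsub : preimageIter f U' P.period P.renormRange ⊆ P.domain \ (P.rays ∪ P.symmRays) := by
    rintro z ⟨hz, hzp⟩
    have hback : ∀ j < P.period, f^[P.period - j] z ∈ P.domain \ P.rays := by
      intro j hj
      induction j with
      | zero => exact Q.piece_subset _ (Q.renormRange_subset hzp)
      | succ j ih =>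
        have h1 := ih (by omega)
        rw [show P.period - j = (P.period - (j + 1)) + 1 by omega,
          Function.iterate_succ_apply'] at h1
        exact (P.mem_of_map_mem Q.ql Q.dividing (hz _ (by omega)) h1).1
    have hp := Q.period_pos
    have h1 := hback (P.period - 1) (by omega)
    rw [Nat.sub_sub_self hp] at h1
    have h2 := P.mem_of_map_mem Q.ql Q.dividing (hz 0 hp) h1
    exact ⟨h2.1.1, fun h => h.elim h2.1.2 h2.2⟩
  by_cases h0 : (0 : ℂ) ∈ preimageIter f U' P.period P.renormRange
  · exact isPreconnected_connectedComponentIn.subset_connectedComponentIn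
      (mem_connectedComponentIn h0) ((connectedComponentIn_subset _ _).trans hsub)
  · rw [renormDomain, connectedComponentIn_eq_empty h0]
    exact empty_subset _

/-- If the critical orbit never escapes through the symmetric pieces, then the map is immediately
renormalizable. -/
theorem immediatelyRenormalizable (hall : ∀ k : ℕ, f^[k * P.period] 0 ∈ Q.centralPiece) :
    P.ImmediatelyRenormalizable := by
  have hp := Q.period_pos
  obtain ⟨G, hGo, hGc, hGsub, hGorb, hGα, hGit⟩ :=
    Q.exists_pullback_range hall (m := P.period - 1) (by omega)
  rw [Nat.sub_sub_self hp] at hGsub hGorb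
  obtain ⟨hGK, hGU⟩ := Q.closure_range_bounds (hGsub.trans ((Q.cell_subset _).trans sdiff_subset))
  have hf0 : f 0 ∈ G := by simpa using hGorb 0
  have hopen : IsOpen (U' ∩ f ⁻¹' G) := Q.ql.isOpen_preimage hGo
  -- The last step of the pull-back is branched: every component covers `G`, hence the critical
  -- value, whose only preimage is `0`.
  have hpre : IsPreconnected (U' ∩ f ⁻¹' G) := by
    refine isPreconnected_of_forall 0 fun z hz => ⟨connectedComponentIn (U' ∩ f ⁻¹' G) z,
      connectedComponentIn_subset _ _, ?_, mem_connectedComponentIn hz,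
      isPreconnected_connectedComponentIn⟩
    have hCsub := connectedComponentIn_subset (U' ∩ f ⁻¹' G) z
    obtain ⟨w, hw, hwf⟩ := Q.ql.image_eq_of_closure
      (O := connectedComponentIn (U' ∩ f ⁻¹' G) z) hopen.connectedComponentIn
      (fun x hx => (hCsub hx).1) ⟨z, mem_connectedComponentIn hz⟩ hGc hGK hGU
      (fun x hx => (hCsub hx).2) closure_comp_inter_subset hf0
    have : w ∈ ({0} : Set ℂ) := by
      rw [← Q.ql.fiber_critical]
      exact ⟨(hCsub hw).1, hwf⟩
    exact (mem_singleton_iff.1 this) ▸ hw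
  have hsub : U' ∩ f ⁻¹' G ⊆ preimageIter f U' P.period P.renormRange := by
    rintro z ⟨hzU, hzG⟩
    obtain ⟨h1, h2⟩ := hGit _ hzG
    refine ⟨fun j hj => ?_, ?_⟩
    · rcases j with _ | j
      · exact hzU
      · rw [Function.iterate_succ_apply]
        exact h1 j (by omega)
    · rwa [← Function.iterate_succ_apply, Nat.succ_eq_add_one, Nat.sub_add_cancel hp] at h2
  have hdom : U' ∩ f ⁻¹' G ⊆ P.renormDomain :=
    hpre.subset_connectedComponentIn ⟨Q.ql.zero_mem, hf0⟩ hsub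
  refine ⟨Q.renormDomain_subset, ⟨?_, fun h => ?_⟩, fun k => hdom ⟨?_, ?_⟩⟩
  · exact closure_mono hdom (Q.ql.mem_closure_preimage P.α_mem (by rwa [P.α_fixed]))
  · have h1 := connectedComponentIn_subset _ _ (interior_subset h)
    have h2 := h1.2
    rw [Function.iterate_fixed P.α_fixed] at h2
    exact α_notMem (Q.piece_subset _ (Q.renormRange_subset h2))
  · exact filledJulia_subset (Q.orbit_julia _)
  · rw [mem_preimage, ← Function.iterate_succ_apply' f]
    exact hGorb k

/-! ### The principal nest -/

lemma exists_initial (hren : ¬ P.ImmediatelyRenormalizable) : ∃ V, P.IsInitialNestPiece V := by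
  classical
  have hex : ∃ s : ℕ, 0 < s ∧ ∃ Z ∈ P.symmPieces, f^[s * P.period] 0 ∈ Z := by
    by_contra! hcon
    refine hren (Q.immediatelyRenormalizable fun k => Q.orbit_central (t := k + 1)
      (fun s hs _ => ?_) (by omega))
    rintro ⟨Z, hZ, h⟩
    exact hcon s hs Z hZ h
  obtain ⟨ht0, Z, hZ, hmem⟩ := Nat.find_spec hex
  have hZ' := hZ
  rw [Q.symmPieces_eq] at hZ'
  obtain ⟨θ, hθ, hne, rfl⟩ := hZ'
  refine ⟨_, Nat.find hex, ⟨⟨ht0, _, hZ, hmem⟩, fun s hs => Nat.find_min' hex hs⟩, _, hZ, ?_, rfl⟩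
  -- The critical orbit cannot land on the boundary of the symmetric piece, because its next point
  -- is off the rays and inside `E`.
  rw [Q.interior_closure_symmPiece hθ]
  refine Q.mem_symmPiece_of_map hmem ?_
  rw [← Function.iterate_succ_apply' f]
  exact Q.orbit_mem _

lemma initial_spec {V : Set ℂ} (hV : P.IsInitialNestPiece V) : ∃ O, V = closure O ∧
    IsRegularPiece U' O ∧ IsNice f U' O ∧ (0 : ℂ) ∈ O ∧ closure O ⊆ Q.piece Q.dividing.crit := by
  obtain ⟨t, ⟨⟨ht0, -⟩, hmin⟩, Z, hZ, hmem, rfl⟩ := hV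
  rw [Q.symmPieces_eq] at hZ
  obtain ⟨θ, hθ, hne, rfl⟩ := hZ
  rw [Q.interior_closure_symmPiece hθ] at hmem
  have ht : ∀ s, 0 < s → s < t → ¬ ∃ Z ∈ P.symmPieces, f^[s * P.period] 0 ∈ Z :=
    fun s hs hst h => absurd (hmin ⟨hs, h⟩) (not_le.2 hst)
  have hp := pullback_eq Q.ql (Q.isRegularPiece_symmPiece hθ)
    (fun k _ => filledJulia_subset (Q.orbit_julia k)) hmem
  exact ⟨_, hp.1, hp.2.1, Q.isNice_initial ht0 ht hθ hne hmem, hp.2.2,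
    (Q.closure_initial_subset ht0 ht hθ hne hmem).trans Q.centralPiece_subset⟩

lemma initial_compactlyContained {V : Set ℂ} (hV : P.IsInitialNestPiece V) :
    CompactlyContained V P.criticalPiece := by
  obtain ⟨O, rfl, hreg, -, -, hsub⟩ := Q.initial_spec hV
  rw [CompactlyContained, closure_closure, Q.criticalPiece_eq]
  exact ⟨hreg.isCompact, hsub.trans (interior_maximal subset_closure (Q.isOpen_piece _))⟩

lemma firstReturn_spec {O V' : Set ℂ} (hreg : IsRegularPiece U' O) (hN : IsNice f U' O)
    (h0 : (0 : ℂ) ∈ O) (h : IsFirstReturnPullback f U' (closure O) V') : ∃ O', V' = closure O' ∧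
      IsRegularPiece U' O' ∧ IsNice f U' O' ∧ (0 : ℂ) ∈ O' ∧ closure O' ⊆ O := by
  obtain ⟨l, hl, rfl⟩ := h
  rw [hreg.interior_closure] at hl
  have hp := pullback_eq Q.ql hreg (fun k _ => filledJulia_subset (Q.orbit_julia k)) hl.1.2
  obtain ⟨h1, h2⟩ := hN.firstReturn Q.ql hreg h0 Q.zero_mem_julia hl
  exact ⟨_, hp.1, hp.2.1, h2, hp.2.2, h1⟩

lemma nest_spec {n : ℕ} {V : Set ℂ} (hV : P.IsNestPiece n V) : ∃ O, V = closure O ∧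
    IsRegularPiece U' O ∧ IsNice f U' O ∧ (0 : ℂ) ∈ O := by
  induction hV with
  | zero h =>
    obtain ⟨O, h1, h2, h3, h4, -⟩ := Q.initial_spec h
    exact ⟨O, h1, h2, h3, h4⟩
  | succ _ h ih =>
    obtain ⟨O, rfl, h2, h3, h4⟩ := ih
    obtain ⟨O', h1, h2, h3, h4, -⟩ := Q.firstReturn_spec h2 h3 h4 h
    exact ⟨O', h1, h2, h3, h4⟩

lemma nest_compactlyContained {n : ℕ} {V V' : Set ℂ} (hV : P.IsNestPiece n V)
    (h : IsFirstReturnPullback f U' V V') : CompactlyContained V' V := by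
  obtain ⟨O, rfl, h2, h3, h4⟩ := Q.nest_spec hV
  obtain ⟨O', rfl, h5, -, -, h6⟩ := Q.firstReturn_spec h2 h3 h4 h
  rw [CompactlyContained, closure_closure, h2.interior_closure]
  exact ⟨h5.isCompact, h6⟩

end PuzzleData.IsAdmissible
end Yoccoz

namespace Yoccoz

/-! ### The Green function -/

open Classical in
/-- The Green function of the basin of infinity. -/
noncomputable def green (c : ℂ) (ψ : ℂ → ℂ) (z : ℂ) : ℝ :=
  if z ∈ quadFilledJulia c then 0 else Real.log ‖Function.invFunOn ψ {w | 1 < ‖w‖} z‖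

namespace IsInverseBottcher

variable {c : ℂ} {ψ : ℂ → ℂ} (hψ : IsInverseBottcher c ψ)
include hψ

lemma invFunOn_apply {w : ℂ} (hw : 1 < ‖w‖) : Function.invFunOn ψ {w | 1 < ‖w‖} (ψ w) = w :=
  hψ.injOn.leftInvOn_invFunOn hw

lemma apply_invFunOn {z : ℂ} (hz : z ∉ quadFilledJulia c) :
    ψ (Function.invFunOn ψ {w | 1 < ‖w‖} z) = z := by
  obtain ⟨w, hw, rfl⟩ := hψ.exists_of_notMem hz
  rw [hψ.invFunOn_apply hw]

lemma one_lt_norm_invFunOn {z : ℂ} (hz : z ∉ quadFilledJulia c) :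
    1 < ‖Function.invFunOn ψ {w | 1 < ‖w‖} z‖ := by
  obtain ⟨w, hw, rfl⟩ := hψ.exists_of_notMem hz
  rwa [hψ.invFunOn_apply hw]

lemma continuousAt_invFunOn {z : ℂ} (hz : z ∉ quadFilledJulia c) :
    ContinuousAt (Function.invFunOn ψ {w | 1 < ‖w‖}) z := by
  intro V hV
  obtain ⟨w, hw, rfl⟩ := hψ.exists_of_notMem hz
  rw [hψ.invFunOn_apply hw] at hV
  obtain ⟨W, hWV, hWo, hwW⟩ := mem_nhds_iff.1 hV
  have hE : IsOpen {w : ℂ | 1 < ‖w‖} := isOpen_lt continuous_const continuous_norm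
  rw [mem_map]
  refine mem_of_superset ((hψ.isOpen_image (hWo.inter hE) inter_subset_right).mem_nhds
    ⟨w, ⟨hwW, hw⟩, rfl⟩) ?_
  rintro _ ⟨y, ⟨hy, hyE⟩, rfl⟩
  rw [mem_preimage, hψ.invFunOn_apply hyE]
  exact hWV hy

lemma differentiableAt_invFunOn_of_deriv {w : ℂ} (hw : 1 < ‖w‖) (hd : deriv ψ w ≠ 0) :
    DifferentiableAt ℂ (Function.invFunOn ψ {w | 1 < ‖w‖}) (ψ w) := by
  have hE : IsOpen {w : ℂ | 1 < ‖w‖} := isOpen_lt continuous_const continuous_norm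
  have h1 : HasDerivAt ψ (deriv ψ w) (Function.invFunOn ψ {w | 1 < ‖w‖} (ψ w)) := by
    rw [hψ.invFunOn_apply hw]
    exact (hψ.holo.differentiableAt (hE.mem_nhds hw)).hasDerivAt
  refine (h1.of_local_left_inverse (hψ.continuousAt_invFunOn (hψ.notMem hw)) hd ?_).differentiableAt
  filter_upwards [hψ.isClosed_quadFilledJulia.isOpen_compl.mem_nhds (hψ.notMem hw)] with z hz
  exact hψ.apply_invFunOn hz

/-- By injectivity `ψ` is nowhere locally constant, so zeros of its derivative are isolated; at
their images the continuous inverse has removable singularities. -/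
lemma differentiableAt_invFunOn {z : ℂ} (hz : z ∉ quadFilledJulia c) :
    DifferentiableAt ℂ (Function.invFunOn ψ {w | 1 < ‖w‖}) z := by
  obtain ⟨w, hw, rfl⟩ := hψ.exists_of_notMem hz
  have hE : IsOpen {w : ℂ | 1 < ‖w‖} := isOpen_lt continuous_const continuous_norm
  obtain ⟨ε, hε, hball⟩ := Metric.isOpen_iff.1 hE w hw
  have hev : ∀ᶠ y in 𝓝[≠] w, deriv ψ y ≠ 0 := by
    rcases ((hψ.analyticOnNhd w hw).deriv).eventually_eq_zero_or_eventually_ne_zero with h | h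
    · exfalso
      obtain ⟨δ, hδ, hδ'⟩ := Metric.eventually_nhds_iff_ball.1 (h.and (hE.eventually_mem hw))
      have hconst : ∀ y ∈ Metric.ball w δ, ψ y = ψ w := fun y hy =>
        (convex_ball w δ).is_const_of_fderivWithin_eq_zero (𝕜 := ℂ)
          (fun x hx => (hψ.holo.differentiableAt
            (hE.mem_nhds (hδ' x hx).2)).differentiableWithinAt) (fun x hx => by
            rw [fderivWithin_of_isOpen Metric.isOpen_ball hx]
            ext
            simpa using (hδ' x hx).1) hy (Metric.mem_ball_self hδ)
      have hm : w + (δ / 2 : ℝ) ∈ Metric.ball w δ := by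
        simp [abs_of_pos hδ, hδ]
      have := hψ.injOn (hδ' _ hm).2 hw (hconst _ hm)
      simp [hδ.ne'] at this
    · exact h
  rw [eventually_nhdsWithin_iff] at hev
  obtain ⟨V, hV, hVo, hwV⟩ := eventually_nhds_iff.1 hev
  have hW : ψ '' (V ∩ {w | 1 < ‖w‖}) ∈ 𝓝 (ψ w) :=
    (hψ.isOpen_image (hVo.inter hE) inter_subset_right).mem_nhds ⟨w, ⟨hwV, hw⟩, rfl⟩
  refine DifferentiableOn.differentiableAt
    ((Complex.differentiableOn_compl_singleton_and_continuousAt_iff hW).1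
    ⟨?_, hψ.continuousAt_invFunOn hz⟩) hW
  rintro _ ⟨⟨y, ⟨hyV, hy⟩, rfl⟩, hne⟩
  exact (hψ.differentiableAt_invFunOn_of_deriv hy (hV y hyV fun h => hne (by rw [h]; rfl))).differentiableWithinAt

omit hψ in
lemma green_of_mem {z : ℂ} (hz : z ∈ quadFilledJulia c) : green c ψ z = 0 := by simp [green, hz]

omit hψ in
lemma green_of_notMem {z : ℂ} (hz : z ∉ quadFilledJulia c) :
    green c ψ z = Real.log ‖Function.invFunOn ψ {w | 1 < ‖w‖} z‖ := by simp [green, hz]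

lemma green_pos {z : ℂ} (hz : z ∉ quadFilledJulia c) : 0 < green c ψ z := by
  rw [green_of_notMem hz]
  exact Real.log_pos (hψ.one_lt_norm_invFunOn hz)

lemma green_nonneg (z : ℂ) : 0 ≤ green c ψ z := by
  by_cases hz : z ∈ quadFilledJulia c
  · rw [green_of_mem hz]
  · exact (hψ.green_pos hz).le

lemma green_quad_iterate (n : ℕ) (z : ℂ) : green c ψ ((quad c)^[n] z) = 2 ^ n * green c ψ z := by
  by_cases hz : z ∈ quadFilledJulia c
  · rw [green_of_mem hz, green_of_mem (iterate_quad_mem hz n), mul_zero]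
  · obtain ⟨w, hw, rfl⟩ := hψ.exists_of_notMem hz
    have hw' : 1 < ‖w ^ 2 ^ n‖ := by
      rw [norm_pow]; exact one_lt_pow₀ hw (by positivity)
    rw [hψ.iterate hw, green_of_notMem (hψ.notMem hw'), green_of_notMem hz,
      hψ.invFunOn_apply hw, hψ.invFunOn_apply hw', norm_pow, Real.log_pow]
    push_cast
    ring

lemma continuous_green : Continuous (green c ψ) := by
  rw [continuous_iff_continuousAt]
  intro z
  by_cases hz : z ∈ quadFilledJulia c
  · rw [ContinuousAt, green_of_mem hz, Metric.tendsto_nhds]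
    intro ε hε
    filter_upwards [(hψ.isOpen_potentialDisk (Real.one_lt_exp_iff.2 hε)).mem_nhds
      (Or.inl hz : z ∈ potentialDisk c ψ (Real.exp ε))] with y hy
    rw [dist_zero_right, Real.norm_of_nonneg (hψ.green_nonneg y)]
    by_cases hyK : y ∈ quadFilledJulia c
    · rwa [green_of_mem hyK]
    · obtain ⟨w, hw, rfl⟩ := hψ.exists_of_notMem hyK
      rw [hψ.mem_potentialDisk hw] at hy
      rw [green_of_notMem hyK, hψ.invFunOn_apply hw]
      exact (Real.log_lt_iff_lt_exp (by linarith)).2 hy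
  · have h := ((hψ.continuousAt_invFunOn hz).norm).log (by linarith [hψ.one_lt_norm_invFunOn hz])
    refine h.congr ?_
    filter_upwards [hψ.isClosed_quadFilledJulia.isOpen_compl.mem_nhds hz] with y hy
    exact (green_of_notMem hy).symm

end IsInverseBottcher

/-! ### Sub-mean values of the truncated Green function -/

/-- A weak maximum principle. By `hloc` the set where the maximum is attained is open, so an
interior maximum spreads over the ball and up to the sphere. -/
lemma exists_mem_sphere_le {w : ℂ → ℝ} {z : ℂ} {ρ : ℝ} (hρ : 0 < ρ)
    (hw : ContinuousOn w (Metric.closedBall z ρ))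
    (hloc : ∀ x ∈ Metric.ball z ρ, (∀ᶠ y in 𝓝 x, w y ≤ w x) → ∀ᶠ y in 𝓝 x, w x ≤ w y) :
    ∃ y ∈ Metric.sphere z ρ, w z ≤ w y := by
  obtain ⟨x, hx, hmax⟩ := (isCompact_closedBall z ρ).exists_isMaxOn
    ⟨z, Metric.mem_closedBall_self hρ.le⟩ hw
  rcases (Metric.mem_closedBall.1 hx).eq_or_lt with hxs | hxb
  · exact ⟨x, hxs, hmax (Metric.mem_closedBall_self hρ.le)⟩
  have hsub : Metric.ball z ρ ⊆ {y | w x ≤ w y} := by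
    have ho : IsOpen (Metric.ball z ρ ∩ {y | w x ≤ w y}) := by
      rw [isOpen_iff_mem_nhds]
      rintro y ⟨hy, hxy⟩
      have hball := Metric.isOpen_ball.mem_nhds hy
      have h1 : ∀ᶠ u in 𝓝 y, w u ≤ w y := by
        filter_upwards [hball] with u hu
        exact (hmax (Metric.ball_subset_closedBall hu)).trans hxy
      filter_upwards [hball, hloc y hy h1] with u hu hu'
      exact ⟨hu, hxy.trans hu'⟩
    refine ((convex_ball z ρ).isPreconnected.subset_of_closure_inter_subset ho
      ⟨x, hxb, hxb, by simp⟩ ?_).trans inter_subset_right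
    rintro y ⟨hy, hyb⟩
    refine ⟨hyb, ?_⟩
    have hc : ContinuousAt w y :=
      hw.continuousAt (mem_of_superset (Metric.isOpen_ball.mem_nhds hyb)
        Metric.ball_subset_closedBall)
    by_contra hlt
    rw [mem_ofPred_eq, not_le] at hlt
    obtain ⟨u, hu, -, hu'⟩ := mem_closure_iff_nhds.1 hy _ (hc.eventually (gt_mem_nhds hlt))
    exact not_lt.2 (mem_ofPred_eq.mp hu') hu
  obtain ⟨y, hy⟩ := (NormedSpace.sphere_nonempty (E := ℂ) (x := z)).2 hρ.le
  refine ⟨y, hy, ?_⟩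
  have hyc : y ∈ closure (Metric.ball z ρ) := by
    rw [closure_ball z hρ.ne']
    exact Metric.sphere_subset_closedBall hy
  have hle : w x ≤ w y := by
    have h := (hw y (Metric.sphere_subset_closedBall hy)).mono Metric.ball_subset_closedBall
    have := mem_closure_iff_nhdsWithin_neBot.1 hyc
    exact ge_of_tendsto h (eventually_nhdsWithin_of_forall hsub)
  exact (hmax (Metric.mem_closedBall_self hρ.le)).trans hle

/-- The hypothesis bounds Riemann sums over regular `n`-gons from below. The position of the polygon
may depend on `n`; periodicity and uniform continuity make this harmless in the limit. -/
lemma mul_le_integral_circleMap {v : ℂ → ℝ} {z : ℂ} {ρ : ℝ} (hρ : 0 < ρ)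
    (hv : ContinuousOn v (Metric.closedBall z ρ))
    (h : ∀ n : ℕ, 0 < n → ∃ y ∈ Metric.sphere z ρ,
      n * v z ≤ ∑ k ∈ Finset.range n, v (z + Circle.exp (2 * Real.pi * k / n) * (y - z))) :
    2 * Real.pi * v z ≤ ∫ t in (0 : ℝ)..2 * Real.pi, v (circleMap z ρ t) := by
  have hpi := Real.pi_pos
  set u : ℝ → ℝ := fun t => v (circleMap z ρ t) with hu
  have huc : Continuous u := by
    refine continuousOn_univ.1 (hv.comp (continuous_circleMap z ρ).continuousOn fun t _ => ?_)
    exact Metric.sphere_subset_closedBall (circleMap_mem_sphere z hρ.le t)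
  have hper : Function.Periodic u (2 * Real.pi) := fun t => by
    simp only [hu, periodic_circleMap z ρ t]
  refine le_of_forall_pos_le_add fun ε hε => ?_
  obtain ⟨δ, hδ, hunif⟩ := Metric.uniformContinuousOn_iff.1
    ((isCompact_Icc (a := (0 : ℝ)) (b := 4 * Real.pi)).uniformContinuousOn_of_continuous
      huc.continuousOn) (ε / (2 * Real.pi)) (by positivity)
  obtain ⟨n, hn⟩ := exists_nat_gt (2 * Real.pi / δ)
  have hn0 : (0 : ℝ) < n := lt_trans (by positivity) hn
  have hstep : 2 * Real.pi / n < δ := by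
    rw [div_lt_iff₀ hδ] at hn
    rw [div_lt_iff₀ hn0]
    linarith
  obtain ⟨y, hy, hsum⟩ := h n (by exact_mod_cast hn0)
  obtain ⟨t, ht, rfl⟩ : y ∈ circleMap z ρ '' Ioc 0 (2 * Real.pi) := by
    rw [image_circleMap_Ioc, abs_of_pos hρ]
    exact hy
  set p : ℕ → ℝ := fun k => t + 2 * Real.pi * k / n with hp
  have hpu : ∀ k : ℕ, v (z + Circle.exp (2 * Real.pi * k / n) * (circleMap z ρ t - z)) = u (p k) := by
    intro k
    simp only [hu, hp, circleMap, Circle.coe_exp]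
    congr 1
    push_cast
    rw [add_mul, Complex.exp_add]
    ring
  have hp_succ : ∀ k, p (k + 1) = p k + 2 * Real.pi / n := fun k => by
    simp only [hp]; push_cast; ring
  have hint : ∫ s in (0 : ℝ)..2 * Real.pi, u s = ∑ k ∈ Finset.range n, ∫ s in p k..p (k + 1), u s := by
    rw [intervalIntegral.sum_integral_adjacent_intervals
      (fun k _ => huc.intervalIntegrable _ _)]
    have h0 : p 0 = t := by simp [hp]
    have hn1 : p n = t + 2 * Real.pi := by simp only [hp]; field_simp
    rw [h0, hn1, hper.intervalIntegral_add_eq t 0, zero_add]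
  have hpiece : ∀ k ∈ Finset.range n, 2 * Real.pi / n * (u (p k) - ε / (2 * Real.pi)) ≤
      ∫ s in p k..p (k + 1), u s := by
    intro k hk
    have hk' : (k : ℝ) + 1 ≤ n := by exact_mod_cast Finset.mem_range.1 hk
    have hle : p k ≤ p (k + 1) := by rw [hp_succ]; linarith [show 0 < 2 * Real.pi / n by positivity]
    have hconst : 2 * Real.pi / n * (u (p k) - ε / (2 * Real.pi)) =
        ∫ _ in p k..p (k + 1), (u (p k) - ε / (2 * Real.pi)) := by
      rw [intervalIntegral.integral_const, smul_eq_mul, hp_succ]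
      ring
    rw [hconst]
    refine intervalIntegral.integral_mono_on hle (by simp)
      (huc.intervalIntegrable _ _) fun s hs => ?_
    have hp0 : 0 < p k := by
      have : 0 ≤ 2 * Real.pi * k / n := by positivity
      simp only [hp]; linarith [ht.1]
    have hp4 : p (k + 1) ≤ 4 * Real.pi := by
      have : 2 * Real.pi * ((k : ℝ) + 1) / n ≤ 2 * Real.pi := by
        rw [div_le_iff₀ hn0]; gcongr
      simp only [hp]; push_cast; linarith [ht.2]
    have := hunif (p k) ⟨hp0.le, hle.trans hp4⟩ s ⟨hp0.le.trans hs.1, hs.2.trans hp4⟩ (by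
      rw [dist_comm, Real.dist_eq, abs_of_nonneg (by linarith [hs.1])]
      have := hs.2
      rw [hp_succ] at this
      linarith)
    rw [Real.dist_eq] at this
    linarith [(abs_lt.1 this).2]
  have hfin := Finset.sum_le_sum hpiece
  rw [← hint, ← Finset.mul_sum, Finset.sum_sub_distrib, Finset.sum_const, Finset.card_range,
    nsmul_eq_mul] at hfin
  simp only [hpu] at hsum
  have h2 : 2 * Real.pi / n * (n * v z - n * (ε / (2 * Real.pi))) ≤
      ∫ s in (0 : ℝ)..2 * Real.pi, u s := le_trans (by gcongr) hfin
  have h3 : 2 * Real.pi / n * (n * v z - n * (ε / (2 * Real.pi))) = 2 * Real.pi * v z - ε := by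
    field_simp
  linarith

end Yoccoz

/-! ### From sub-mean values to area bounds -/

namespace Yoccoz

open MeasureTheory in
-- Since `v ≤ M` on `T` and `v = 0` elsewhere, each circle of radius below `R` meets `T` in angular
-- measure at least `2πm / M`. Polar integration over radii between `R / 2` and `R` gives the area.
lemma ofReal_le_volume_of_le_integral {T : Set ℂ} (hT : IsOpen T) {v : ℂ → ℝ} {z : ℂ} {R M m : ℝ}
    (hR : 0 < R) (hM : 0 < M) (hvM : ∀ x ∈ Metric.ball z R, v x ≤ M) (hv0 : ∀ x ∉ T, v x = 0)
    (hv : ContinuousOn v (Metric.ball z R))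
    (h : ∀ r ∈ Ioo 0 R, 2 * Real.pi * m ≤ ∫ t in (0 : ℝ)..2 * Real.pi, v (circleMap z r t)) :
    ENNReal.ofReal (R / 2 * (2 * Real.pi * m / M) * (R / 2)) ≤ volume T := by
  have hpi := Real.pi_pos
  set g : ℂ → ENNReal := fun ζ => T.indicator 1 (z + ζ) with hg
  have hgm : Measurable g := (measurable_one.indicator hT.measurableSet).comp (measurable_const_add z)
  have hvol : volume T = ∫⁻ ζ, g ζ := by
    rw [hg, lintegral_add_left_eq_self (fun x => T.indicator (1 : ℂ → ENNReal) x) z,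
      lintegral_indicator_one hT.measurableSet]
  rw [hvol, ← Complex.lintegral_comp_polarCoord_symm, polarCoord_target, Measure.volume_eq_prod,
    ← Measure.prod_restrict, lintegral_prod _ (by
      refine Measurable.aemeasurable ?_
      refine (ENNReal.measurable_ofReal.comp measurable_fst).smul (hgm.comp ?_)
      have : (Complex.polarCoord.symm : ℝ × ℝ → ℂ) = fun p : ℝ × ℝ =>
          (p.1 : ℂ) * ((Real.cos p.2 : ℂ) + (Real.sin p.2 : ℂ) * Complex.I) := by
        ext p; rw [Complex.polarCoord_symm_apply]
      rw [this]
      fun_prop)]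
  have hcirc : ∀ r ∈ Ioo 0 R, ENNReal.ofReal (2 * Real.pi * m / M) ≤
      ∫⁻ t in Ioo (-Real.pi) Real.pi, g (Complex.polarCoord.symm (r, t)) := by
    intro r hr
    have hmem : ∀ t, circleMap z r t ∈ Metric.ball z R := fun t => by
      rw [Metric.mem_ball, dist_eq_norm, circleMap_sub_center, norm_circleMap_zero,
        abs_of_pos hr.1]
      exact hr.2
    have huc : Continuous fun t => v (circleMap z r t) :=
      continuousOn_univ.1 (hv.comp (continuous_circleMap z r).continuousOn fun t _ => hmem t)
    have hper : Function.Periodic (fun t => v (circleMap z r t)) (2 * Real.pi) := fun t => by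
      simp only [periodic_circleMap z r t]
    have h1 := h r hr
    have h2 := hper.intervalIntegral_add_eq 0 (-Real.pi)
    rw [zero_add] at h2
    rw [h2, show -Real.pi + 2 * Real.pi = Real.pi by ring,
      intervalIntegral.integral_of_le (by linarith)] at h1
    rw [ENNReal.ofReal_div_of_pos hM, ENNReal.div_le_iff (by simpa using hM) (by simp)]
    calc ENNReal.ofReal (2 * Real.pi * m)
        ≤ ENNReal.ofReal (∫ t in Ioc (-Real.pi) Real.pi, v (circleMap z r t)) :=
          ENNReal.ofReal_le_ofReal h1
      _ ≤ ∫⁻ t in Ioc (-Real.pi) Real.pi, ENNReal.ofReal (v (circleMap z r t)) := by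
          rw [integral_eq_lintegral_pos_part_sub_lintegral_neg_part
            (huc.integrableOn_Ioc)]
          refine le_trans (ENNReal.ofReal_le_ofReal (sub_le_self _ ENNReal.toReal_nonneg)) ?_
          exact ENNReal.ofReal_toReal_le
      _ = ∫⁻ t in Ioo (-Real.pi) Real.pi, ENNReal.ofReal (v (circleMap z r t)) := by
          rw [restrict_Ioo_eq_restrict_Ioc]
      _ ≤ ∫⁻ t in Ioo (-Real.pi) Real.pi,
            g (Complex.polarCoord.symm (r, t)) * ENNReal.ofReal M := by
          refine lintegral_mono fun t => ?_
          have hz : z + Complex.polarCoord.symm (r, t) = circleMap z r t := by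
            rw [Complex.polarCoord_symm_apply, circleMap, Complex.exp_mul_I]
            push_cast
            rfl
          simp only [hg, hz]
          by_cases hT' : circleMap z r t ∈ T
          · rw [indicator_of_mem hT', Pi.one_apply, one_mul]
            exact ENNReal.ofReal_le_ofReal (hvM _ (hmem t))
          · simp [hv0 _ hT']
      _ = _ := lintegral_mul_const' _ _ (by simp)
  calc ENNReal.ofReal (R / 2 * (2 * Real.pi * m / M) * (R / 2))
      = ∫⁻ _ in Ioo (R / 2) R, ENNReal.ofReal (R / 2 * (2 * Real.pi * m / M)) := by
        rw [setLIntegral_const, Real.volume_Ioo, ← ENNReal.ofReal_mul' (by linarith)]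
        congr 1
        ring
    _ ≤ ∫⁻ r in Ioo (R / 2) R, ∫⁻ t in Ioo (-Real.pi) Real.pi,
          ENNReal.ofReal r • g (Complex.polarCoord.symm (r, t)) := by
        refine setLIntegral_mono' measurableSet_Ioo fun r hr => ?_
        have hr0 : r ∈ Ioo 0 R := ⟨by linarith [hr.1], hr.2⟩
        simp only [smul_eq_mul]
        rw [lintegral_const_mul' _ _ (by simp), ENNReal.ofReal_mul (by positivity)]
        exact mul_le_mul' (ENNReal.ofReal_le_ofReal hr.1.le) (hcirc r hr0)
    _ ≤ _ := lintegral_mono_set fun r hr => lt_trans (by positivity) hr.1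

namespace IsInverseBottcher

variable {c : ℂ} {ψ : ℂ → ℂ} (hψ : IsInverseBottcher c ψ)
include hψ

/-- Symmetrize the truncated Green function over `n` rotations about `z`. At a local maximum `x`,
the sum is bounded below nearby by the logarithm of the modulus of a holomorphic product over the
copies lying in `T`, with equality at `x`; so the maximum modulus principle supplies the local
hypothesis of `exists_mem_sphere_le`. -/
lemma indicator_green_le_integral {T : Set ℂ} (hT : IsOpen T) (hTK : T ⊆ (quadFilledJulia c)ᶜ)
    {z : ℂ} {ρ : ℝ} (hρ : 0 < ρ)
    (hv : ContinuousOn (T.indicator (green c ψ)) (Metric.closedBall z ρ)) :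
    2 * Real.pi * T.indicator (green c ψ) z ≤
      ∫ t in (0 : ℝ)..2 * Real.pi, T.indicator (green c ψ) (circleMap z ρ t) := by
  classical
  set v := T.indicator (green c ψ) with hvdef
  have hv0 : ∀ x, 0 ≤ v x := fun x => indicator_nonneg (fun y _ => hψ.green_nonneg y) x
  refine mul_le_integral_circleMap hρ hv fun n hn => ?_
  set R : ℕ → ℂ → ℂ := fun k x => z + Circle.exp (2 * Real.pi * k / n) * (x - z) with hR
  have hRc : ∀ k, Continuous (R k) := fun k => by simp only [hR]; fun_prop
  have hRd : ∀ k, Differentiable ℂ (R k) := fun k => by simp only [hR]; fun_prop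
  have hRm : ∀ k x, dist (R k x) z = dist x z := fun k x => by
    rw [dist_eq_norm, dist_eq_norm, hR, add_sub_cancel_left, norm_mul, Circle.norm_coe, one_mul]
  obtain ⟨y, hy, hle⟩ := exists_mem_sphere_le (w := fun x => ∑ k ∈ Finset.range n, v (R k x)) hρ
    (by
      refine continuousOn_finsetSum _ fun k _ => hv.comp (hRc k).continuousOn fun x hx => ?_
      rw [Metric.mem_closedBall, hRm]
      exact hx) (by
      intro x hx hmax
      set S := (Finset.range n).filter fun k => R k x ∈ T with hS
      set F := Function.invFunOn ψ {w | 1 < ‖w‖}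
      set g : ℂ → ℂ := fun y => ∏ k ∈ S, F (R k y) with hg
      have hTev : ∀ᶠ y in 𝓝 x, ∀ k ∈ S, R k y ∈ T := by
        rw [Finset.eventually_all]
        intro k hk
        exact (hRc k).continuousAt.eventually (hT.mem_nhds (Finset.mem_filter.1 hk).2)
      have hgpos : ∀ y, (∀ k ∈ S, R k y ∈ T) → 0 < ‖g y‖ := fun y hy => by
        rw [hg, norm_prod]
        exact Finset.prod_pos fun k hk =>
          one_pos.trans (hψ.one_lt_norm_invFunOn (hTK (hy k hk)))
      have hlog : ∀ y, (∀ k ∈ S, R k y ∈ T) → Real.log ‖g y‖ = ∑ k ∈ S, v (R k y) := fun y hy => by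
        rw [hg, norm_prod, Real.log_prod fun k hk =>
          (one_pos.trans (hψ.one_lt_norm_invFunOn (hTK (hy k hk)))).ne']
        refine Finset.sum_congr rfl fun k hk => ?_
        rw [hvdef, indicator_of_mem (hy k hk), green_of_notMem (hTK (hy k hk))]
      have hlow : ∀ y, ∑ k ∈ S, v (R k y) ≤ ∑ k ∈ Finset.range n, v (R k y) := fun y =>
        Finset.sum_le_sum_of_subset_of_nonneg (Finset.filter_subset _ _) fun k _ _ => hv0 _
      have hxS : ∀ k ∈ S, R k x ∈ T := fun k hk => (Finset.mem_filter.1 hk).2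
      have heq : ∑ k ∈ S, v (R k x) = ∑ k ∈ Finset.range n, v (R k x) := by
        refine Finset.sum_subset (Finset.filter_subset _ _) fun k hk hkS => ?_
        exact indicator_of_notMem (fun h => hkS (Finset.mem_filter.2 ⟨hk, h⟩)) _
      have hdiff : ∀ᶠ y in 𝓝 x, DifferentiableAt ℂ g y := by
        filter_upwards [hTev] with y hy
        refine DifferentiableAt.fun_finsetProd fun k hk => ?_
        exact (hψ.differentiableAt_invFunOn (hTK (hy k hk))).comp y (hRd k y)
      have hloc : IsLocalMax (norm ∘ g) x := by
        filter_upwards [hTev, hmax] with y hy hy'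
        change ‖g y‖ ≤ ‖g x‖
        rw [← Real.log_le_log_iff (hgpos y hy) (hgpos x hxS), hlog y hy, hlog x hxS, heq]
        exact (hlow y).trans hy'
      filter_upwards [hTev, Complex.norm_eventually_eq_of_isLocalMax hdiff hloc] with y hy hy'
      rw [← heq, ← hlog x hxS, ← hy', hlog y hy]
      exact hlow y)
  refine ⟨y, hy, le_trans (le_of_eq ?_) hle⟩
  simp [hR]

end IsInverseBottcher
end Yoccoz

namespace Yoccoz

/-! ### The basin near a repelling fixed point -/

/-- `Φ` is a branch near `a` of the inverse of the `N`-th iterate of `z ↦ z ^ 2 + c`, which fixes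
`a` and contracts the disk of radius `s` about `a`. -/
structure IsInverseBranch (c a : ℂ) (N : ℕ) (s : ℝ) (Φ : ℂ → ℂ) : Prop where
  radius_pos : 0 < s
  continuousOn : ContinuousOn Φ (Metric.ball a s)
  mapsTo : MapsTo Φ (Metric.ball a s) (Metric.ball a (s / 2))
  right_inv : ∀ z ∈ Metric.ball a s, (quad c)^[N] (Φ z) = z
  left_inv : ∀ᶠ z in 𝓝 a, Φ ((quad c)^[N] z) = z

/-- The part of the basin of infinity in the disk of radius `s` about `a`. -/
def basinBall (c a : ℂ) (s : ℝ) : Set ℂ := (quadFilledJulia c)ᶜ ∩ Metric.ball a s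

lemma comp_eq_or_disjoint {F : Set ℂ} (z w : ℂ) :
    connectedComponentIn F z = connectedComponentIn F w ∨
      Disjoint (connectedComponentIn F z) (connectedComponentIn F w) := by
  by_contra! h
  obtain ⟨x, hx, hx'⟩ := not_disjoint_iff.1 h.2
  exact h.1 ((connectedComponentIn_eq hx).trans (connectedComponentIn_eq hx').symm)

lemma const_of_pow_eq_one {X : Type*} [TopologicalSpace X] {S : Set X} (hS : IsPreconnected S)
    {q : X → ℂ} (hq : ContinuousOn q S) {n : ℕ} (hn : 0 < n) (h : ∀ x ∈ S, q x ^ n = 1) {x y : X}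
    (hx : x ∈ S) (hy : y ∈ S) : q x = q y := by
  have hfin : {u : ℂ | u ^ n = 1}.Finite := by
    refine ((Polynomial.nthRootsFinset n (1 : ℂ)).finite_toSet).subset fun u hu => ?_
    exact (Polynomial.mem_nthRootsFinset hn (1 : ℂ)).2 hu
  obtain ⟨u, -, hu⟩ := hS.eqOn_const_of_mapsTo ⟨hfin.instDiscreteTopology⟩ hq (T := {u : ℂ | u ^ n = 1}) h ⟨1, one_pow n⟩
  exact (hu hx).trans (hu hy).symm

namespace IsInverseBottcher

variable {c : ℂ} {ψ : ℂ → ℂ} (hψ : IsInverseBottcher c ψ)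
include hψ

lemma isOpen_basinBall (a : ℂ) (s : ℝ) : IsOpen (basinBall c a s) :=
  hψ.isClosed_quadFilledJulia.isOpen_compl.inter Metric.isOpen_ball

lemma iterate_ray {r : ℝ} (hr : 1 < r) (ζ : Circle) (n : ℕ) :
    (quad c)^[n] (ψ (r * ζ)) = ψ ((r ^ 2 ^ n : ℝ) * (ζ ^ 2 ^ n : Circle)) := by
  rw [hψ.iterate (one_lt_norm_mul hr ζ)]
  push_cast
  rw [mul_pow]

lemma exists_tail_comp {a : ℂ} {s : ℝ} (hs : 0 < s) {θ : Circle} (hθ : θ ∈ landingAngles ψ a) :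
    ∃ z, ∃ r : ℝ, 1 < r ∧ ∀ t ∈ Ioo 1 r, ψ (t * θ) ∈ connectedComponentIn (basinBall c a s) z := by
  have hev : ∀ᶠ t : ℝ in 𝓝[>] 1, ψ (t * θ) ∈ Metric.ball a s :=
    (show Tendsto _ _ _ from hθ).eventually (Metric.ball_mem_nhds a hs)
  obtain ⟨r, hr, hsub⟩ := mem_nhdsGT_iff_exists_Ioo_subset.1 hev
  have hr1 : (1 : ℝ) < r := hr
  refine ⟨ψ (((1 + r) / 2 : ℝ) * θ), r, hr, fun t ht => ?_⟩
  have hpre : IsPreconnected ((fun t : ℝ => ψ (t * θ)) '' Ioo 1 r) :=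
    isPreconnected_Ioo.image _ (hψ.continuousOn.comp (by fun_prop) fun t ht =>
      one_lt_norm_mul ht.1 θ)
  refine hpre.subset_connectedComponentIn ⟨(1 + r) / 2, ⟨by linarith, by linarith⟩, rfl⟩ ?_
    ⟨t, ht, rfl⟩
  rintro _ ⟨t, ht, rfl⟩
  exact ⟨hψ.notMem (one_lt_norm_mul ht.1 θ), hsub ht⟩

omit hψ in
lemma tendsto_rpow_inv (n : ℕ) (hn : 0 < n) :
    Tendsto (fun t : ℝ => t ^ ((n : ℝ)⁻¹)) (𝓝[>] 1) (𝓝[>] 1) := by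
  refine tendsto_nhdsWithin_iff.2 ⟨?_, ?_⟩
  · have := (Real.continuousAt_rpow_const 1 ((n : ℝ)⁻¹) (Or.inl one_ne_zero)).tendsto
    rw [Real.one_rpow] at this
    exact this.mono_left nhdsWithin_le_nhds
  · filter_upwards [self_mem_nhdsWithin] with t ht
    exact Real.one_lt_rpow ht (by positivity)

/-- Within the ball, the boundary of the component lies in the filled Julia set, where the Green
function vanishes. -/
lemma continuousOn_indicator_green {a : ℂ} {s : ℝ} (x : ℂ) :
    ContinuousOn ((connectedComponentIn (basinBall c a s) x).indicator (green c ψ))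
      (Metric.ball a s) := by
  intro z hz
  refine ContinuousAt.continuousWithinAt ?_
  set T := connectedComponentIn (basinBall c a s) x
  have hTo : IsOpen T := (hψ.isOpen_basinBall a s).connectedComponentIn
  by_cases hK : z ∈ quadFilledJulia c
  · have hzT : z ∉ T := fun h => (connectedComponentIn_subset _ _ h).1 hK
    rw [ContinuousAt, indicator_of_notMem hzT]
    have h0 := hψ.continuous_green.tendsto z
    rw [green_of_mem hK] at h0
    exact squeeze_zero (fun y => indicator_nonneg (fun y _ => hψ.green_nonneg y) y)
      (fun y => indicator_le_self' (fun y _ => hψ.green_nonneg y) y) h0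
  · by_cases hzT : z ∈ T
    · refine hψ.continuous_green.continuousAt.congr ?_
      filter_upwards [hTo.mem_nhds hzT] with y hy
      exact (indicator_of_mem hy _).symm
    · refine (continuousAt_const (y := (0 : ℝ))).congr ?_
      filter_upwards [((hψ.isOpen_basinBall a s).connectedComponentIn (x := z)).mem_nhds
        (mem_connectedComponentIn ⟨hK, hz⟩)] with y hy
      refine (indicator_of_notMem (fun hyT => hzT ?_) _).symm
      have : T = connectedComponentIn (basinBall c a s) z :=
        (connectedComponentIn_eq hyT).trans (connectedComponentIn_eq hy).symm
      rw [this]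
      exact mem_connectedComponentIn ⟨hK, hz⟩

variable {a : ℂ} {N : ℕ} {s : ℝ} {Φ : ℂ → ℂ} (hΦ : IsInverseBranch c a N s Φ)
include hΦ

omit hψ in
lemma _root_.Yoccoz.IsInverseBranch.mapsTo_basinBall :
    MapsTo Φ (basinBall c a s) (basinBall c a s) := by
  rintro z ⟨hz, hzs⟩
  refine ⟨fun h => hz ?_, Metric.ball_subset_ball (by linarith [hΦ.radius_pos]) (hΦ.mapsTo hzs)⟩
  rw [← hΦ.right_inv z hzs]
  exact iterate_quad_mem h N

lemma green_inverseBranch {z : ℂ} (hz : z ∈ Metric.ball a s) :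
    green c ψ z = 2 ^ N * green c ψ (Φ z) := by
  rw [← hψ.green_quad_iterate, hΦ.right_inv z hz]

/-- Along a sequence of rays landing at `a`, each of which is the image of the next one, two of
the components of the basin near `a` coincide. -/
lemma exists_comp_eq {T : ℕ → Set ℂ} (hT : ∀ m, ∃ z, T m = connectedComponentIn (basinBall c a s) z)
    (hne : ∀ m, (T m).Nonempty) (hmap : ∀ m, MapsTo Φ (T m) (T (m + 1))) :
    ∃ i j, i < j ∧ T i = T j := by
  by_contra! hcon
  have hs := hΦ.radius_pos
  have hpi := Real.pi_pos
  have hTo : ∀ m, IsOpen (T m) := fun m => by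
    obtain ⟨z, hz⟩ := hT m
    rw [hz]
    exact (hψ.isOpen_basinBall a s).connectedComponentIn
  have hTsub : ∀ m, T m ⊆ basinBall c a s := fun m => by
    obtain ⟨z, hz⟩ := hT m
    rw [hz]
    exact connectedComponentIn_subset _ _
  have hdisj : Pairwise (Function.onFun Disjoint T) := by
    intro i j hij
    obtain ⟨z, hz⟩ := hT i
    obtain ⟨w, hw⟩ := hT j
    rcases comp_eq_or_disjoint (F := basinBall c a s) z w with h | h
    · rw [← hz, ← hw] at h
      rcases lt_or_gt_of_ne hij with hlt | hlt
      · exact absurd h (hcon i j hlt)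
      · exact absurd h.symm (hcon j i hlt)
    · change Disjoint (T i) (T j)
      rwa [hz, hw]
  -- Pairwise disjoint sets inside one disk have summable areas.
  have hvol : Tendsto (fun m => MeasureTheory.volume (T m)) atTop (𝓝 0) := by
    refine ENNReal.tendsto_atTop_zero_of_tsum_ne_top ?_
    rw [← MeasureTheory.measure_iUnion hdisj fun m => (hTo m).measurableSet]
    refine ne_top_of_le_ne_top (MeasureTheory.measure_ball_lt_top (x := a) (r := s)).ne
      (MeasureTheory.measure_mono (iUnion_subset fun m z hz => (hTsub m hz).2))
  obtain ⟨C, hC⟩ : ∃ C, ∀ z ∈ Metric.ball a s, green c ψ z ≤ C := by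
    obtain ⟨C, hC⟩ := (isCompact_closedBall a s).bddAbove_image hψ.continuous_green.continuousOn
    exact ⟨C, fun z hz => hC ⟨z, Metric.ball_subset_closedBall hz, rfl⟩⟩
  set M : ℕ → ℝ := fun m => sSup (green c ψ '' T m) with hM
  have hbdd : ∀ m, BddAbove (green c ψ '' T m) := fun m =>
    ⟨C, by rintro _ ⟨z, hz, rfl⟩; exact hC z (hTsub m hz).2⟩
  have hleM : ∀ m, ∀ z ∈ T m, green c ψ z ≤ M m := fun m z hz => le_csSup (hbdd m) ⟨z, hz, rfl⟩
  have hMpos : ∀ m, 0 < M m := fun m => by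
    obtain ⟨z, hz⟩ := hne m
    exact (hψ.green_pos (hTsub m hz).1).trans_le (hleM m z hz)
  have hMC : ∀ m, M m ≤ C := fun m => csSup_le ((hne m).image _) (by
    rintro _ ⟨z, hz, rfl⟩; exact hC z (hTsub m hz).2)
  -- Chosen so that `2 ^ N * κ = 1 / 2`.
  set κ : ℝ := (1 / 2) ^ (N + 1) with hκ
  obtain ⟨m₀, hm₀⟩ := eventually_atTop.1 (hvol.eventually (gt_mem_nhds
    (show (0 : ENNReal) < ENNReal.ofReal (s / 2 / 2 * (2 * Real.pi * κ) * (s / 2 / 2)) by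
      rw [ENNReal.ofReal_pos]; positivity)))
  -- A larger value at a point of the half disk would, by the area bound with `R = s / 2`, force the
  -- component to have more area than is left.
  have hnarrow : ∀ m, m₀ ≤ m → ∀ z ∈ T m, z ∈ Metric.ball a (s / 2) → green c ψ z ≤ κ * M m := by
    intro m hm z hz hzs
    by_contra! hlt
    have hball : Metric.ball z (s / 2) ⊆ Metric.ball a s := by
      refine Metric.ball_subset_ball' ?_
      rw [Metric.mem_ball] at hzs
      linarith
    have hcont : ContinuousOn ((T m).indicator (green c ψ)) (Metric.ball a s) := by
      obtain ⟨x, hx⟩ := hT m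
      rw [hx]
      exact hψ.continuousOn_indicator_green x
    have h1 := ofReal_le_volume_of_le_integral (hTo m) (v := (T m).indicator (green c ψ)) (z := z)
      (R := s / 2) (M := M m) (m := green c ψ z) (by positivity) (hMpos m)
      (fun x _ => indicator_le' (hleM m) (fun _ _ => (hMpos m).le) x)
      (fun x hx => indicator_of_notMem hx _) (hcont.mono hball) (fun r hr => by
        have := hψ.indicator_green_le_integral (hTo m) (fun x hx => (hTsub m hx).1) (z := z)
          (ρ := r) hr.1 (hcont.mono ((Metric.closedBall_subset_ball hr.2).trans hball))
        rwa [indicator_of_mem hz] at this)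
    refine absurd (h1.trans_lt (hm₀ m hm)) (not_lt.2 (ENNReal.ofReal_le_ofReal ?_))
    have : κ ≤ green c ψ z / M m := by
      rw [le_div_iff₀ (hMpos m)]
      exact hlt.le
    rw [mul_div_assoc]
    gcongr
  -- `Φ` carries `T m` into the half disk and divides the potential by `2 ^ N`, so the suprema at
  -- least double, although `C` bounds them all.
  have hdouble : ∀ m, m₀ ≤ m → 2 * M m ≤ M (m + 1) := by
    intro m hm
    have : M m ≤ M (m + 1) / 2 := by
      refine csSup_le ((hne m).image _) ?_
      rintro _ ⟨z, hz, rfl⟩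
      have hzs := (hTsub m hz).2
      have h1 := hnarrow (m + 1) (by omega) (Φ z) (hmap m hz) (hΦ.mapsTo hzs)
      rw [hψ.green_inverseBranch hΦ hzs]
      calc 2 ^ N * green c ψ (Φ z) ≤ 2 ^ N * (κ * M (m + 1)) := by gcongr
        _ = M (m + 1) / 2 := by
          rw [hκ, one_div, inv_pow, pow_succ]
          field_simp
    linarith
  have hgrow : ∀ n, 2 ^ n * M m₀ ≤ M (m₀ + n) := by
    intro n
    induction n with
    | zero => simp
    | succ n ih =>
      have := hdouble (m₀ + n) (by omega)
      rw [pow_succ, ← add_assoc]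
      linarith
  obtain ⟨n, hn⟩ := pow_unbounded_of_one_lt (C / M m₀) (by norm_num : (1 : ℝ) < 2)
  rw [div_lt_iff₀ (hMpos m₀)] at hn
  linarith [hgrow n, hMC (m₀ + n)]

end IsInverseBottcher
end Yoccoz

/-! ### Inverse branches as roots in the Böttcher coordinate -/

namespace Yoccoz

namespace IsInverseBottcher

variable {c : ℂ} {ψ : ℂ → ℂ} (hψ : IsInverseBottcher c ψ)
include hψ

variable {a : ℂ} {N : ℕ} {s : ℝ} {Φ : ℂ → ℂ} (hΦ : IsInverseBranch c a N s Φ)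
include hΦ

omit hψ in
lemma _root_.Yoccoz.IsInverseBranch.iterate_mapsTo (m : ℕ) :
    MapsTo Φ^[m] (basinBall c a s) (basinBall c a s) := by
  exact hΦ.mapsTo_basinBall.iterate m

omit hψ in
lemma _root_.Yoccoz.IsInverseBranch.iterate_continuousOn (m : ℕ) :
    ContinuousOn Φ^[m] (basinBall c a s) := by
  induction m with
  | zero => exact continuousOn_id
  | succ m ih =>
    rw [Function.iterate_succ']
    exact (hΦ.continuousOn.mono inter_subset_right).comp ih (hΦ.iterate_mapsTo m)

omit hψ in
lemma _root_.Yoccoz.IsInverseBranch.iterate_right_inv (m : ℕ) {z : ℂ} (hz : z ∈ basinBall c a s) :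
    (quad c)^[N * m] (Φ^[m] z) = z := by
  induction m with
  | zero => rfl
  | succ m ih =>
    rw [Nat.mul_succ, Function.iterate_add_apply, Function.iterate_succ_apply',
      hΦ.right_inv _ (hΦ.iterate_mapsTo m hz).2, ih]

omit hψ in
lemma _root_.Yoccoz.IsInverseBranch.iterate_left_inv (ha : quad c a = a) (m : ℕ) :
    ∀ᶠ z in 𝓝 a, Φ^[m] ((quad c)^[N * m] z) = z := by
  induction m with
  | zero => simp
  | succ m ih =>
    have hc : Tendsto (quad c)^[N] (𝓝 a) (𝓝 a) := by
      have := ((continuous_quad c).iterate N).tendsto a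
      rwa [Function.iterate_fixed ha] at this
    filter_upwards [hΦ.left_inv, hc.eventually ih] with z hz hz'
    rw [Nat.mul_succ, Function.iterate_add_apply (quad c), Function.iterate_succ_apply', hz', hz]

/-- The branches of the inverse in the Böttcher coordinate. -/
noncomputable def _root_.Yoccoz.IsInverseBranch.root (_ : IsInverseBranch c a N s Φ) (ψ : ℂ → ℂ)
    (m : ℕ) (w : ℂ) : ℂ := Function.invFunOn ψ {w | 1 < ‖w‖} (Φ^[m] (ψ w))

lemma root_spec (m : ℕ) {w : ℂ} (hw : 1 < ‖w‖) (hz : ψ w ∈ basinBall c a s) :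
    1 < ‖hΦ.root ψ m w‖ ∧ hΦ.root ψ m w ^ 2 ^ (N * m) = w := by
  have hK := (hΦ.iterate_mapsTo m hz).1
  have h1 := hψ.one_lt_norm_invFunOn hK
  refine ⟨h1, ?_⟩
  have h2 := hψ.iterate h1 (N * m)
  rw [hψ.apply_invFunOn hK, hΦ.iterate_right_inv m hz] at h2
  refine (hψ.injOn hw ?_ h2).symm
  rw [mem_ofPred_eq, norm_pow]
  exact one_lt_pow₀ h1 (by positivity)

lemma continuousOn_root (m : ℕ) :
    ContinuousOn (hΦ.root ψ m) {w | 1 < ‖w‖ ∧ ψ w ∈ basinBall c a s} := by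
  intro w hw
  have hK := (hΦ.iterate_mapsTo m hw.2).1
  have h1 : ContinuousOn (fun w => Φ^[m] (ψ w)) {w | 1 < ‖w‖ ∧ ψ w ∈ basinBall c a s} :=
    (hΦ.iterate_continuousOn m).comp (hψ.continuousOn.mono fun w hw => hw.1) fun w hw => hw.2
  exact ContinuousAt.comp_continuousWithinAt (f := fun w => Φ^[m] (ψ w))
    (hψ.continuousAt_invFunOn hK) (h1 w hw)

/-- Two continuous branches of the same root differ by a root of unity, which is constant on the
ball. -/
lemma root_ball (m : ℕ) {w₀ : ℂ} {δ : ℝ} (hδ : δ ≤ 1)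
    (hsub : Metric.ball w₀ δ ⊆ {w | 1 < ‖w‖ ∧ ψ w ∈ basinBall c a s}) {w : ℂ}
    (hw : w ∈ Metric.ball w₀ δ) :
    hΦ.root ψ m w =
      hΦ.root ψ m w₀ * Complex.exp (Complex.log (w / w₀) / ((2 ^ (N * m) : ℕ) : ℂ)) := by
  have hw0 : w₀ ∈ Metric.ball w₀ δ := Metric.mem_ball_self (Metric.pos_of_mem_ball hw)
  have h01 := (hsub hw0).1
  have hne : w₀ ≠ 0 := by rintro rfl; simp at h01; linarith
  have hn : ((2 ^ (N * m) : ℕ) : ℂ) ≠ 0 := by simp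
  have hslit : ∀ w ∈ Metric.ball w₀ δ, w / w₀ ∈ Complex.slitPlane := by
    intro w hw
    refine Complex.mem_slitPlane_of_norm_lt_one (z := w / w₀ - 1) ?_ |> fun h => by
      simpa using h
    rw [← div_self hne, ← sub_div, norm_div, div_lt_one (by linarith), ← dist_eq_norm]
    exact (Metric.mem_ball.1 hw).trans_le (hδ.trans h01.le)
  have hr0 : ∀ w ∈ Metric.ball w₀ δ, hΦ.root ψ m w ≠ 0 := fun w hw h => by
    have := (hψ.root_spec hΦ m (hsub hw).1 (hsub hw).2).1
    rw [h, norm_zero] at this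
    linarith
  set E : ℂ → ℂ := fun w => Complex.exp (Complex.log (w / w₀) / ((2 ^ (N * m) : ℕ) : ℂ)) with hE
  have hEc : ContinuousOn E (Metric.ball w₀ δ) := by
    refine Complex.continuous_exp.comp_continuousOn ?_
    exact ((continuousOn_id.div_const w₀).clog hslit).div_const _
  have hq := const_of_pow_eq_one (convex_ball w₀ δ).isPreconnected
    (q := fun w => hΦ.root ψ m w / (hΦ.root ψ m w₀ * E w)) (n := 2 ^ (N * m))
    (((hψ.continuousOn_root hΦ m).mono hsub).div (continuousOn_const.mul hEc) fun w hw =>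
      mul_ne_zero (hr0 w₀ hw0) (Complex.exp_ne_zero _)) (by positivity) (fun w hw => by
      have hwne : w ≠ 0 := fun h => by
        have := hslit w hw
        simp [h] at this
      rw [div_pow, mul_pow, (hψ.root_spec hΦ m (hsub hw).1 (hsub hw).2).2,
        (hψ.root_spec hΦ m (hsub hw0).1 (hsub hw0).2).2, hE]
      simp only
      rw [← Complex.exp_nat_mul, mul_div_cancel₀ _ hn,
        Complex.exp_log (div_ne_zero hwne hne), mul_div_cancel₀ _ hne, div_self hwne]) hw hw0
  have hE0 : E w₀ = 1 := by simp [hE, div_self hne]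
  change _ / _ = _ / _ at hq
  rw [hE0, mul_one, div_self (hr0 w₀ hw0), div_eq_one_iff_eq
    (mul_ne_zero (hr0 w₀ hw0) (Complex.exp_ne_zero _))] at hq
  exact hq

lemma tendsto_root_ball (hN : 0 < N) {w₀ : ℂ} {δ : ℝ} (hδ : δ ≤ 1)
    (hsub : Metric.ball w₀ δ ⊆ {w | 1 < ‖w‖ ∧ ψ w ∈ basinBall c a s}) {w : ℂ}
    (hw : w ∈ Metric.ball w₀ δ) :
    Tendsto (fun m => hΦ.root ψ m w - hΦ.root ψ m w₀) atTop (𝓝 0) := by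
  have hw0 : w₀ ∈ Metric.ball w₀ δ := Metric.mem_ball_self (Metric.pos_of_mem_ball hw)
  have hbound : ∀ m, ‖hΦ.root ψ m w₀‖ ≤ ‖w₀‖ := fun m => by
    have h := hψ.root_spec hΦ m (hsub hw0).1 (hsub hw0).2
    conv_rhs => rw [← h.2]
    rw [norm_pow]
    exact le_self_pow₀ h.1.le (by positivity)
  have hlim : Tendsto (fun m : ℕ => Complex.log (w / w₀) / ((2 ^ (N * m) : ℕ) : ℂ)) atTop (𝓝 0) := by
    refine tendsto_zero_iff_norm_tendsto_zero.2 ?_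
    have h2 : Tendsto (fun m : ℕ => (2 : ℝ) ^ (N * m)) atTop atTop :=
      (tendsto_pow_atTop_atTop_of_one_lt (by norm_num)).comp
        (tendsto_id.const_mul_atTop' hN)
    refine (h2.const_div_atTop ‖Complex.log (w / w₀)‖).congr fun m => ?_
    simp
  have hexp := (Complex.continuous_exp.tendsto 0).comp hlim
  rw [Complex.exp_zero] at hexp
  have h1 := (tendsto_iff_norm_sub_tendsto_zero.1 hexp).const_mul ‖w₀‖
  rw [mul_zero] at h1
  refine squeeze_zero_norm (fun m => ?_) h1
  rw [hψ.root_ball hΦ m hδ hsub hw, ← mul_sub_one, norm_mul]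
  exact mul_le_mul_of_nonneg_right (hbound m) (norm_nonneg _)

/-- On small balls the oscillation of the roots tends to zero; the relation spreads over the
connected preimage of the component by an open-closed argument. -/
lemma tendsto_root_comp (hN : 0 < N) {x w w' : ℂ} (hw1 : 1 < ‖w‖) (hw1' : 1 < ‖w'‖)
    (hw : ψ w ∈ connectedComponentIn (basinBall c a s) x)
    (hw' : ψ w' ∈ connectedComponentIn (basinBall c a s) x) :
    Tendsto (fun m => hΦ.root ψ m w' - hΦ.root ψ m w) atTop (𝓝 0) := by
  set T := connectedComponentIn (basinBall c a s) x
  have hTo : IsOpen T := (hψ.isOpen_basinBall a s).connectedComponentIn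
  have hTK : ∀ z ∈ T, z ∉ quadFilledJulia c := fun z hz => (connectedComponentIn_subset _ _ hz).1
  set W := {w : ℂ | 1 < ‖w‖} ∩ ψ ⁻¹' T with hW
  have hWo : IsOpen W := hψ.continuousOn.isOpen_inter_preimage
    (isOpen_lt continuous_const continuous_norm) hTo
  have hWsub : W ⊆ {w | 1 < ‖w‖ ∧ ψ w ∈ basinBall c a s} := fun w hw =>
    ⟨hw.1, connectedComponentIn_subset _ _ hw.2⟩
  have hWp : IsPreconnected W := by
    have : W = Function.invFunOn ψ {w | 1 < ‖w‖} '' T := by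
      ext w
      constructor
      · exact fun h => ⟨ψ w, h.2, hψ.invFunOn_apply h.1⟩
      · rintro ⟨z, hz, rfl⟩
        exact ⟨hψ.one_lt_norm_invFunOn (hTK z hz), by rwa [mem_preimage, hψ.apply_invFunOn (hTK z hz)]⟩
    rw [this]
    exact isPreconnected_connectedComponentIn.image _ fun z hz =>
      (hψ.continuousAt_invFunOn (hTK z hz)).continuousWithinAt
  have hball : ∀ y ∈ W, ∃ δ > 0, δ ≤ 1 ∧ Metric.ball y δ ⊆ W := fun y hy => by
    obtain ⟨δ, hδ, h⟩ := Metric.isOpen_iff.1 hWo y hy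
    exact ⟨min δ 1, by positivity, min_le_right _ _,
      (Metric.ball_subset_ball (min_le_left _ _)).trans h⟩
  set S := {y ∈ W | Tendsto (fun m => hΦ.root ψ m y - hΦ.root ψ m w) atTop (𝓝 0)} with hS
  have hrel : ∀ y ∈ W, ∃ δ > 0, Metric.ball y δ ⊆ W ∧ ∀ u ∈ Metric.ball y δ, u ∈ S ↔ y ∈ S := by
    intro y hy
    obtain ⟨δ, hδ, hδ1, hsub⟩ := hball y hy
    refine ⟨δ, hδ, hsub, fun u hu => ?_⟩
    have h := hψ.tendsto_root_ball hΦ hN hδ1 (hsub.trans hWsub) hu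
    constructor
    · rintro ⟨-, h'⟩
      refine ⟨hy, ?_⟩
      simpa using h'.sub h
    · rintro ⟨-, h'⟩
      refine ⟨hsub hu, ?_⟩
      simpa using h'.add h
  have hSo : IsOpen S := by
    rw [Metric.isOpen_iff]
    intro y hy
    obtain ⟨δ, hδ, -, h⟩ := hrel y hy.1
    exact ⟨δ, hδ, fun u hu => (h u hu).2 hy⟩
  have hsub : W ⊆ S := by
    refine hWp.subset_of_closure_inter_subset hSo ⟨w, ⟨hw1, hw⟩, ⟨hw1, hw⟩, by simp⟩ ?_
    rintro y ⟨hy, hyW⟩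
    obtain ⟨δ, hδ, -, h⟩ := hrel y hyW
    obtain ⟨u, hu, huS⟩ := mem_closure_iff_nhds.1 hy _ (Metric.ball_mem_nhds y hδ)
    exact (h u hu).1 huS
  exact (hsub ⟨hw1', hw'⟩).2

/-- Close to `a` the branch inverts the iterate exactly, so it follows the ray `ζ`; along the rest
of the ray it can differ only by a constant root of unity. -/
lemma root_ray (ha : quad c a = a) (m : ℕ) {θ ζ : Circle}
    (hζ : ζ ∈ landingAngles ψ a) (hζθ : ζ ^ 2 ^ (N * m) = θ) {r : ℝ}
    (hr : ∀ t ∈ Ioo 1 r, ψ (t * θ) ∈ basinBall c a s) {t : ℝ} (ht : t ∈ Ioo 1 r) :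
    hΦ.root ψ m (t * θ) = (t ^ (((2 ^ (N * m) : ℕ) : ℝ)⁻¹) : ℝ) * ζ := by
  set n := 2 ^ (N * m) with hn
  have hn0 : 0 < n := by positivity
  have hpow : ∀ u : ℝ, 1 < u → (u ^ ((n : ℝ)⁻¹)) ^ n = u := fun u hu =>
    Real.rpow_inv_natCast_pow (by linarith) hn0.ne'
  have hone : ∀ u : ℝ, 1 < u → 1 < u ^ ((n : ℝ)⁻¹) := fun u hu =>
    Real.one_lt_rpow hu (by positivity)
  have hr1 : 1 < r := ht.1.trans ht.2
  have hev : ∀ᶠ u : ℝ in 𝓝[>] 1, hΦ.root ψ m (u * θ) = (u ^ ((n : ℝ)⁻¹) : ℝ) * ζ := by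
    have h1 := (show Tendsto _ _ _ from hζ).comp (tendsto_rpow_inv n hn0)
    filter_upwards [h1.eventually (hΦ.iterate_left_inv ha m), self_mem_nhdsWithin] with u hu hu1
    simp only [Function.comp] at hu
    rw [hψ.iterate_ray (hone u hu1), ← hn, hpow u hu1, hζθ] at hu
    rw [IsInverseBranch.root, hu, hψ.invFunOn_apply (one_lt_norm_mul (hone u hu1) ζ)]
  obtain ⟨u, hu, hur⟩ := (hev.and (Ioo_mem_nhdsGT hr1)).exists
  have hne : ∀ u : ℝ, 1 < u → ((u ^ ((n : ℝ)⁻¹) : ℝ) : ℂ) * ζ ≠ 0 := fun u hu =>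
    mul_ne_zero (by exact_mod_cast (by linarith [hone u hu] : u ^ ((n : ℝ)⁻¹) ≠ 0)) ζ.coe_ne_zero
  have hq := const_of_pow_eq_one (isPreconnected_Ioo (a := (1 : ℝ)) (b := r))
    (q := fun u : ℝ => hΦ.root ψ m (u * θ) / ((u ^ ((n : ℝ)⁻¹) : ℝ) * ζ)) (n := n)
    (ContinuousOn.div ((hψ.continuousOn_root hΦ m).comp (by fun_prop) fun u hu =>
      ⟨one_lt_norm_mul hu.1 θ, hr u hu⟩) (by
        refine ContinuousOn.mul ?_ continuousOn_const
        refine Complex.continuous_ofReal.comp_continuousOn ?_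
        exact continuousOn_id.rpow_const fun u hu => Or.inl (by have := hu.1; simp; linarith))
      fun u hu => hne u hu.1) hn0 (fun u hu => by
        have h2 : (ζ : ℂ) ^ n = θ := by rw [← hζθ, hn]; simp
        rw [div_pow, (hψ.root_spec hΦ m (one_lt_norm_mul hu.1 θ) (hr u hu)).2, mul_pow, h2,
          ← Complex.ofReal_pow, hpow u hu.1, div_self]
        exact mul_ne_zero (by exact_mod_cast (by linarith [hu.1] : u ≠ 0)) θ.coe_ne_zero) ht hur
  change _ / _ = _ / _ at hq
  rw [hu, div_self (hne u hur.1), div_eq_one_iff_eq (hne t ht.1)] at hq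
  exact hq

/-- Among the rays landing at the fixed point `a` there are rays which are almost invariant under
an iterate of the angle doubling. -/
lemma exists_tendsto_angles (ha : quad c a = a) (hN : 0 < N) {θ : ℕ → Circle}
    (hθ : ∀ m, θ m ∈ landingAngles ψ a) (hsq : ∀ m, θ (m + 1) ^ 2 ^ N = θ m) :
    ∃ i j, i < j ∧ Tendsto (fun m => (θ (i + m) : ℂ) - θ (j + m)) atTop (𝓝 0) := by
  have hpow : ∀ i m, θ (i + m) ^ 2 ^ (N * m) = θ i := by
    intro i m
    induction m with
    | zero => simp
    | succ m ih =>
      rw [Nat.mul_succ, add_comm (N * m) N, pow_add, pow_mul, ← add_assoc, hsq, ih]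
  choose z r hr hz using fun m => hψ.exists_tail_comp hΦ.radius_pos (hθ m)
  set T : ℕ → Set ℂ := fun m => connectedComponentIn (basinBall c a s) (z m) with hT
  have hmap : ∀ m, MapsTo Φ (T m) (T (m + 1)) := by
    intro m
    rw [mapsTo_iff_image_subset]
    have hsub : T m ⊆ basinBall c a s := connectedComponentIn_subset _ _
    refine subset_comp (isPreconnected_connectedComponentIn.image _
      ((hΦ.continuousOn.mono inter_subset_right).mono hsub))
      (mapsTo_iff_image_subset.1 (hΦ.mapsTo_basinBall.mono_left hsub)) ?_
    have h1 : Tendsto (fun t : ℝ => t ^ 2 ^ N) (𝓝[>] 1) (𝓝[>] 1) := by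
      refine tendsto_nhdsWithin_iff.2 ⟨?_, ?_⟩
      · have := ((continuous_pow (2 ^ N) : Continuous fun r : ℝ => r ^ 2 ^ N).tendsto 1)
        rw [one_pow] at this
        exact this.mono_left nhdsWithin_le_nhds
      · filter_upwards [self_mem_nhdsWithin] with t ht
        exact one_lt_pow₀ (mem_Ioi.1 ht) (by positivity)
    obtain ⟨t, ⟨ht1, ht2⟩, ht3⟩ :=
      ((((show Tendsto _ _ _ from hθ (m + 1)).eventually hΦ.left_inv).and
      (Ioo_mem_nhdsGT (hr (m + 1)))).and (h1.eventually (Ioo_mem_nhdsGT (hr m)))).exists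
    rw [hψ.iterate_ray ht2.1, hsq] at ht1
    exact ⟨ψ (t * θ (m + 1)), ⟨_, hz m _ ht3, ht1⟩, hz (m + 1) t ht2⟩
  obtain ⟨i, j, hij, hTij⟩ := hψ.exists_comp_eq hΦ (T := T) (fun m => ⟨z m, rfl⟩)
    (fun m => ⟨_, hz m ((1 + r m) / 2) ⟨by linarith [hr m], by linarith [hr m]⟩⟩) hmap
  refine ⟨i, j, hij, ?_⟩
  set t := (1 + min (r i) (r j)) / 2 with ht
  have hmin : 1 < min (r i) (r j) := lt_min (hr i) (hr j)
  have hti : t ∈ Ioo 1 (r i) := ⟨by linarith, by linarith [min_le_left (r i) (r j)]⟩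
  have htj : t ∈ Ioo 1 (r j) := ⟨by linarith, by linarith [min_le_right (r i) (r j)]⟩
  have hbasin : ∀ m, ∀ u ∈ Ioo 1 (r m), ψ (u * θ m) ∈ basinBall c a s := fun m u hu =>
    connectedComponentIn_subset _ _ (hz m u hu)
  have hlim := hψ.tendsto_root_comp hΦ hN (x := z i) (one_lt_norm_mul htj.1 (θ j))
    (one_lt_norm_mul hti.1 (θ i)) (by
      have := hz j t htj
      change _ ∈ T j at this
      rwa [← hTij] at this) (hz i t hti)
  -- Both roots are taken at the same potential `t`, so their common modulus factors out, and it is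
  -- at least one.
  refine squeeze_zero_norm (fun m => ?_) (tendsto_zero_iff_norm_tendsto_zero.1 hlim)
  rw [hψ.root_ray hΦ ha m (hθ (i + m)) (hpow i m) (hbasin i) hti,
    hψ.root_ray hΦ ha m (hθ (j + m)) (hpow j m) (hbasin j) htj, ← mul_sub, norm_mul]
  refine le_mul_of_one_le_left (norm_nonneg _) ?_
  rw [Complex.norm_real]
  exact (Real.one_le_rpow hti.1.le (by positivity)).trans (le_abs_self _)

end IsInverseBottcher
end Yoccoz

namespace Yoccoz

/-! ### Invariant sets of angle doubling in a half circle -/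

/-- Let `S` be a set of directions in a closed half circle, invariant under angle doubling. If
`S` contains a point of period `k`, then each point of `S` is mapped to a point of period `k` by
an iterate of the doubling. -/
lemma exists_pow_fixed_of_halfCircle {S : Set Circle} {ζ₀ : Circle}
    (hS : ∀ ζ ∈ S, ∃ x ∈ Icc 0 Real.pi, ζ = ζ₀ * Circle.exp x) (hsq : ∀ ζ ∈ S, ζ ^ 2 ∈ S)
    {q : Circle} (hq : q ∈ S) {k : ℕ} (hqk : q ^ 2 ^ k = q) {ζ : Circle}
    (hζ : ζ ∈ S) : ∃ n, (ζ ^ 2 ^ (k * n)) ^ 2 ^ k = ζ ^ 2 ^ (k * n) := by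
  have hpi := Real.pi_pos
  obtain ⟨τ, -, hτ⟩ := exists_angle ζ₀ (ζ₀ ^ 2)
  set X : Set ℝ := {x | ζ₀ * Circle.exp x ∈ S} with hX
  set fl : ℝ → ℤ := fun x => ⌊x / (2 * Real.pi)⌋ with hfl
  have hfl1 : ∀ x, 0 ≤ x - fl x * (2 * Real.pi) ∧ x - fl x * (2 * Real.pi) < 2 * Real.pi := by
    intro x
    have h1 := Int.floor_le (x / (2 * Real.pi))
    have h2 := Int.lt_floor_add_one (x / (2 * Real.pi))
    rw [le_div_iff₀ (by positivity)] at h1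
    rw [div_lt_iff₀ (by positivity)] at h2
    exact ⟨by simp only [hfl]; linarith, by simp only [hfl]; linarith⟩
  have hflX : ∀ x ∈ X, x - fl x * (2 * Real.pi) ≤ Real.pi := by
    intro x hx
    obtain ⟨y, hy, hxy⟩ := hS _ hx
    have h : x - fl x * (2 * Real.pi) = y := by
      refine circle_exp_inj (θ := ζ₀) (hfl1 x).1 (hfl1 x).2 hy.1 (by linarith [hy.2]) ?_
      rw [← hxy, Circle.periodic_exp.sub_int_mul_eq]
    rw [h]
    exact hy.2
  have hmono : ∀ x y, x ≤ y → fl x ≤ fl y := fun x y h =>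
    Int.floor_le_floor (by gcongr)
  -- A lift of doubling in the coordinate `ζ₀ * exp (i x)`, lowered by one turn for each full turn
  -- already made, so that it commutes with the shift by `2π`. It is monotone on `X` because the
  -- points of `X` leave gaps of length at least `π`, which doubling stretches to at least a full
  -- turn.
  set G : ℝ → ℝ := fun x => 2 * x + τ - fl x * (2 * Real.pi) with hG
  have hGexp : ∀ x, ζ₀ * Circle.exp (G x) = (ζ₀ * Circle.exp x) ^ 2 := by
    intro x
    rw [hG]
    simp only
    rw [Circle.periodic_exp.sub_int_mul_eq, Circle.exp_add, mul_pow, hτ, two_mul, Circle.exp_add, sq]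
    ac_rfl
  have hGX : ∀ x ∈ X, G x ∈ X := fun x hx => by
    rw [hX, mem_ofPred_eq, hGexp]
    exact hsq _ hx
  have hGmono : ∀ x ∈ X, ∀ y ∈ X, x ≤ y → G x ≤ G y := by
    intro x hx y hy hxy
    rcases (hmono x y hxy).eq_or_lt with h | h
    · simp only [hG, h]; linarith
    · have h' : (fl x : ℝ) + 1 ≤ fl y := by exact_mod_cast h
      simp only [hG]
      nlinarith [hflX x hx, (hfl1 y).1]
  have hGshift : ∀ x, G (x + 2 * Real.pi) = G x + 2 * Real.pi := by
    intro x
    have : fl (x + 2 * Real.pi) = fl x + 1 := by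
      simp only [hfl]
      rw [add_div, div_self (by positivity), Int.floor_add_one]
    simp only [hG, this]
    push_cast
    ring
  have hGexpand : ∀ x ∈ X, ∀ y ∈ X, x ≤ y → y - x < Real.pi → G y - G x = 2 * (y - x) := by
    intro x hx y hy hxy hlt
    rcases (hmono x y hxy).eq_or_lt with h | h
    · simp only [hG, h]; ring
    · have h' : (fl x : ℝ) + 1 ≤ fl y := by exact_mod_cast h
      nlinarith [hflX x hx, (hfl1 y).1]
  have hGabs : ∀ x ∈ X, ∀ y ∈ X, |y - x| < Real.pi → |G y - G x| = 2 * |y - x| := by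
    intro x hx y hy hlt
    rcases le_total x y with h | h
    · rw [abs_of_nonneg (sub_nonneg.2 h)] at hlt ⊢
      rw [hGexpand x hx y hy h hlt, abs_of_nonneg (by linarith)]
    · rw [abs_sub_comm, abs_of_nonneg (sub_nonneg.2 h)] at hlt
      rw [abs_sub_comm, abs_sub_comm y x, hGexpand y hy x hx h hlt, abs_of_nonneg (by linarith),
        abs_of_nonneg (by linarith)]
  have hitX : ∀ j, ∀ x ∈ X, G^[j] x ∈ X := fun j x hx => by
    induction j with
    | zero => exact hx
    | succ j ih => rw [Function.iterate_succ_apply']; exact hGX _ ih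
  have hitexp : ∀ j x, ζ₀ * Circle.exp (G^[j] x) = (ζ₀ * Circle.exp x) ^ 2 ^ j := fun j x => by
    induction j with
    | zero => simp
    | succ j ih => rw [Function.iterate_succ_apply', hGexp, ih, pow_succ 2, pow_mul]
  have hitmono : ∀ j, ∀ x ∈ X, ∀ y ∈ X, x ≤ y → G^[j] x ≤ G^[j] y := fun j x hx y hy h => by
    induction j with
    | zero => exact h
    | succ j ih =>
      rw [Function.iterate_succ_apply', Function.iterate_succ_apply']
      exact hGmono _ (hitX j x hx) _ (hitX j y hy) ih
  have hitshift : ∀ j x, G^[j] (x + 2 * Real.pi) = G^[j] x + 2 * Real.pi := fun j x => by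
    induction j with
    | zero => rfl
    | succ j ih => rw [Function.iterate_succ_apply', ih, hGshift, Function.iterate_succ_apply']
  have hitabs : ∀ x ∈ X, ∀ y ∈ X, 2 ^ k * |y - x| < Real.pi →
      ∀ j ≤ k, |G^[j] y - G^[j] x| = 2 ^ j * |y - x| := by
    intro x hx y hy hlt j hj
    induction j with
    | zero => simp
    | succ j ih =>
      have ih' := ih (by omega)
      rw [Function.iterate_succ_apply', Function.iterate_succ_apply',
        hGabs _ (hitX j x hx) _ (hitX j y hy), ih', pow_succ]
      · ring
      · rw [ih']
        refine lt_of_le_of_lt ?_ hlt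
        gcongr
        · norm_num
        · omega
  obtain ⟨b, -, hb⟩ := hS q hq
  have hbX : b ∈ X := by rw [hX, mem_ofPred_eq, ← hb]; exact hq
  obtain ⟨l, hl⟩ : ∃ l : ℤ, G^[k] b = b + l * (2 * Real.pi) := by
    refine Circle.exp_eq_exp.1 (mul_left_cancel (a := ζ₀) ?_)
    rw [hitexp, ← hb, hqk]
  -- The lift of the `k`-th iterate normalized to fix `b`, hence also `b + 2π`; orbits starting
  -- between them are therefore monotone and bounded.
  set H : ℝ → ℝ := fun x => G^[k] x - l * (2 * Real.pi) with hH
  have hHexp : ∀ x, ζ₀ * Circle.exp (H x) = (ζ₀ * Circle.exp x) ^ 2 ^ k := fun x => by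
    rw [← hitexp, hH]
    simp only
    rw [Circle.periodic_exp.sub_int_mul_eq]
  have hHX : ∀ x ∈ X, H x ∈ X := fun x hx => by
    have : ζ₀ * Circle.exp (H x) = ζ₀ * Circle.exp (G^[k] x) := by rw [hHexp, hitexp]
    rw [hX, mem_ofPred_eq, this]
    exact hitX k x hx
  have hHmono : ∀ x ∈ X, ∀ y ∈ X, x ≤ y → H x ≤ H y := fun x hx y hy h =>
    sub_le_sub_right (hitmono k x hx y hy h) _
  have hb2X : b + 2 * Real.pi ∈ X := by
    rw [hX, mem_ofPred_eq, Circle.periodic_exp b, ← hb]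
    exact hq
  have hHb : H b = b := by simp only [hH, hl]; ring
  have hHb2 : H (b + 2 * Real.pi) = b + 2 * Real.pi := by
    simp only [hH, hitshift, hl]; ring
  obtain ⟨t, ht, hζt⟩ := exists_angle q ζ
  set s : ℕ → ℝ := fun n => H^[n] (b + t) with hs
  have hs_succ : ∀ n, s (n + 1) = H (s n) := fun n => by
    simp only [hs, Function.iterate_succ_apply']
  have hsexp : ∀ n, ζ₀ * Circle.exp (s n) = ζ ^ 2 ^ (k * n) := by
    intro n
    induction n with
    | zero =>
      simp only [hs, Function.iterate_zero, id, mul_zero, pow_zero, pow_one]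
      rw [Circle.exp_add, ← mul_assoc, ← hb, hζt]
    | succ n ih => rw [hs_succ, hHexp, ih, ← pow_mul, ← pow_add, Nat.mul_succ]
  have hsX : ∀ n, s n ∈ X ∧ s n ∈ Icc b (b + 2 * Real.pi) := by
    intro n
    induction n with
    | zero =>
      refine ⟨?_, ?_, ?_⟩
      · rw [hX, mem_ofPred_eq, hsexp]
        simpa using hζ
      · simp only [hs, Function.iterate_zero, id]; linarith [ht.1]
      · simp only [hs, Function.iterate_zero, id]; linarith [ht.2]
    | succ n ih =>
      rw [hs_succ]
      refine ⟨hHX _ ih.1, ?_, ?_⟩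
      · have := hHmono _ hbX _ ih.1 ih.2.1
        rwa [hHb] at this
      · have := hHmono _ ih.1 _ hb2X ih.2.2
        rwa [hHb2] at this
  obtain ⟨x, hx⟩ : ∃ x, Tendsto s atTop (𝓝 x) := by
    rcases le_total (s 0) (s 1) with h | h
    · have hm : Monotone s := by
        refine monotone_nat_of_le_succ fun n => ?_
        induction n with
        | zero => exact h
        | succ n ih =>
          rw [hs_succ n, hs_succ (n + 1)]
          exact hHmono _ (hsX n).1 _ (hsX _).1 ih
      exact ⟨_, tendsto_atTop_ciSup hm ⟨b + 2 * Real.pi, by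
        rintro _ ⟨n, rfl⟩; exact (hsX n).2.2⟩⟩
    · have hm : Antitone s := by
        refine antitone_nat_of_succ_le fun n => ?_
        induction n with
        | zero => exact h
        | succ n ih =>
          rw [hs_succ n, hs_succ (n + 1)]
          exact hHmono _ (hsX _).1 _ (hsX n).1 ih
      exact ⟨_, tendsto_atTop_ciInf hm ⟨b, by
        rintro _ ⟨n, rfl⟩; exact (hsX n).2.1⟩⟩
  have hd : Tendsto (fun n => |s (n + 1) - s n|) atTop (𝓝 0) := by
    simpa using ((hx.comp (tendsto_add_atTop_nat 1)).sub hx).abs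
  have hsmall : ∀ᶠ n in atTop, |s (n + 1) - s n| < Real.pi / 2 ^ k :=
    hd.eventually (gt_mem_nhds (by positivity))
  obtain ⟨n₀, hn₀⟩ := eventually_atTop.1 hsmall
  -- `H` does not shorten small steps, while the steps of a convergent sequence tend to zero; so
  -- they vanish from `n₀` on.
  have hle : ∀ n, |s (n₀ + 1) - s n₀| ≤ |s (n₀ + n + 1) - s (n₀ + n)| := by
    intro n
    induction n with
    | zero => rfl
    | succ n ih =>
      refine ih.trans ?_
      have h1 := hn₀ (n₀ + n) (by omega)
      rw [lt_div_iff₀ (by positivity), mul_comm] at h1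
      have h2 := hitabs _ (hsX (n₀ + n)).1 _ (hsX (n₀ + n + 1)).1 h1 k le_rfl
      have h3 : s (n₀ + (n + 1) + 1) - s (n₀ + (n + 1)) =
          G^[k] (s (n₀ + n + 1)) - G^[k] (s (n₀ + n)) := by
        rw [← add_assoc, hs_succ (n₀ + n + 1)]
        nth_rw 2 [hs_succ (n₀ + n)]
        simp only [hH]
        ring
      rw [h3, h2]
      exact le_mul_of_one_le_left (abs_nonneg _) (one_le_pow₀ (by norm_num))
  have hzero : |s (n₀ + 1) - s n₀| ≤ 0 := by
    refine ge_of_tendsto (hd.comp (tendsto_add_atTop_nat n₀)) (Eventually.of_forall fun n => ?_)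
    have := hle n
    rwa [add_comm n₀ n] at this
  have heq : s (n₀ + 1) = s n₀ := sub_eq_zero.1 (abs_nonpos_iff.1 hzero)
  refine ⟨n₀, ?_⟩
  rw [← hsexp, ← hHexp, ← hs_succ, heq]

namespace IsInverseBottcher

variable {c : ℂ} {ψ : ℂ → ℂ} (hψ : IsInverseBottcher c ψ)
include hψ

/-- The directions of the rays at `a` are not linked with the opposite directions. -/
lemma landing_unlinked {a : ℂ} (ha : quad c a = a) (ha0 : a ≠ 0) {ζ : Circle} {φ y : ℝ}
    (hζ : ζ ∈ landingAngles ψ a) (hφ0 : 0 < φ) (hφ : φ < Real.pi)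
    (hφA : ζ * Circle.exp φ ∈ landingAngles ψ a) (hy0 : Real.pi < y) (hy : y < Real.pi + φ) :
    ζ * Circle.exp y ∉ landingAngles ψ a := by
  intro hyA
  have haK := mem_quadFilledJulia_of_fixed ha
  have hnaK := neg_mem_quadFilledJulia.2 haK
  have hna : -a ≠ a := fun h => ha0 (neg_eq_self.1 h)
  have hexp : ∀ u : ℝ, -(ζ * Circle.exp u) = ζ * Circle.exp (u - Real.pi) := by
    intro u
    refine Circle.ext ?_
    simp only [Circle.coe_neg, Circle.coe_mul, Circle.coe_exp]
    push_cast
    rw [sub_mul, Complex.exp_sub, Complex.exp_pi_mul_I]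
    ring
  have hdisj : ∀ ξ ∈ landingAngles ψ a, ∀ η ∈ landingAngles ψ a,
      Disjoint (closedRay ψ (-a) (-η)) (closedRay ψ a ξ) := by
    intro ξ hξ η hη
    refine disjoint_left.2 ?_
    rintro _ (rfl | ⟨r, hr, rfl⟩) h
    · rcases h with h | ⟨r, hr, h⟩
      · exact hna h
      · exact hψ.notMem (one_lt_norm_mul hr ξ) ((show ψ (r * ξ) = -a from h) ▸ hnaK)
    · have := (hψ.ray_mem_closedRay haK hr).1 h
      exact hψ.landing_neg_notMem ha0 hη (this ▸ hξ)
  -- The rays at `-a` opposite to `ζ` and `ζ e^{iy}` form a connected set disjoint from the rays at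
  -- `a`. Its directions, at angles `π` and `y - π` from `ζ`, lie on different sides of the pair.
  refine hψ.separation ha0 haK hφ0 (by linarith) hζ hφA
    (C := closedRay ψ (-a) (-(ζ * Circle.exp y)) ∪ closedRay ψ (-a) (-ζ))
    (IsPreconnected.union (-a) (Or.inl rfl) (Or.inl rfl)
      (hψ.isPreconnected_closedRay (hψ.landing_neg hyA))
      (hψ.isPreconnected_closedRay (hψ.landing_neg hζ)))
    (disjoint_union_left.2 ⟨hdisj _ hζ _ hyA, hdisj _ hζ _ hζ⟩)
    (disjoint_union_left.2 ⟨hdisj _ hφA _ hyA, hdisj _ hφA _ hζ⟩) ?_ ?_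
  · refine ⟨ψ ((2 : ℝ) * (-(ζ * Circle.exp y) : Circle)),
      Or.inl (Or.inr ⟨2, by norm_num, rfl⟩), (2, y - Real.pi), ⟨by norm_num, ?_, ?_⟩, ?_⟩
    · simp only; linarith
    · simp only; linarith
    · simp only [hexp]
  · refine ⟨ψ ((2 : ℝ) * (-ζ : Circle)),
      Or.inr (Or.inr ⟨2, by norm_num, rfl⟩), (2, Real.pi), ⟨by norm_num, hφ, ?_⟩, ?_⟩
    · simp only; linarith
    · have := hexp (2 * Real.pi)
      rw [Circle.exp_two_pi, mul_one] at this
      rw [this]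
      ring_nf

/-- The directions of the rays landing at `a` lie in a half circle. -/
lemma exists_halfCircle {a : ℂ} (ha : quad c a = a) (ha0 : a ≠ 0) :
    ∃ ζ₀ : Circle, ∀ ζ ∈ landingAngles ψ a, ∃ x ∈ Icc 0 Real.pi, ζ = ζ₀ * Circle.exp x := by
  rcases (landingAngles ψ a).eq_empty_or_nonempty with h | ⟨ζ, hζ⟩
  · exact ⟨1, by simp [h]⟩
  have hpi := Real.pi_pos
  -- The angles below `π` by which landing directions precede `ζ`; turning back by their supremum
  -- gives the initial point of the half circle.
  set X : Set ℝ := {x ∈ Ico 0 Real.pi | ζ * Circle.exp (-x) ∈ landingAngles ψ a} with hX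
  have h0X : (0 : ℝ) ∈ X := ⟨⟨le_rfl, hpi⟩, by simpa using hζ⟩
  have hbdd : BddAbove X := ⟨Real.pi, fun x hx => hx.1.2.le⟩
  have hm0 : 0 ≤ sSup X := le_csSup hbdd h0X
  refine ⟨ζ * Circle.exp (-sSup X), fun η hη => ?_⟩
  have hadd : ∀ u : ℝ, ζ * Circle.exp (-sSup X) * Circle.exp (u + sSup X) = ζ * Circle.exp u := by
    intro u
    rw [mul_assoc, ← Circle.exp_add]
    ring_nf
  obtain ⟨t, ht, rfl⟩ := exists_angle ζ η
  rcases lt_trichotomy t Real.pi with hlt | rfl | hgt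
  · refine ⟨t + sSup X, ⟨by linarith [ht.1], ?_⟩, (hadd t).symm⟩
    have : sSup X ≤ Real.pi - t := by
      refine csSup_le ⟨0, h0X⟩ fun x hx => ?_
      by_contra! hcon
      -- A direction ahead by `t` and one behind by `x` with `t + x > π` would be linked with their
      -- opposites.
      refine hψ.landing_unlinked ha ha0 hζ (φ := t) (y := 2 * Real.pi - x) ?_ hlt hη ?_ ?_ ?_
      · linarith [hx.1.2]
      · linarith [hx.1.2]
      · linarith
      · have : 2 * Real.pi - x = -x + 2 * Real.pi := by ring
        rw [this, Circle.periodic_exp]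
        exact hx.2
    linarith
  · exfalso
    refine hψ.landing_neg_notMem ha0 hζ ?_
    have : ζ * Circle.exp Real.pi = -ζ := by
      refine Circle.ext ?_
      simp [Circle.coe_exp, Complex.exp_pi_mul_I]
    rwa [← this]
  · have hx : 2 * Real.pi - t ∈ X := by
      refine ⟨⟨by linarith [ht.2], by linarith⟩, ?_⟩
      have : -(2 * Real.pi - t) = t - 2 * Real.pi := by ring
      rw [this, Circle.periodic_exp.sub_eq]
      exact hη
    have h1 := le_csSup hbdd hx
    refine ⟨t - 2 * Real.pi + sSup X, ⟨by linarith, ?_⟩, ?_⟩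
    · have : sSup X ≤ Real.pi := csSup_le ⟨0, h0X⟩ fun x hx => hx.1.2.le
      linarith [ht.2]
    · rw [hadd, Circle.periodic_exp.sub_eq]

/-- The angle doubling has a periodic point in the closure of the set of directions of the rays
landing at a repelling fixed point. -/
lemma exists_periodic_mem_closure {a : ℂ} (ha : quad c a = a) (ha0 : a ≠ 0) {N : ℕ} (hN : 0 < N)
    {s : ℝ} {Φ : ℂ → ℂ} (hΦ : IsInverseBranch c a N s Φ) (hne : (landingAngles ψ a).Nonempty) :
    ∃ k, 0 < k ∧ ∃ q ∈ closure (landingAngles ψ a), q ^ 2 ^ k = q := by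
  obtain ⟨θ₀, hθ₀⟩ := hne
  choose! pre hpre hpre' using fun ζ (hζ : ζ ∈ landingAngles ψ a) =>
    hψ.exists_landing_pow_eq ha ha0 N hζ
  set θ : ℕ → Circle := fun m => pre^[m] θ₀ with hθ
  have hθA : ∀ m, θ m ∈ landingAngles ψ a := by
    intro m
    induction m with
    | zero => exact hθ₀
    | succ m ih => simp only [hθ, Function.iterate_succ_apply']; exact hpre _ ih
  have hθs : ∀ m, θ (m + 1) ^ 2 ^ N = θ m := fun m => by
    have := hpre' _ (hθA m)
    simp only [hθ, Function.iterate_succ_apply'] at this ⊢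
    exact this
  obtain ⟨i, j, hij, hlim⟩ := hψ.exists_tendsto_angles hΦ ha hN hθA hθs
  set k := N * (j - i) with hk
  have hk0 : 0 < k := Nat.mul_pos hN (by omega)
  have hpow : ∀ i m, θ (i + m) ^ 2 ^ (N * m) = θ i := by
    intro i m
    induction m with
    | zero => simp
    | succ m ih => rw [Nat.mul_succ, add_comm (N * m) N, pow_add, pow_mul, ← add_assoc, hθs, ih]
  -- Doubling `k` times takes `θ (j + m)` to `θ (i + m)`, and the two sequences are asymptotic, so
  -- every limit point is fixed by this iterate.
  obtain ⟨q, -, φ, hφ, hq⟩ := isCompact_univ.tendsto_subseq (x := fun m => θ (j + m))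
    fun _ => mem_univ _
  have hqc : q ∈ closure (landingAngles ψ a) :=
    mem_closure_of_tendsto hq (Eventually.of_forall fun m => hθA _)
  have hqk : q ^ 2 ^ k = q := by
    refine Circle.ext ?_
    have h1 : Tendsto (fun m => ((θ (j + φ m) : Circle) : ℂ)) atTop (𝓝 q) :=
      (continuous_subtype_val.tendsto q).comp hq
    have h2 : Tendsto (fun m => ((θ (i + φ m) : Circle) : ℂ)) atTop (𝓝 q) := by
      simpa using (hlim.comp hφ.tendsto_atTop).add h1
    have h3 := h1.pow (2 ^ k)
    refine tendsto_nhds_unique ?_ h2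
    rw [Circle.coe_pow]
    refine h3.congr fun m => ?_
    rw [← Circle.coe_pow]
    congr 1
    have := hpow (i + φ m) (j - i)
    rw [← hk] at this
    rw [← this]
    congr 2
    omega
  exact ⟨k, hk0, q, hqc, hqk⟩

/-- The rays landing at a repelling fixed point have a common period. -/
theorem exists_common_period {a : ℂ} (ha : quad c a = a) (ha0 : a ≠ 0) {N : ℕ} (hN : 0 < N)
    {s : ℝ} {Φ : ℂ → ℂ} (hΦ : IsInverseBranch c a N s Φ) :
    ∃ p, 0 < p ∧ ∀ ζ ∈ landingAngles ψ a, ζ ^ 2 ^ p = ζ := by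
  rcases (landingAngles ψ a).eq_empty_or_nonempty with h | hne
  · exact ⟨1, one_pos, by simp [h]⟩
  obtain ⟨k, hk0, q, hqc, hqk⟩ := hψ.exists_periodic_mem_closure ha ha0 hN hΦ hne
  obtain ⟨ζ₀, hζ₀⟩ := hψ.exists_halfCircle ha ha0
  have hhalf : ∀ ζ ∈ closure (landingAngles ψ a), ∃ x ∈ Icc 0 Real.pi, ζ = ζ₀ * Circle.exp x := by
    have hcl : IsClosed ((fun x : ℝ => ζ₀ * Circle.exp x) '' Icc 0 Real.pi) :=
      (isCompact_Icc.image (by fun_prop)).isClosed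
    intro ζ hζ
    obtain ⟨x, hx, h⟩ := closure_minimal (fun ζ hζ => by
      obtain ⟨x, hx, h⟩ := hζ₀ ζ hζ
      exact ⟨x, hx, h.symm⟩) hcl hζ
    exact ⟨x, hx, h.symm⟩
  have hsq : ∀ ζ ∈ closure (landingAngles ψ a), ζ ^ 2 ∈ closure (landingAngles ψ a) :=
    fun ζ hζ => map_mem_closure (f := fun ζ : Circle => ζ ^ 2) (continuous_pow 2) hζ
      fun ξ hξ => hψ.landing_sq ha hξ
  refine ⟨k, hk0, fun ζ hζ => ?_⟩
  obtain ⟨n, hn⟩ := exists_pow_fixed_of_halfCircle hhalf hsq hqc hqk (subset_closure hζ)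
  -- Eventual periodicity becomes periodicity: `ζ` and its `k`-th image both land at `a`, where
  -- iterated doubling is injective.
  have h : (ζ ^ 2 ^ k) ^ 2 ^ (k * n) = ζ ^ 2 ^ (k * n) := by
    rw [pow_right_comm]
    exact hn
  exact hψ.injOn_landing_pow ha ha0 (k * n) (hψ.landing_pow ha k hζ) hζ h

end IsInverseBottcher
end Yoccoz

namespace Yoccoz

/-! ### Inverse branches at a repelling fixed point -/

/-- A holomorphic map has a contracting local inverse at a repelling fixed point. -/
lemma exists_contracting_inverse {f : ℂ → ℂ} {α : ℂ} (hd : ∀ᶠ z in 𝓝 α, DifferentiableAt ℂ f z)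
    (hα : f α = α) (hrep : 1 < ‖deriv f α‖) :
    ∃ (e : OpenPartialHomeomorph ℂ ℂ) (κ η : ℝ), (∀ z, e z = f z) ∧ α ∈ e.source ∧ 0 ≤ κ ∧ κ < 1 ∧
      0 < η ∧ Metric.ball α η ⊆ e.target ∧
      ∀ z ∈ Metric.ball α η, ‖e.symm z - α‖ ≤ κ * ‖z - α‖ := by
  have hd0 : deriv f α ≠ 0 := norm_pos_iff.1 (by linarith)
  have hs : HasStrictDerivAt f (deriv f α) α :=
    (Complex.analyticAt_iff_eventually_differentiableAt.2 hd).hasStrictDerivAt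
  set e := (hs.hasStrictFDerivAt_equiv hd0).toOpenPartialHomeomorph f
  have hef : ∀ z, e z = f z := fun z => rfl
  have hαs : α ∈ e.source := (hs.hasStrictFDerivAt_equiv hd0).mem_toOpenPartialHomeomorph_source
  have hαt : α ∈ e.target := by
    have := e.map_source hαs
    rwa [hef, hα] at this
  have hsymm : e.symm α = α := by
    have := e.left_inv hαs
    rwa [hef, hα] at this
  have hder : HasDerivAt e.symm (deriv f α)⁻¹ α := by
    refine e.hasDerivAt_symm hαt hd0 ?_
    rw [hsymm]
    exact hs.hasDerivAt
  have hinv : ‖(deriv f α)⁻¹‖ < 1 := by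
    rw [norm_inv]
    exact inv_lt_one_of_one_lt₀ hrep
  set κ := (1 + ‖(deriv f α)⁻¹‖) / 2 with hκ
  have hκ0 : 0 < κ - ‖(deriv f α)⁻¹‖ := by rw [hκ]; linarith
  have hev := (hasDerivAt_iff_isLittleO.1 hder).def hκ0
  obtain ⟨η, hη, hball⟩ := Metric.eventually_nhds_iff_ball.1
    (hev.and (e.open_target.eventually_mem hαt))
  refine ⟨e, κ, η, hef, hαs, by positivity, by rw [hκ]; linarith, hη,
    fun z hz => (hball z hz).2, fun z hz => ?_⟩
  have h1 := (hball z hz).1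
  rw [hsymm, smul_eq_mul] at h1
  have h2 : e.symm z - α = (e.symm z - α - (z - α) * (deriv f α)⁻¹) + (z - α) * (deriv f α)⁻¹ := by
    ring
  rw [h2]
  refine (norm_add_le _ _).trans ?_
  rw [norm_mul]
  linarith

namespace PuzzleData

variable {f : ℂ → ℂ} {U' U : Set ℂ}

/-- At a repelling fixed point `α` the conjugate polynomial has inverse branches which contract a
disk. -/
lemma exists_inverseBranch (P : PuzzleData f U') (hf : IsQuadraticLike f U' U)
    (hrep : 1 < ‖deriv f P.α‖) :
    ∃ N s Φ, 0 < N ∧ IsInverseBranch P.c (P.h P.α) N s Φ := by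
  have hdiff : ∀ᶠ z in 𝓝 P.α, DifferentiableAt ℂ f z := by
    filter_upwards [hf.isOpen_dom.mem_nhds P.α_mem] with z hz
    exact hf.holo.differentiableAt (hf.isOpen_dom.mem_nhds hz)
  obtain ⟨e, κ, η₀, hef, hαs, hκ0, hκ1, hη₀, htar, hcon⟩ :=
    exists_contracting_inverse hdiff P.α_fixed hrep
  have hαh : P.α ∈ P.h.source := P.julia_source P.α_mem_julia
  obtain ⟨η₁, hη₁, hsrc⟩ := Metric.isOpen_iff.1 P.h.open_source P.α hαh
  set η := min η₀ η₁ with hη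
  have hηpos : 0 < η := lt_min hη₀ hη₁
  set B := Metric.ball P.α η with hB
  have hB0 : B ⊆ Metric.ball P.α η₀ := Metric.ball_subset_ball (min_le_left _ _)
  have hBsrc : B ⊆ P.h.source := (Metric.ball_subset_ball (min_le_right _ _)).trans hsrc
  have hBe : MapsTo e.symm B B := by
    intro z hz
    rw [hB, Metric.mem_ball, dist_eq_norm] at hz ⊢
    refine (hcon z (hB0 (by rwa [hB, Metric.mem_ball, dist_eq_norm]))).trans_lt ?_
    nlinarith [norm_nonneg (z - P.α)]
  have hBit : ∀ n, MapsTo e.symm^[n] B B := fun n => hBe.iterate n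
  have hnorm : ∀ n, ∀ z ∈ B, ‖e.symm^[n] z - P.α‖ ≤ κ ^ n * ‖z - P.α‖ := by
    intro n z hz
    induction n with
    | zero => simp
    | succ n ih =>
      rw [Function.iterate_succ_apply', pow_succ', mul_assoc]
      exact (hcon _ (hB0 (hBit n hz))).trans (by gcongr)
  have hcont : ∀ n, ContinuousOn e.symm^[n] B := by
    intro n
    induction n with
    | zero => exact continuousOn_id
    | succ n ih =>
      rw [Function.iterate_succ']
      exact (e.continuousOn_symm.mono (hB0.trans htar)).comp ih (hBit n)
  have hconj : ∀ n, ∀ z ∈ B, (quad P.c)^[n] (P.h (e.symm^[n] z)) = P.h z := by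
    intro n z hz
    induction n with
    | zero => rfl
    | succ n ih =>
      have hz1 : e.symm^[n] z ∈ B := hBit n hz
      have hfe : f (e.symm (e.symm^[n] z)) = e.symm^[n] z := by
        rw [← hef]
        exact e.right_inv (htar (hB0 hz1))
      rw [Function.iterate_succ_apply, Function.iterate_succ_apply' e.symm,
        ← P.conj.conj _ (hBsrc (hBe hz1)) (by rw [hfe]; exact hBsrc hz1), hfe, ih]
  set a := P.h P.α with ha
  have hat : a ∈ P.h.target := P.h.map_source hαh
  have hsymma : P.h.symm a = P.α := P.h.left_inv hαh
  have hsymmB : ∀ᶠ z in 𝓝 a, P.h.symm z ∈ B := by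
    refine (P.h.symm.continuousAt hat).eventually ?_
    rw [hsymma]
    exact Metric.ball_mem_nhds _ hηpos
  obtain ⟨s, hs, hball⟩ := Metric.eventually_nhds_iff_ball.1
    (hsymmB.and (P.h.open_target.eventually_mem hat))
  obtain ⟨δ, hδ, hδs⟩ := Metric.eventually_nhds_iff_ball.1
    ((P.h.continuousAt hαh).eventually (Metric.ball_mem_nhds a (half_pos hs)))
  have hlim : Tendsto (fun n : ℕ => κ ^ n * η) atTop (𝓝 0) := by
    simpa using (tendsto_pow_atTop_nhds_zero_of_lt_one hκ0 hκ1).mul_const η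
  -- With this `N`, the inverse iterate brings the disk so close to `α` that its image under `h`
  -- falls in the disk of half the radius.
  obtain ⟨N, hNδ, hN⟩ := ((hlim.eventually (gt_mem_nhds hδ)).and (eventually_gt_atTop 0)).exists
  refine ⟨N, s, fun z => P.h (e.symm^[N] (P.h.symm z)), hN, hs, ?_, ?_, ?_, ?_⟩
  · refine P.h.continuousOn.comp ((hcont N).comp (P.h.continuousOn_symm.mono
      fun z hz => (hball z hz).2) fun z hz => (hball z hz).1) fun z hz => ?_
    exact hBsrc (hBit N (hball z hz).1)
  · intro z hz
    refine hδs _ ?_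
    have hzB := (hball z hz).1
    rw [Metric.mem_ball, dist_eq_norm]
    refine (hnorm N _ hzB).trans_lt (lt_of_le_of_lt ?_ hNδ)
    rw [hB, Metric.mem_ball, dist_eq_norm] at hzB
    gcongr
  · intro z hz
    rw [hconj N _ (hball z hz).1, P.h.right_inv (hball z hz).2]
  · have hfc : ContinuousAt f P.α := hf.continuousAt P.α_mem
    have hft : Tendsto f (𝓝 P.α) (𝓝 P.α) := by
      have := hfc.tendsto
      rwa [P.α_fixed] at this
    have hleft : ∀ n, ∀ᶠ z in 𝓝 P.α, e.symm^[n] (f^[n] z) = z ∧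
        (quad P.c)^[n] (P.h z) = P.h (f^[n] z) ∧ f^[n] z ∈ P.h.source := by
      intro n
      induction n with
      | zero =>
        filter_upwards [P.h.open_source.mem_nhds hαh] with z hz
        exact ⟨rfl, rfl, hz⟩
      | succ n ih =>
        filter_upwards [hft.eventually ih, e.open_source.mem_nhds hαs,
          P.h.open_source.mem_nhds hαh, hft.eventually (P.h.open_source.mem_nhds hαh)]
          with z ⟨h1, h2, h3⟩ h4 h5 h6
        rw [Function.iterate_succ_apply' e.symm, Function.iterate_succ_apply,
          Function.iterate_succ_apply, h1, ← hef, e.left_inv h4, ← P.conj.conj z h5 h6, hef]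
        exact ⟨rfl, h2, h3⟩
    have ht : Tendsto P.h.symm (𝓝 a) (𝓝 P.α) := by
      have := (P.h.symm.continuousAt hat).tendsto
      rwa [hsymma] at this
    filter_upwards [ht.eventually (hleft N), P.h.open_target.mem_nhds hat] with z ⟨h1, h2, h3⟩ h4
    rw [P.h.right_inv h4] at h2
    rw [h2, P.h.left_inv h3, h1, P.h.right_inv h4]

/-- Puzzle data of a quadratic-like map with repelling fixed points are admissible if the critical
orbit does not hit `α`. -/
lemma isAdmissible (P : PuzzleData f U') (hf : IsQuadraticLike f U' U)
    (hrep : ∀ z ∈ U', f z = z → 1 < ‖deriv f z‖) (hland : ∀ n : ℕ, f^[n] 0 ≠ P.α) :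
    P.IsAdmissible U := by
  have h0 := P.zero_julia hf
  have hne : P.h P.α ≠ 0 := fun h => by
    refine hland 0 (P.h.injOn (P.julia_source h0.1) (P.julia_source P.α_mem_julia) ?_)
    rw [h0.2, h]
  obtain ⟨N, s, Φ, hN, hΦ⟩ := P.exists_inverseBranch hf (hrep P.α P.α_mem P.α_fixed)
  obtain ⟨p, hp, hpA⟩ := P.bottcher.exists_common_period P.fixed hne hN hΦ
  have hspec : P.period ∈ {p : ℕ | 0 < p ∧ ∀ ζ ∈ landingAngles P.ψ (P.h P.α), ζ ^ 2 ^ p = ζ} :=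
    Nat.sInf_mem ⟨p, hp, hpA⟩
  refine ⟨hf, ⟨P.bottcher, P.fixed, hne, fun h => ?_, ?_, P.α_dividing⟩, hland, hspec.1, hspec.2⟩
  · refine hland 1 (P.h.injOn (P.julia_source (map_mem_filledJulia h0.1))
      (P.julia_source P.α_mem_julia) ?_)
    rw [← h]
    rw [P.julia_conj h0.1, h0.2]
    simp [quad]
  -- A common period makes all landing directions roots of unity of order dividing `2 ^ p - 1`, so
  -- they are finite in number.
  · have h1 : 0 < 2 ^ p - 1 := Nat.sub_pos_of_lt (Nat.one_lt_two_pow hp.ne')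
    have hfin : {u : ℂ | u ^ (2 ^ p - 1) = 1}.Finite :=
      ((Polynomial.nthRootsFinset (2 ^ p - 1) (1 : ℂ)).finite_toSet).subset fun u hu =>
        (Polynomial.mem_nthRootsFinset h1 (1 : ℂ)).2 hu
    refine Finite.of_finite_image (f := fun ζ : Circle => (ζ : ℂ)) (hfin.subset ?_)
      Circle.coe_injective.injOn
    rintro _ ⟨ζ, hζ, rfl⟩
    have h2 : ζ ^ (2 ^ p - 1) = 1 := by
      have h3 := hpA ζ hζ
      have h4 : 2 ^ p = 2 ^ p - 1 + 1 := by omega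
      rw [h4, pow_succ] at h3
      exact mul_eq_right.1 h3
    rw [mem_ofPred_eq, ← Circle.coe_pow, h2, Circle.coe_one]

end PuzzleData
end Yoccoz

theorem proposition3p1 (f : ℂ → ℂ) (U' U : Set ℂ)
    (hf : Yoccoz.IsQuadraticLike f U' U)
    (hconn : IsConnected (Yoccoz.filledJulia f U'))
    (hrep : ∀ z ∈ U', f z = z → 1 < ‖deriv f z‖)
    (P : Yoccoz.PuzzleData f U')
    (hland : ∀ n : ℕ, f^[n] 0 ≠ P.α)
    (hren : ¬ P.ImmediatelyRenormalizable) :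
    (∃ V, P.IsNestPiece 0 V) ∧
    (∀ V, P.IsNestPiece 0 V → Yoccoz.CompactlyContained V P.criticalPiece) ∧
    ∀ (n : ℕ) (V V' : Set ℂ), P.IsNestPiece n V → Yoccoz.IsFirstReturnPullback f U' V V' →
      Yoccoz.CompactlyContained V' V := by
  have Q := P.isAdmissible hf hrep hland
  refine ⟨(Q.exists_initial hren).imp fun V => Yoccoz.PuzzleData.IsNestPiece.zero, ?_,
    fun n V V' hV h => Q.nest_compactlyContained hV h⟩
  rintro V ⟨hV⟩
  exact Q.initial_compactlyContained hV
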